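/- Work with smooth real manifolds (or, throughout, with complex manifolds and holomorphic maps), finite dimensional, Hausdorff and second countable. A \emph{local model} $(H,\mathfrak g)$ is a Lie group $H$ with Lie algebra $\mathfrak h$, a finite dimensional Lie algebra $\mathfrak g$ on which $H$ acts smoothly by Lie algebra automorphisms (the action of $h$ is written $\mathrm{Ad}(h)$), and an injective, $H$-equivariant Lie algebra morphism $\mathfrak h\to\mathfrak g$. An \emph{$(H,\mathfrak g)$-geometry} on $M$ is a principal right $H$-bundle $E\to M$ with a $\mathfrak g$-valued 1-form $\omega$ on $E$ such that $r_h^*\omega=\mathrm{Ad}(h)^{-1}\omega$ for $h\in H$, each $\omega_e:T_eE\to\mathfrak g$ is a linear isomorphism, and $\omega$ takes the constant value $A$ on the vector field on $E$ generated by $A\in\mathfrak h$ through the right action. Its \emph{curvature} is the function $K:E\to\mathfrak g\otimes\Lambda^2(\mathfrak g/\mathfrak h)^*$ with \[ d\omega+\tfrac12[\omega,\omega]=K\,\bar\omega\wedge\bar\omega,\qquad \bar\omega=\omega \bmod \mathfrak h,\qquad (\bar\omega\wedge\bar\omega)(v,w)=\bar\omega(v)\wedge\bar\omega(w). \] It is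 unique, and it exists if the derivative at $1$ of the $H$-action on $\mathfrak g$ is the bracket with $\mathfrak h\subset\mathfrak g$ (as holds for the local model of any homogeneous space $G/H$). A \emph{model morphism} $\Phi:(H_0,\mathfrak g_0)\to(H_1,\mathfrak g_1)$ is a Lie group morphism $\Phi:H_0\to H_1$ with a linear map $\Phi:\mathfrak g_0\to\mathfrak g_1$ extending the induced map $\mathfrak h_0\to\mathfrak h_1$ and satisfying $\Phi(\mathrm{Ad}(h_0)A_0)=\mathrm{Ad}(\Phi(h_0))\Phi(A_0)$; it is a \emph{disguise} if the induced map $\mathfrak g_0/\mathfrak h_0\to\mathfrak g_1/\mathfrak h_1$ is an isomorphism. A \emph{$\Phi$-morphism} from an $(H_0,\mathfrak g_0)$-geometry $(E_0,\omega_0)$ to an $(H_1,\mathfrak g_1)$-geometry $(E_1,\omega_1)$ is a smooth map $F:E_0\to E_1$ with $F(e_0h_0)=F(e_0)\Phi(h_0)$ and $F^*\omega_1=\Phi\omega_0$. A \emph{local isomorphism} of $(H,\mathfrak g)$-geometries is an $H$-equivariant local diffeomorphism of the total spaces that pulls back the one Cartan connection to the other. \textbf{Theorem.} Let $\Phi:(H_0,\mathfrak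 g_0)\to(H_1,\mathfrak g_1)$ be a disguise and $E_0\to M$ an $(H_0,\mathfrak g_0)$-geometry with Cartan connection $\omega_0$. Let $E_1=E_0\times_{H_0}H_1$ be the quotient of $E_0\times H_1$ by the right $H_0$-action $(e_0,h_1)h_0=(e_0h_0,\Phi(h_0)^{-1}h_1)$. (1) $E_1$ with the quotient topology is Hausdorff and second countable and has a manifold structure for which $E_0\times H_1\to E_1$ is a smooth submersion. (2) There is a unique 1-form $\omega_1$ on $E_1$ whose pullback to $E_0\times H_1$ is, at $(e_0,h_1)$, \[ \omega_1=h_1^{-1}\,dh_1+\mathrm{Ad}(h_1)^{-1}\Phi\omega_0, \] and $E_1\to M$, $[e_0,h_1]\mapsto\pi_0(e_0)$ (with $\pi_0:E_0\to M$ the bundle projection), with the right action $[e_0,h_1]k=[e_0,h_1k]$ and the 1-form $\omega_1$, is an $(H_1,\mathfrak g_1)$-geometry. (3) $F_{\mathrm{disguise}}:E_0\to E_1$, $e_0\mapsto[e_0,1]$, is a $\Phi$-morphism. (4) If $K_0$ and $K_1$ are the curvatures of $E_0$ and $E_1$, then, pulled back to $E_0\times H_1$, at $(e_0,h_1)$,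 \[ K_1\,\bar\omega_1\wedge\bar\omega_1=\mathrm{Ad}(h_1)^{-1}\Bigl(\Phi\bigl(K_0\,\bar\omega_0\wedge\bar\omega_0\bigr)+\tfrac12[\Phi\omega_0,\Phi\omega_0]-\tfrac12\Phi[\omega_0,\omega_0]\Bigr). \] (5) For every $(H_1,\mathfrak g_1)$-geometry $E_1'\to M'$, every $\Phi$-morphism $F:E_0\to E_1'$ factors as $F=F_1\circ F_{\mathrm{disguise}}$ for a unique local isomorphism $F_1:E_1\to E_1'$ of $(H_1,\mathfrak g_1)$-geometries. -/

import Mathlib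

open Function Set
open scoped Manifold ContDiff

noncomputable section

namespace CartanGeom

/-! All manifolds are smooth manifolds without boundary, modelled on finite dimensional normed
spaces over `𝕜`. For `𝕜 = ℝ`, `ContMDiff _ _ ∞` means smooth; for `𝕜 = ℂ` it means holomorphic. -/

section Forms

variable {𝕜 : Type*} [RCLike 𝕜]

/-- The (not necessarily smooth) `𝔤`-valued 1-forms on a manifold `M` modelled on `E`. -/
abbrev OneForm (𝕜 : Type*) [RCLike 𝕜] (E : Type*) [NormedAddCommGroup E] [NormedSpace 𝕜 E]
    (M : Type*) [TopologicalSpace M] [ChartedSpace E M]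
    (𝔤 : Type*) [NormedAddCommGroup 𝔤] [NormedSpace 𝕜 𝔤] :=
  ∀ x : M, TangentSpace 𝓘(𝕜, E) x →L[𝕜] 𝔤

variable {E : Type*} [NormedAddCommGroup E] [NormedSpace 𝕜 E]
  {M : Type*} [TopologicalSpace M] [ChartedSpace E M]
  {𝔤 : Type*} [NormedAddCommGroup 𝔤] [NormedSpace 𝕜 𝔤]

/-- A 1-form is smooth if it is smooth as a function on the tangent bundle. -/
def OneForm.IsSmooth [IsManifold 𝓘(𝕜, E) ∞ M] (α : OneForm 𝕜 E M 𝔤) : Prop :=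
  ContMDiff (𝓘(𝕜, E).tangent) 𝓘(𝕜, 𝔤) ∞ (fun v : TangentBundle 𝓘(𝕜, E) M => α v.1 v.2)

/-- The coordinate expression of `α` in the preferred chart at `x`. -/
def OneForm.inChart (α : OneForm 𝕜 E M 𝔤) (x : M) : E → E →L[𝕜] 𝔤 := fun y =>
  (α ((extChartAt 𝓘(𝕜, E) x).symm y)).comp
    (mfderiv 𝓘(𝕜, E) 𝓘(𝕜, E) (extChartAt 𝓘(𝕜, E) x).symm y)

/-- The exterior derivative `dα` at `x`, computed in the preferred chart at `x` (whose derivative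
at `x` is the identification of the tangent space at `x` with `E`), with the normalization
`dα(V,W) = V (α W) - W (α V) - α [V,W]`. -/
def OneForm.d (α : OneForm 𝕜 E M 𝔤) (x : M) (v w : TangentSpace 𝓘(𝕜, E) x) : 𝔤 :=
  extDeriv (fun y => ContinuousAlternatingMap.ofSubsingleton 𝕜 E 𝔤 (0 : Fin 1) (α.inChart x y))
    (extChartAt 𝓘(𝕜, E) x x) ![v, w]

end Forms

/-- A local model `(H, 𝔤)`: the Lie group `H` acts smoothly and linearly on `𝔤` by automorphisms of
a Lie bracket, and the Lie algebra of `H` is included in `𝔤` as a Lie subalgebra and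
`H`-submodule. -/
structure LocalModel (𝕜 : Type*) [RCLike 𝕜]
    (EH : Type*) [NormedAddCommGroup EH] [NormedSpace 𝕜 EH]
    (H : Type*) [TopologicalSpace H] [ChartedSpace EH H] [Group H] [LieGroup 𝓘(𝕜, EH) ∞ H]
    (𝔤 : Type*) [NormedAddCommGroup 𝔤] [NormedSpace 𝕜 𝔤] where
  /-- the Lie bracket of `𝔤` -/
  bracket : 𝔤 →ₗ[𝕜] 𝔤 →ₗ[𝕜] 𝔤
  bracket_self : ∀ A, bracket A A = 0
  jacobi : ∀ A B C, bracket A (bracket B C) = bracket (bracket A B) C + bracket B (bracket A C)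
  /-- the action of `H` on `𝔤` -/
  Ad : Representation 𝕜 H 𝔤
  contMDiff_Ad : ContMDiff (𝓘(𝕜, EH).prod 𝓘(𝕜, 𝔤)) 𝓘(𝕜, 𝔤) ∞ (fun p : H × 𝔤 => Ad p.1 p.2)
  Ad_bracket : ∀ h A B, Ad h (bracket A B) = bracket (Ad h A) (Ad h B)
  /-- the inclusion of the Lie algebra of `H` -/
  incl : GroupLieAlgebra 𝓘(𝕜, EH) H →ₗ[𝕜] 𝔤
  incl_injective : Injective incl
  incl_bracket : ∀ X Y : GroupLieAlgebra 𝓘(𝕜, EH) H, incl ⁅X, Y⁆ = bracket (incl X) (incl Y)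
  incl_Ad : ∀ (h : H) (X : GroupLieAlgebra 𝓘(𝕜, EH) H),
    incl (mfderiv 𝓘(𝕜, EH) 𝓘(𝕜, EH) (fun k : H => h * k * h⁻¹) 1 X) = Ad h (incl X)

section Model

variable {𝕜 : Type*} [RCLike 𝕜]
  {EH : Type*} [NormedAddCommGroup EH] [NormedSpace 𝕜 EH]
  {H : Type*} [TopologicalSpace H] [ChartedSpace EH H] [Group H] [LieGroup 𝓘(𝕜, EH) ∞ H]
  {𝔤 : Type*} [NormedAddCommGroup 𝔤] [NormedSpace 𝕜 𝔤]

/-- The subspace `𝔥 ⊆ 𝔤`. -/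
abbrev LocalModel.sub (𝓜 : LocalModel 𝕜 EH H 𝔤) : Submodule 𝕜 𝔤 := LinearMap.range 𝓜.incl

/-- The infinitesimal action of `𝔥` on `𝔤` is given by the bracket of `𝔤`. -/
def LocalModel.InfinitesimallyAdjoint (𝓜 : LocalModel 𝕜 EH H 𝔤) : Prop :=
  ∀ (X : GroupLieAlgebra 𝓘(𝕜, EH) H) (A : 𝔤),
    mfderiv 𝓘(𝕜, EH) 𝓘(𝕜, 𝔤) (fun h : H => 𝓜.Ad h A) 1 X = 𝓜.bracket (𝓜.incl X) A

/-- For a linear map `α` with values in `𝔤`, this is the alternating form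
`[α, α](v, w) = [α v, α w] - [α w, α v]`. -/
def LocalModel.wedge (𝓜 : LocalModel 𝕜 EH H 𝔤) {V : Type*} (α : V → 𝔤) (v w : V) : 𝔤 :=
  𝓜.bracket (α v) (α w) - 𝓜.bracket (α w) (α v)

/-- The Maurer-Cartan form `h⁻¹ dh` of `H` at `h`, with values in the Lie algebra of `H`. -/
def maurerCartan (𝕜 : Type*) [RCLike 𝕜] {EH : Type*} [NormedAddCommGroup EH] [NormedSpace 𝕜 EH]
    {H : Type*} [TopologicalSpace H] [ChartedSpace EH H] [Group H] (h : H) :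
    TangentSpace 𝓘(𝕜, EH) h →ₗ[𝕜] GroupLieAlgebra 𝓘(𝕜, EH) H :=
  (mfderiv 𝓘(𝕜, EH) 𝓘(𝕜, EH) (fun k : H => h⁻¹ * k) h).toLinearMap

end Model

section ModelMorphism

variable {𝕜 : Type*} [RCLike 𝕜]
  {EH₀ : Type*} [NormedAddCommGroup EH₀] [NormedSpace 𝕜 EH₀]
  {H₀ : Type*} [TopologicalSpace H₀] [ChartedSpace EH₀ H₀] [Group H₀]
  [LieGroup 𝓘(𝕜, EH₀) ∞ H₀]
  {𝔤₀ : Type*} [NormedAddCommGroup 𝔤₀] [NormedSpace 𝕜 𝔤₀]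
  {EH₁ : Type*} [NormedAddCommGroup EH₁] [NormedSpace 𝕜 EH₁]
  {H₁ : Type*} [TopologicalSpace H₁] [ChartedSpace EH₁ H₁] [Group H₁]
  [LieGroup 𝓘(𝕜, EH₁) ∞ H₁]
  {𝔤₁ : Type*} [NormedAddCommGroup 𝔤₁] [NormedSpace 𝕜 𝔤₁]

/-- A morphism of local models: a Lie group morphism `H₀ → H₁` and a linear map `𝔤₀ → 𝔤₁`
(which need not be a Lie algebra morphism). -/
structure ModelMorphism (𝓜₀ : LocalModel 𝕜 EH₀ H₀ 𝔤₀) (𝓜₁ : LocalModel 𝕜 EH₁ H₁ 𝔤₁) where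
  /-- the Lie group morphism -/
  grp : ContMDiffMonoidMorphism 𝓘(𝕜, EH₀) 𝓘(𝕜, EH₁) ∞ H₀ H₁
  /-- the linear map -/
  lin : 𝔤₀ →ₗ[𝕜] 𝔤₁
  lin_incl : ∀ X : GroupLieAlgebra 𝓘(𝕜, EH₀) H₀,
    lin (𝓜₀.incl X) = 𝓜₁.incl (mfderiv 𝓘(𝕜, EH₀) 𝓘(𝕜, EH₁) grp 1 X)
  lin_Ad : ∀ (h : H₀) (A : 𝔤₀), lin (𝓜₀.Ad h A) = 𝓜₁.Ad (grp h) (lin A)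

variable {𝓜₀ : LocalModel 𝕜 EH₀ H₀ 𝔤₀} {𝓜₁ : LocalModel 𝕜 EH₁ H₁ 𝔤₁}

/-- The induced linear map `𝔤₀/𝔥₀ → 𝔤₁/𝔥₁`. -/
def ModelMorphism.baseMap (Φ : ModelMorphism 𝓜₀ 𝓜₁) : (𝔤₀ ⧸ 𝓜₀.sub) →ₗ[𝕜] (𝔤₁ ⧸ 𝓜₁.sub) :=
  Submodule.mapQ 𝓜₀.sub 𝓜₁.sub Φ.lin (by
    rintro _ ⟨X, rfl⟩
    exact ⟨_, (Φ.lin_incl X).symm⟩)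

/-- A disguise is a model morphism which induces an isomorphism `𝔤₀/𝔥₀ → 𝔤₁/𝔥₁`
(which is automatically `H₀`-equivariant). -/
def ModelMorphism.IsDisguise (Φ : ModelMorphism 𝓜₀ 𝓜₁) : Prop := Bijective Φ.baseMap

end ModelMorphism

/-- A smooth principal right `H`-bundle `E → M`. -/
structure PrincipalBundle (𝕜 : Type*) [RCLike 𝕜]
    (EH : Type*) [NormedAddCommGroup EH] [NormedSpace 𝕜 EH]
    (H : Type*) [TopologicalSpace H] [ChartedSpace EH H] [Group H]
    (EM : Type*) [NormedAddCommGroup EM] [NormedSpace 𝕜 EM]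
    (M : Type*) [TopologicalSpace M] [ChartedSpace EM M]
    (EE : Type*) [NormedAddCommGroup EE] [NormedSpace 𝕜 EE]
    (E : Type*) [TopologicalSpace E] [ChartedSpace EE E] where
  proj : E → M
  /-- the right action `e h` -/
  act : E → H → E
  act_one : ∀ e, act e 1 = e
  act_mul : ∀ e h k, act e (h * k) = act (act e h) k
  contMDiff_proj : ContMDiff 𝓘(𝕜, EE) 𝓘(𝕜, EM) ∞ proj
  contMDiff_act : ContMDiff (𝓘(𝕜, EE).prod 𝓘(𝕜, EH)) 𝓘(𝕜, EE) ∞ (fun p : E × H => act p.1 p.2)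
  proj_act : ∀ e h, proj (act e h) = proj e
  /-- equivariant local triviality -/
  locally_trivial : ∀ m : M, ∃ U : Set M, IsOpen U ∧ m ∈ U ∧
    ∃ φ : PartialDiffeomorph 𝓘(𝕜, EE) (𝓘(𝕜, EM).prod 𝓘(𝕜, EH)) E (M × H) ∞,
      φ.source = proj ⁻¹' U ∧ φ.target = U ×ˢ univ ∧
      (∀ e ∈ φ.source, (φ e).1 = proj e) ∧
      ∀ e ∈ φ.source, ∀ h, φ (act e h) = ((φ e).1, (φ e).2 * h)

/-- A Cartan geometry on `M` modelled on the local model `(H, 𝔤)`. -/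
structure CartanGeometry {𝕜 : Type*} [RCLike 𝕜]
    {EH : Type*} [NormedAddCommGroup EH] [NormedSpace 𝕜 EH]
    {H : Type*} [TopologicalSpace H] [ChartedSpace EH H] [Group H] [LieGroup 𝓘(𝕜, EH) ∞ H]
    {𝔤 : Type*} [NormedAddCommGroup 𝔤] [NormedSpace 𝕜 𝔤]
    (𝓜 : LocalModel 𝕜 EH H 𝔤)
    (EM : Type*) [NormedAddCommGroup EM] [NormedSpace 𝕜 EM]
    (M : Type*) [TopologicalSpace M] [ChartedSpace EM M]
    (EE : Type*) [NormedAddCommGroup EE] [NormedSpace 𝕜 EE]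
    (E : Type*) [TopologicalSpace E] [ChartedSpace EE E] [IsManifold 𝓘(𝕜, EE) ∞ E]
    extends PrincipalBundle 𝕜 EH H EM M EE E where
  /-- the Cartan connection -/
  conn : OneForm 𝕜 EE E 𝔤
  smooth : conn.IsSmooth
  equivariant : ∀ (h : H) (e : E) (v : TangentSpace 𝓘(𝕜, EE) e),
    conn (act e h) (mfderiv 𝓘(𝕜, EE) 𝓘(𝕜, EE) (fun e' => act e' h) e v) = 𝓜.Ad h⁻¹ (conn e v)
  bijective : ∀ e, Bijective (conn e)
  /-- for `X ∈ 𝔥`, the constant vector field of `X` is the velocity of the right action of `H`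
  in the direction `X` -/
  vertical : ∀ (e : E) (X : GroupLieAlgebra 𝓘(𝕜, EH) H),
    conn (act e 1) (mfderiv 𝓘(𝕜, EH) 𝓘(𝕜, EE) (fun h => act e h) 1 X) = 𝓜.incl X

section Geometry

variable {𝕜 : Type*} [RCLike 𝕜]
  {EH : Type*} [NormedAddCommGroup EH] [NormedSpace 𝕜 EH]
  {H : Type*} [TopologicalSpace H] [ChartedSpace EH H] [Group H] [LieGroup 𝓘(𝕜, EH) ∞ H]
  {𝔤 : Type*} [NormedAddCommGroup 𝔤] [NormedSpace 𝕜 𝔤] {𝓜 : LocalModel 𝕜 EH H 𝔤}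
  {EM : Type*} [NormedAddCommGroup EM] [NormedSpace 𝕜 EM]
  {M : Type*} [TopologicalSpace M] [ChartedSpace EM M]
  {EE : Type*} [NormedAddCommGroup EE] [NormedSpace 𝕜 EE]
  {E : Type*} [TopologicalSpace E] [ChartedSpace EE E] [IsManifold 𝓘(𝕜, EE) ∞ E]

/-- `K : E → 𝔤 ⊗ Λ²(𝔤/𝔥)^*` is the curvature function of the geometry:
`dω + (1/2) [ω, ω] = K (ω̄ ∧ ω̄)`, where `ω̄` is the soldering form `ω mod 𝔥`. -/
def CartanGeometry.IsCurvature (G : CartanGeometry 𝓜 EM M EE E)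
    (K : E → (𝔤 ⧸ 𝓜.sub) [⋀^Fin 2]→ₗ[𝕜] 𝔤) : Prop :=
  ∀ (e : E) (v w : TangentSpace 𝓘(𝕜, EE) e),
    G.conn.d e v w + (1 / 2 : 𝕜) • 𝓜.wedge (G.conn e) v w =
      K e ![𝓜.sub.mkQ (G.conn e v), 𝓜.sub.mkQ (G.conn e w)]

variable {EM' : Type*} [NormedAddCommGroup EM'] [NormedSpace 𝕜 EM']
  {M' : Type*} [TopologicalSpace M'] [ChartedSpace EM' M']
  {EE' : Type*} [NormedAddCommGroup EE'] [NormedSpace 𝕜 EE']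
  {E' : Type*} [TopologicalSpace E'] [ChartedSpace EE' E'] [IsManifold 𝓘(𝕜, EE') ∞ E']

/-- A local isomorphism of geometries with the same local model: an `H`-equivariant local
diffeomorphism of the total spaces which matches the Cartan connections. -/
structure IsLocalIso (G : CartanGeometry 𝓜 EM M EE E) (G' : CartanGeometry 𝓜 EM' M' EE' E')
    (F : E → E') : Prop where
  isLocalDiffeomorph : IsLocalDiffeomorph 𝓘(𝕜, EE) 𝓘(𝕜, EE') ∞ F
  map_act : ∀ e h, F (G.act e h) = G'.act (F e) h
  pullback : ∀ (e : E) (v : TangentSpace 𝓘(𝕜, EE) e),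
    G'.conn (F e) (mfderiv 𝓘(𝕜, EE) 𝓘(𝕜, EE') F e v) = G.conn e v

end Geometry

section Morphism

variable {𝕜 : Type*} [RCLike 𝕜]
  {EH₀ : Type*} [NormedAddCommGroup EH₀] [NormedSpace 𝕜 EH₀]
  {H₀ : Type*} [TopologicalSpace H₀] [ChartedSpace EH₀ H₀] [Group H₀]
  [LieGroup 𝓘(𝕜, EH₀) ∞ H₀]
  {𝔤₀ : Type*} [NormedAddCommGroup 𝔤₀] [NormedSpace 𝕜 𝔤₀]
  {EH₁ : Type*} [NormedAddCommGroup EH₁] [NormedSpace 𝕜 EH₁]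
  {H₁ : Type*} [TopologicalSpace H₁] [ChartedSpace EH₁ H₁] [Group H₁]
  [LieGroup 𝓘(𝕜, EH₁) ∞ H₁]
  {𝔤₁ : Type*} [NormedAddCommGroup 𝔤₁] [NormedSpace 𝕜 𝔤₁]
  {𝓜₀ : LocalModel 𝕜 EH₀ H₀ 𝔤₀} {𝓜₁ : LocalModel 𝕜 EH₁ H₁ 𝔤₁}
  {EM₀ : Type*} [NormedAddCommGroup EM₀] [NormedSpace 𝕜 EM₀]
  {M₀ : Type*} [TopologicalSpace M₀] [ChartedSpace EM₀ M₀]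
  {EE₀ : Type*} [NormedAddCommGroup EE₀] [NormedSpace 𝕜 EE₀]
  {E₀ : Type*} [TopologicalSpace E₀] [ChartedSpace EE₀ E₀] [IsManifold 𝓘(𝕜, EE₀) ∞ E₀]
  {EM₁ : Type*} [NormedAddCommGroup EM₁] [NormedSpace 𝕜 EM₁]
  {M₁ : Type*} [TopologicalSpace M₁] [ChartedSpace EM₁ M₁]
  {EE₁ : Type*} [NormedAddCommGroup EE₁] [NormedSpace 𝕜 EE₁]
  {E₁ : Type*} [TopologicalSpace E₁] [ChartedSpace EE₁ E₁] [IsManifold 𝓘(𝕜, EE₁) ∞ E₁]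

/-- A morphism of Cartan geometries modelled on `Φ` (a `Φ`-morphism). -/
structure IsMorphism (Φ : ModelMorphism 𝓜₀ 𝓜₁) (G₀ : CartanGeometry 𝓜₀ EM₀ M₀ EE₀ E₀)
    (G₁ : CartanGeometry 𝓜₁ EM₁ M₁ EE₁ E₁) (F : E₀ → E₁) : Prop where
  contMDiff : ContMDiff 𝓘(𝕜, EE₀) 𝓘(𝕜, EE₁) ∞ F
  map_act : ∀ e h, F (G₀.act e h) = G₁.act (F e) (Φ.grp h)
  pullback : ∀ (e : E₀) (v : TangentSpace 𝓘(𝕜, EE₀) e),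
    G₁.conn (F e) (mfderiv 𝓘(𝕜, EE₀) 𝓘(𝕜, EE₁) F e v) = Φ.lin (G₀.conn e v)

/-- The equivalence relation on `E₀ × H₁` whose classes are the orbits of the right `H₀`-action
`(e₀, h₁) h₀ = (e₀ h₀, Φ(h₀)⁻¹ h₁)`. -/
def orbitSetoid (Φ : ModelMorphism 𝓜₀ 𝓜₁) (G₀ : CartanGeometry 𝓜₀ EM₀ M₀ EE₀ E₀) :
    Setoid (E₀ × H₁) where
  r p q := ∃ k : H₀, q = (G₀.act p.1 k, (Φ.grp k)⁻¹ * p.2)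
  iseqv :=
    { refl := fun p => ⟨1, by simp [G₀.act_one]⟩
      symm := by
        rintro p _ ⟨k, rfl⟩
        exact ⟨k⁻¹, by simp [← G₀.act_mul, G₀.act_one]⟩
      trans := by
        rintro p _ _ ⟨k, rfl⟩ ⟨l, rfl⟩
        exact ⟨k * l, by simp [G₀.act_mul, mul_assoc]⟩ }

/-- The quotient `E₁ = E₀ ×_{H₀} H₁`, with the quotient topology. -/
abbrev Extension (Φ : ModelMorphism 𝓜₀ 𝓜₁) (G₀ : CartanGeometry 𝓜₀ EM₀ M₀ EE₀ E₀) : Type _ :=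
  Quotient (orbitSetoid Φ G₀)

/-- The quotient map `E₀ × H₁ → E₀ ×_{H₀} H₁`. -/
def Extension.mk (Φ : ModelMorphism 𝓜₀ 𝓜₁) (G₀ : CartanGeometry 𝓜₀ EM₀ M₀ EE₀ E₀)
    (p : E₀ × H₁) : Extension Φ G₀ :=
  Quotient.mk (orbitSetoid Φ G₀) p

/-- The map `e₀ ↦ [(e₀, 1)]`. -/
def Extension.disguise (Φ : ModelMorphism 𝓜₀ 𝓜₁) (G₀ : CartanGeometry 𝓜₀ EM₀ M₀ EE₀ E₀)
    (e : E₀) : Extension Φ G₀ :=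
  Extension.mk Φ G₀ (e, 1)

/-- The 1-form `h₁⁻¹ dh₁ + Ad(h₁)⁻¹ Φ ω₀` on `E₀ × H₁` at `(e, h)`, on the tangent vector
`(v, w)`. -/
def productForm (Φ : ModelMorphism 𝓜₀ 𝓜₁) (G₀ : CartanGeometry 𝓜₀ EM₀ M₀ EE₀ E₀)
    (e : E₀) (h : H₁) (u : TangentSpace 𝓘(𝕜, EE₀) e × TangentSpace 𝓘(𝕜, EH₁) h) : 𝔤₁ :=
  𝓜₁.incl (maurerCartan 𝕜 h u.2) + 𝓜₁.Ad h⁻¹ (Φ.lin (G₀.conn e u.1))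

end Morphism

end CartanGeom

end

open CartanGeom

/-! Let `κ` be the `H₀`-coordinate of a point of `E₀` relative to a smooth local section `s`, so `e
= s(π₀ e) κ(e)`. Then `[e, h] ↦ (π₀ e, Φ(κ(e)) h)` trivializes the quotient over the domain of `s`.
Two such charts differ by left multiplication by a smooth `H₁`-valued function on the base, so they
glue to a manifold. The quotient map has smooth local sections through every point (`exists_lift`),
so it is a submersion and a form on the quotient is determined by its pullback.

The product form descends because it is invariant under `(e, h) ↦ (e k, Φ(k)⁻¹ h)` even when `k`
varies with the point (`productForm_gauge`): the derivative of `k` enters twice, with opposite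
signs. Two local lifts of one map differ by such a `k`, so pulling back along any lift gives the
same `ω₁` (`productForm_lift`, `conn_mk`). It is onto because a disguise gives `𝔤₁ = 𝔥₁ + Φ(𝔤₀)`,
and it is then injective by a dimension count.

The expression `dω + ½[ω, ω]` kills vertical vectors when the infinitesimal action is the bracket
(`CartanGeometry.d_vertical`), which yields the curvature function. To compare curvatures it
suffices to look at slices `E₀ × {h}`, where `ω₁` is the constant linear map `Ad(h)⁻¹ Φ` applied to
`ω₀`: exterior derivatives are natural (`OneForm.d_pullback`), and `𝔥₁`-components are invisible to
`K₁`. The last two terms of the formula measure the failure of `Φ` to respect brackets.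

For the universal property, equivariance forces `F₁[e, h] = F(e) h`. The product rule shows that it
matches the connections; these are coframes, so its derivative is invertible and the inverse
function theorem applies. -/

noncomputable section

namespace CartanGeom

/-! ### Gluing a manifold from local models -/

section ManifoldOfLocalModels

variable {𝕜 : Type*} [NontriviallyNormedField 𝕜]
  {E : Type*} [NormedAddCommGroup E] [NormedSpace 𝕜 E]
  {H : Type*} [TopologicalSpace H] {I : ModelWithCorners 𝕜 E H} {n : WithTop ℕ∞}
  {N : Type*} [TopologicalSpace N] [ChartedSpace H N] [IsManifold I n N]
  {X : Type*} [TopologicalSpace X]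

/-- A space covered by open subsets which are identified with open subsets of a manifold `N` by
homeomorphisms with smooth transition maps is a manifold. -/
theorem exists_chartedSpace_of_transition {ι : Type*} (T : ι → OpenPartialHomeomorph X N)
    (hcov : ∀ x, ∃ i, x ∈ (T i).source)
    (hT : ∀ i j, ContMDiffOn I I n ((T i).symm ≫ₕ T j) ((T i).symm ≫ₕ T j).source) :
    ∃ (_ : ChartedSpace H X) (_ : IsManifold I n X),
      (∀ i, ContMDiffOn I I n (T i) (T i).source) ∧
      ∀ i, ContMDiffOn I I n (T i).symm (T i).target := by
  choose idx hidx using hcov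
  let cs : ChartedSpace H X :=
    { atlas := {e | ∃ i, ∃ c ∈ atlas H N, e = T i ≫ₕ c}
      chartAt := fun x => T (idx x) ≫ₕ chartAt H (T (idx x) x)
      mem_chart_source := fun x => by simp [hidx]
      chart_mem_atlas := fun x => ⟨_, _, chart_mem_atlas _ _, rfl⟩ }
  have hman : IsManifold I n X := by
    refine isManifold_of_contDiffOn I n X ?_
    rintro _ _ ⟨i, c, hc, rfl⟩ ⟨j, c', hc', rfl⟩
    rw [← contMDiffOn_iff_contDiffOn]
    have h1 : ContMDiffOn 𝓘(𝕜, E) I n I.symm (range I) := I.contMDiffOn_symm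
    have h2 : ContMDiffOn I I n c.symm c.target :=
      contMDiffOn_symm_of_mem_maximalAtlas (IsManifold.subset_maximalAtlas hc)
    have h3 : ContMDiffOn I I n c' c'.source :=
      contMDiffOn_of_mem_maximalAtlas (IsManifold.subset_maximalAtlas hc')
    have h4 : ContMDiff I 𝓘(𝕜, E) n I := I.contMDiff
    intro y hy
    simp only [mfld_simps] at hy
    refine ContMDiffAt.comp_contMDiffWithinAt (I' := I) y h4.contMDiffAt ?_
    refine ContMDiffAt.comp_contMDiffWithinAt (I' := I)
      (g := c' ∘ ((T i).symm ≫ₕ T j) ∘ c.symm) y ?_ ?_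
    · refine ContMDiffAt.comp (I' := I) _ (h3.contMDiffAt (c'.open_source.mem_nhds ?_)) ?_
      · simp [hy]
      refine ContMDiffAt.comp (I' := I) _ ((hT i j).contMDiffAt
        (((T i).symm ≫ₕ T j).open_source.mem_nhds ?_))
        (h2.contMDiffAt (c.open_target.mem_nhds ?_))
      · simp [hy]
      · simp [hy]
    · exact (h1 y (by simp [hy])).mono inter_subset_right
  -- Near `x`, the map `T (idx x)` is the chart of `X` at `x` followed by the inverse of a chart of
  -- `N`.
  have key1 : ∀ x, ContMDiffAt I I n (T (idx x)) x := by
    intro x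
    have h1 : ContMDiffAt I I n (chartAt H x) x := contMDiffAt_of_mem_maximalAtlas
      (IsManifold.chart_mem_maximalAtlas x) (mem_chart_source H x)
    have h2 : ContMDiffAt I I n (chartAt H (T (idx x) x)).symm (chartAt H x x) :=
      contMDiffAt_symm_of_mem_maximalAtlas (IsManifold.chart_mem_maximalAtlas _) (by
        change chartAt H (T (idx x) x) (T (idx x) x) ∈ _
        simp)
    refine (h2.comp x h1).congr_of_eventuallyEq ?_
    filter_upwards [(chartAt H x).open_source.mem_nhds (mem_chart_source H x)] with y hy
    change _ = (chartAt H (T (idx x) x)).symm ((chartAt H (T (idx x) x)) (T (idx x) y))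
    rw [OpenPartialHomeomorph.left_inv]
    change y ∈ (T (idx x) ≫ₕ chartAt H (T (idx x) x)).source at hy
    simp only [mfld_simps] at hy
    exact hy.2
  have key2 : ∀ x, ContMDiffAt I I n (T (idx x)).symm (T (idx x) x) := by
    intro x
    have h1 : ContMDiffAt I I n (chartAt H x).symm (chartAt H x x) :=
      contMDiffAt_symm_of_mem_maximalAtlas
        (IsManifold.chart_mem_maximalAtlas x) (mem_chart_target H x)
    have h2 : ContMDiffAt I I n (chartAt H (T (idx x) x)) (T (idx x) x) :=
      contMDiffAt_of_mem_maximalAtlas (IsManifold.chart_mem_maximalAtlas _)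
        (mem_chart_source H _)
    refine (ContMDiffAt.comp (T (idx x) x) (g := (chartAt H x).symm) h1 h2).congr_of_eventuallyEq ?_
    filter_upwards [(chartAt H (T (idx x) x)).open_source.mem_nhds (mem_chart_source H _)] with y hy
    change _ = (T (idx x)).symm ((chartAt H (T (idx x) x)).symm ((chartAt H (T (idx x) x)) y))
    rw [OpenPartialHomeomorph.left_inv _ hy]
  refine ⟨cs, hman, fun j x hx => ContMDiffAt.contMDiffWithinAt ?_,
    fun j y hy => ContMDiffAt.contMDiffWithinAt ?_⟩
  -- Near `x`, an arbitrary `T j` is `T (idx x)` followed by a transition map.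
  · have hs : T (idx x) x ∈ ((T (idx x)).symm ≫ₕ T j).source := by
      simp [hidx, hx]
    refine (ContMDiffAt.comp (I' := I) x ((hT (idx x) j).contMDiffAt
      (((T (idx x)).symm ≫ₕ T j).open_source.mem_nhds hs)) (key1 x)).congr_of_eventuallyEq ?_
    filter_upwards [(T (idx x)).open_source.mem_nhds (hidx x)] with y hy
    simp [hy]
  · set x := (T j).symm y with hxdef
    have hx : x ∈ (T j).source := (T j).map_target hy
    have hyx : y = T j x := ((T j).right_inv hy).symm
    have hs : y ∈ ((T j).symm ≫ₕ T (idx x)).source := by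
      simp [hy, ← hxdef, hidx]
    have h0 : ((T j).symm ≫ₕ T (idx x)) y = T (idx x) x := by simp [hxdef]
    refine (ContMDiffAt.comp (I' := I) y (g := (T (idx x)).symm) (by rw [h0]; exact key2 x)
      ((hT j (idx x)).contMDiffAt
      (((T j).symm ≫ₕ T (idx x)).open_source.mem_nhds hs))).congr_of_eventuallyEq ?_
    filter_upwards [((T j).symm ≫ₕ T (idx x)).open_source.mem_nhds hs] with z hz
    simp only [mfld_simps] at hz
    simp [hz]

end ManifoldOfLocalModels

/-! ### Inverse function theorem -/

section InverseFunction

variable {𝕜 : Type*} [RCLike 𝕜]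
  {E : Type*} [NormedAddCommGroup E] [NormedSpace 𝕜 E] [CompleteSpace E]
  {F : Type*} [NormedAddCommGroup F] [NormedSpace 𝕜 F] [CompleteSpace F]
  {M : Type*} [TopologicalSpace M] [ChartedSpace E M] {n : WithTop ℕ∞} [IsManifold 𝓘(𝕜, E) n M]
  {N : Type*} [TopologicalSpace N] [ChartedSpace F N] [IsManifold 𝓘(𝕜, F) n N]

/-- The inverse function theorem on manifolds. -/
theorem isLocalDiffeomorph_of_bijective_mfderiv {f : M → N} (hn : n ≠ 0)
    (hf : ContMDiff 𝓘(𝕜, E) 𝓘(𝕜, F) n f)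
    (hbij : ∀ x, Bijective (mfderiv 𝓘(𝕜, E) 𝓘(𝕜, F) f x)) :
    IsLocalDiffeomorph 𝓘(𝕜, E) 𝓘(𝕜, F) n f := by
  have h1n : 1 ≤ n := ENat.one_le_iff_ne_zero_withTop.mpr hn
  have : IsManifold 𝓘(𝕜, E) 1 M := .of_le h1n
  have : IsManifold 𝓘(𝕜, F) 1 N := .of_le h1n
  intro x
  set φ := chartAt E x with hφ
  set ψ := chartAt F (f x) with hψ
  have sφ : ContMDiffOn 𝓘(𝕜, E) 𝓘(𝕜, E) n φ φ.source := contMDiffOn_chart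
  have sφ' : ContMDiffOn 𝓘(𝕜, E) 𝓘(𝕜, E) n φ.symm φ.target := contMDiffOn_chart_symm
  have sψ : ContMDiffOn 𝓘(𝕜, F) 𝓘(𝕜, F) n ψ ψ.source := contMDiffOn_chart
  have sψ' : ContMDiffOn 𝓘(𝕜, F) 𝓘(𝕜, F) n ψ.symm ψ.target := contMDiffOn_chart_symm
  set g : E → F := ψ ∘ f ∘ φ.symm with hg
  set O : Set E := φ.target ∩ φ.symm ⁻¹' (f ⁻¹' ψ.source) with hO
  have hOo : IsOpen O := φ.symm.isOpen_inter_preimage (ψ.open_source.preimage hf.continuous)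
  have hxO : φ x ∈ O := by simp [hO, hφ, hψ]
  have hgs : ∀ y ∈ O, ContMDiffAt 𝓘(𝕜, E) 𝓘(𝕜, F) n g y := fun y hy =>
    ContMDiffAt.comp (I' := 𝓘(𝕜, F)) _ (sψ.contMDiffAt (ψ.open_source.mem_nhds hy.2))
      (hf.contMDiffAt.comp y (sφ'.contMDiffAt (φ.open_target.mem_nhds hy.1)))
  have hgd : ∀ y ∈ O, ∃ g' : E ≃L[𝕜] F, HasFDerivAt g (g' : E →L[𝕜] F) y := by
    intro y hy
    have hd : DifferentiableAt 𝕜 g y := ((hgs y hy).contDiffAt).differentiableAt hn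
    have hb : Bijective (fderiv 𝕜 g y) := by
      have e1 := (mdifferentiable_chart (I := 𝓘(𝕜, F)) (f x)).mfderiv_bijective hy.2
      have e2 := (mdifferentiable_chart (I := 𝓘(𝕜, E)) x).symm.mfderiv_bijective
        (x := y) hy.1
      have hc : fderiv 𝕜 g y = (mfderiv 𝓘(𝕜, F) 𝓘(𝕜, F) ψ (f (φ.symm y))).comp
          ((mfderiv 𝓘(𝕜, E) 𝓘(𝕜, F) f (φ.symm y)).comp
            (mfderiv 𝓘(𝕜, E) 𝓘(𝕜, E) φ.symm y)) := by
        rw [← mfderiv_eq_fderiv, hg, mfderiv_comp (I' := 𝓘(𝕜, F)) y,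
          mfderiv_comp (I' := 𝓘(𝕜, E)) y]
        · rfl
        · exact hf.mdifferentiableAt hn
        · exact (sφ'.contMDiffAt (φ.open_target.mem_nhds hy.1)).mdifferentiableAt hn
        · exact (sψ.contMDiffAt (ψ.open_source.mem_nhds hy.2)).mdifferentiableAt hn
        · exact (hf.contMDiffAt.comp y
            (sφ'.contMDiffAt (φ.open_target.mem_nhds hy.1))).mdifferentiableAt hn
      rw [hc]
      exact e1.comp ((hbij _).comp e2)
    refine ⟨ContinuousLinearEquiv.ofBijective (fderiv 𝕜 g y)
      (LinearMap.ker_eq_bot.mpr hb.1) (LinearMap.range_eq_top.mpr hb.2), ?_⟩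
    rw [ContinuousLinearEquiv.coe_ofBijective]
    exact hd.hasFDerivAt
  obtain ⟨g', hg'⟩ := hgd _ hxO
  -- On `O` the derivative of `g` is invertible at every point, so after restriction the inverse is
  -- smooth on its whole domain and not only at one point.
  let e := ((hgs _ hxO).contDiffAt.toOpenPartialHomeomorph g hg' hn).restrOpen O hOo
  have heO : e.source ⊆ O := fun y hy => hy.2
  have hxe : φ x ∈ e.source :=
    ⟨(hgs _ hxO).contDiffAt.mem_toOpenPartialHomeomorph_source hg' hn, hxO⟩
  have heg : ∀ y, e y = g y := fun y => rfl
  let Ψ : OpenPartialHomeomorph M N := φ ≫ₕ e ≫ₕ ψ.symm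
  have hΨ : ∀ y ∈ Ψ.source, f y = Ψ y := by
    intro y hy
    have hy1 : y ∈ φ.source := hy.1
    have hy2 : φ y ∈ O := heO hy.2.1
    change f y = ψ.symm (ψ (f (φ.symm (φ y))))
    rw [ψ.left_inv hy2.2, φ.left_inv hy1]
  refine ⟨⟨Ψ.toPartialEquiv, Ψ.open_source, Ψ.open_target,
    (hf.contMDiffOn (s := Ψ.source)).congr fun y hy => (hΨ y hy).symm, ?_⟩, ?_, hΨ⟩
  · intro z hz
    refine ContMDiffAt.contMDiffWithinAt ?_
    have hz' := Ψ.map_target hz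
    have hz1 : z ∈ ψ.source := hz.1.1
    have hz2 : ψ z ∈ e.target := hz.1.2
    have hz3 : e.symm (ψ z) ∈ φ.target := hz.2
    refine ContMDiffAt.comp (I' := 𝓘(𝕜, E)) z (g := φ.symm) (f := e.symm ∘ ψ)
      (sφ'.contMDiffAt (φ.open_target.mem_nhds hz3)) ?_
    refine ContMDiffAt.comp (I' := 𝓘(𝕜, F)) z (g := e.symm)
      ?_ (sψ.contMDiffAt (ψ.open_source.mem_nhds hz1))
    have hO' := heO (e.map_target hz2)
    obtain ⟨g'', hg''⟩ := hgd _ hO'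
    exact (e.contDiffAt_symm hz2 hg'' (hgs _ hO').contDiffAt).contMDiffAt
  · refine ⟨mem_chart_source E x, hxe, ?_⟩
    change g (φ x) ∈ ψ.target
    exact ψ.map_source (hxO.2)

end InverseFunction

/-! ### Logarithmic derivatives in a Lie group -/

section LogarithmicDerivative

variable {𝕜 : Type*} [RCLike 𝕜]
  {EH : Type*} [NormedAddCommGroup EH] [NormedSpace 𝕜 EH]
  {H : Type*} [TopologicalSpace H] [ChartedSpace EH H] [Group H] [LieGroup 𝓘(𝕜, EH) ∞ H]
  {𝔤 : Type*} [NormedAddCommGroup 𝔤] [NormedSpace 𝕜 𝔤] {𝓜 : LocalModel 𝕜 EH H 𝔤}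
  {EX : Type*} [NormedAddCommGroup EX] [NormedSpace 𝕜 EX]
  {HX : Type*} [TopologicalSpace HX] {I : ModelWithCorners 𝕜 EX HX}
  {X : Type*} [TopologicalSpace X] [ChartedSpace HX X]

theorem mdifferentiable_mul_left (h : H) :
    MDifferentiable 𝓘(𝕜, EH) 𝓘(𝕜, EH) (fun k : H => h * k) :=
  (contMDiff_mul_left (I := 𝓘(𝕜, EH)) (n := ∞)).mdifferentiable (by simp)

/-- The product rule for logarithmic derivatives. -/
theorem LocalModel.incl_maurerCartan_mul (𝓜 : LocalModel 𝕜 EH H 𝔤) {a b : X → H} {x : X}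
    (ha : MDifferentiableAt I 𝓘(𝕜, EH) a x) (hb : MDifferentiableAt I 𝓘(𝕜, EH) b x)
    (ξ : TangentSpace I x) :
    𝓜.incl (maurerCartan 𝕜 (a x * b x) (mfderiv I 𝓘(𝕜, EH) (fun y => a y * b y) x ξ)) =
      𝓜.Ad (b x)⁻¹ (𝓜.incl (maurerCartan 𝕜 (a x) (mfderiv I 𝓘(𝕜, EH) a x ξ))) +
      𝓜.incl (maurerCartan 𝕜 (b x) (mfderiv I 𝓘(𝕜, EH) b x ξ)) := by
  set g := a x with hg
  set h := b x with hh
  have dm : MDifferentiableAt (𝓘(𝕜, EH).prod 𝓘(𝕜, EH)) 𝓘(𝕜, EH)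
      (fun p : H × H => (g * h)⁻¹ * (p.1 * p.2)) (a x, b x) :=
    (contMDiff_const.mul (contMDiff_fst.mul contMDiff_snd)).mdifferentiableAt (n := ∞) (by simp)
  have dab : MDifferentiableAt I 𝓘(𝕜, EH) (fun y => a y * b y) x :=
    ((contMDiff_fst.mul contMDiff_snd).mdifferentiableAt (n := ∞) (by simp)).comp x
      (ha.prodMk hb) (g := fun p : H × H => p.1 * p.2)
  have e1 : maurerCartan 𝕜 (g * h) (mfderiv I 𝓘(𝕜, EH) (fun y => a y * b y) x ξ) =
      mfderiv 𝓘(𝕜, EH) 𝓘(𝕜, EH) (fun k => (g * h)⁻¹ * (k * h)) g (mfderiv I 𝓘(𝕜, EH) a x ξ) +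
      mfderiv 𝓘(𝕜, EH) 𝓘(𝕜, EH) (fun k => (g * h)⁻¹ * (g * k)) h (mfderiv I 𝓘(𝕜, EH) b x ξ) := by
    have c1 := mfderiv_comp_apply_of_eq x (f := fun y => a y * b y) (y := g * h)
      (mdifferentiable_mul_left (𝕜 := 𝕜) (EH := EH) (g * h)⁻¹ (g * h)) dab rfl ξ
    refine c1.symm.trans ?_
    have c2 := mfderiv_comp_apply_of_eq x (f := fun y => (a y, b y)) (y := (a x, b x))
      dm (ha.prodMk hb) rfl ξ
    refine c2.trans ?_
    rw [mfderiv_prodMk ha hb]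
    exact mfderiv_prod_eq_add_apply dm
  have e2 : (mfderiv 𝓘(𝕜, EH) 𝓘(𝕜, EH) (fun k => (g * h)⁻¹ * (g * k)) h
      (mfderiv I 𝓘(𝕜, EH) b x ξ) : EH) = maurerCartan 𝕜 h (mfderiv I 𝓘(𝕜, EH) b x ξ) := by
    have : (fun k => (g * h)⁻¹ * (g * k)) = fun k => h⁻¹ * k := by funext k; group
    rw [this]; rfl
  -- Since `(g h)⁻¹ k h = h⁻¹ (g⁻¹ k) h`, the left factor contributes through conjugation by `h⁻¹`,
  -- which `incl_Ad` turns into `Ad(h)⁻¹`.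
  have e3 : (mfderiv 𝓘(𝕜, EH) 𝓘(𝕜, EH) (fun k => (g * h)⁻¹ * (k * h)) g
      (mfderiv I 𝓘(𝕜, EH) a x ξ) : EH) =
      mfderiv 𝓘(𝕜, EH) 𝓘(𝕜, EH) (fun k : H => h⁻¹ * k * h⁻¹⁻¹) 1
        (maurerCartan 𝕜 g (mfderiv I 𝓘(𝕜, EH) a x ξ)) := by
    have : (fun k => (g * h)⁻¹ * (k * h)) = (fun k : H => h⁻¹ * k * h⁻¹⁻¹) ∘ fun k => g⁻¹ * k := by
      funext k; simp [mul_assoc]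
    rw [this]
    refine mfderiv_comp_apply_of_eq g ?_ (mdifferentiable_mul_left _ _) (inv_mul_cancel g) _
    exact ((contMDiff_const.mul contMDiff_id).mul contMDiff_const).mdifferentiableAt
      (n := ∞) (by simp)
  refine (congrArg 𝓜.incl (e1.trans (congrArg₂ (fun u v : EH => u + v) e3 e2))).trans ?_
  refine (map_add 𝓜.incl _ _).trans (congrArg (· + _) (𝓜.incl_Ad h⁻¹ _))

end LogarithmicDerivative

/-! ### The Cartan connection along products -/

section Geometry

variable {𝕜 : Type*} [RCLike 𝕜]
  {EH : Type*} [NormedAddCommGroup EH] [NormedSpace 𝕜 EH]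
  {H : Type*} [TopologicalSpace H] [ChartedSpace EH H] [Group H] [LieGroup 𝓘(𝕜, EH) ∞ H]
  {𝔤 : Type*} [NormedAddCommGroup 𝔤] [NormedSpace 𝕜 𝔤] {𝓜 : LocalModel 𝕜 EH H 𝔤}
  {EM : Type*} [NormedAddCommGroup EM] [NormedSpace 𝕜 EM]
  {M : Type*} [TopologicalSpace M] [ChartedSpace EM M]
  {EE : Type*} [NormedAddCommGroup EE] [NormedSpace 𝕜 EE]
  {E : Type*} [TopologicalSpace E] [ChartedSpace EE E] [IsManifold 𝓘(𝕜, EE) ∞ E]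
  {EX : Type*} [NormedAddCommGroup EX] [NormedSpace 𝕜 EX]
  {HX : Type*} [TopologicalSpace HX] {I : ModelWithCorners 𝕜 EX HX}
  {X : Type*} [TopologicalSpace X] [ChartedSpace HX X]

-- All tangent spaces are the model space as types, so a vector can be kept while its base point is
-- replaced by a propositionally equal one.
omit [IsManifold 𝓘(𝕜, EE) ∞ E] in
theorem OneForm.apply_congr (α : OneForm 𝕜 EE E 𝔤) {p q : E} (h : p = q) (v : EE) :
    α p (v : TangentSpace 𝓘(𝕜, EE) p) = α q (v : TangentSpace 𝓘(𝕜, EE) q) := by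
  subst h; rfl

/-- From `e k = (e h)(h⁻¹ k)`, the orbit map near `h` is the orbit map of `e h` near `1`, where the
axiom `vertical` applies. -/
theorem CartanGeometry.conn_mfderiv_act_right (G : CartanGeometry 𝓜 EM M EE E) (e : E) (h : H)
    (w : TangentSpace 𝓘(𝕜, EH) h) :
    G.conn (G.act e h) (mfderiv 𝓘(𝕜, EH) 𝓘(𝕜, EE) (fun k => G.act e k) h w) =
      𝓜.incl (maurerCartan 𝕜 h w) := by
  have h1 : (fun k => G.act e k) = (fun k => G.act (G.act e h) k) ∘ (fun k => h⁻¹ * k) := by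
    funext k; simp [← G.act_mul]
  have h2 : MDifferentiableAt 𝓘(𝕜, EH) 𝓘(𝕜, EE) (fun k => G.act (G.act e h) k) (h⁻¹ * h) :=
    (G.contMDiff_act.comp (contMDiff_const.prodMk contMDiff_id)).mdifferentiableAt (by simp)
  have h3 : (mfderiv 𝓘(𝕜, EH) 𝓘(𝕜, EE) (fun k => G.act e k) h w : EE) =
      mfderiv 𝓘(𝕜, EH) 𝓘(𝕜, EE) (fun k => G.act (G.act e h) k) 1 (maurerCartan 𝕜 h w) := by
    rw [h1]
    exact mfderiv_comp_apply_of_eq h (by simpa using h2) (mdifferentiable_mul_left _ _)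
      (inv_mul_cancel h) w
  exact (congrArg (G.conn (G.act e h)) h3).trans
    ((G.conn.apply_congr (G.act_one _).symm _).trans (G.vertical (G.act e h) (maurerCartan 𝕜 h w)))

/-- The Cartan connection on the velocity of a product. -/
theorem CartanGeometry.conn_mfderiv_act (G : CartanGeometry 𝓜 EM M EE E) {a : X → E} {b : X → H}
    {x : X} (ha : MDifferentiableAt I 𝓘(𝕜, EE) a x) (hb : MDifferentiableAt I 𝓘(𝕜, EH) b x)
    (ξ : TangentSpace I x) :
    G.conn (G.act (a x) (b x)) (mfderiv I 𝓘(𝕜, EE) (fun y => G.act (a y) (b y)) x ξ) =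
      𝓜.Ad (b x)⁻¹ (G.conn (a x) (mfderiv I 𝓘(𝕜, EE) a x ξ)) +
      𝓜.incl (maurerCartan 𝕜 (b x) (mfderiv I 𝓘(𝕜, EH) b x ξ)) := by
  have h1 : MDifferentiableAt (𝓘(𝕜, EE).prod 𝓘(𝕜, EH)) 𝓘(𝕜, EE)
      (fun p : E × H => G.act p.1 p.2) (a x, b x) := G.contMDiff_act.mdifferentiableAt (by simp)
  have h2 : (fun y => G.act (a y) (b y)) = (fun p : E × H => G.act p.1 p.2) ∘
    (fun y => (a y, b y)) := rfl
  rw [h2, mfderiv_comp_apply (I' := 𝓘(𝕜, EE).prod 𝓘(𝕜, EH)) x h1 (ha.prodMk hb),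
    mfderiv_prodMk ha hb]
  erw [mfderiv_prod_eq_add_apply h1]
  rw [map_add]
  congr 1
  · exact G.equivariant _ _ _
  · exact G.conn_mfderiv_act_right _ _ _

end Geometry

/-! ### Local sections of principal bundles -/

section Bundle

variable {𝕜 : Type*} [RCLike 𝕜]
  {EH : Type*} [NormedAddCommGroup EH] [NormedSpace 𝕜 EH]
  {H : Type*} [TopologicalSpace H] [ChartedSpace EH H] [Group H]
  {EM : Type*} [NormedAddCommGroup EM] [NormedSpace 𝕜 EM]
  {M : Type*} [TopologicalSpace M] [ChartedSpace EM M]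
  {EE : Type*} [NormedAddCommGroup EE] [NormedSpace 𝕜 EE]
  {E : Type*} [TopologicalSpace E] [ChartedSpace EE E]

/-- A smooth local section of a principal bundle over an open set `U`, with the induced equivariant
map to the structure group. -/
structure PrincipalBundle.LocalSection (B : PrincipalBundle 𝕜 EH H EM M EE E) where
  /-- the domain of the section -/
  U : Set M
  isOpen_U : IsOpen U
  /-- the section -/
  sec : M → E
  /-- the group element which moves the section to a given point -/
  fib : E → H
  contMDiffOn_sec : ContMDiffOn 𝓘(𝕜, EM) 𝓘(𝕜, EE) ∞ sec U
  contMDiffOn_fib : ContMDiffOn 𝓘(𝕜, EE) 𝓘(𝕜, EH) ∞ fib (B.proj ⁻¹' U)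
  proj_sec : ∀ m ∈ U, B.proj (sec m) = m
  act_sec : ∀ e, B.proj e ∈ U → B.act (sec (B.proj e)) (fib e) = e
  fib_act : ∀ e h, B.proj e ∈ U → fib (B.act e h) = fib e * h
  fib_sec : ∀ m ∈ U, fib (sec m) = 1

/-- The section is the preimage of `U × {1}` under an equivariant trivialization, and `fib` is the
group component of the trivialization. -/
theorem PrincipalBundle.exists_localSection (B : PrincipalBundle 𝕜 EH H EM M EE E) (m : M) :
    ∃ s : B.LocalSection, m ∈ s.U := by
  obtain ⟨U, hU, hm, φ, hs, ht, hp, hact⟩ := B.locally_trivial m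
  have hsrc : ∀ e, e ∈ φ.source ↔ B.proj e ∈ U := fun e => by rw [hs]; rfl
  have hmem : ∀ m ∈ U, (m, (1 : H)) ∈ φ.target := fun m hm => by rw [ht]; exact ⟨hm, trivial⟩
  have hsm : ∀ m ∈ U, φ.invFun (m, 1) ∈ φ.source := fun m hm => φ.map_target' (hmem m hm)
  have hright : ∀ m ∈ U, φ (φ.invFun (m, 1)) = (m, 1) := fun m hm => φ.right_inv' (hmem m hm)
  have hproj : ∀ m ∈ U, B.proj (φ.invFun (m, 1)) = m := fun m hm => by
    rw [← hp _ (hsm m hm), hright m hm]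
  refine ⟨⟨U, hU, fun m => φ.invFun (m, 1), fun e => (φ e).2, ?_, ?_, hproj, ?_, ?_, ?_⟩, hm⟩
  · refine φ.contMDiffOn_invFun.comp (contMDiffOn_id.prodMk contMDiffOn_const) fun m hm => ?_
    exact hmem m hm
  · rw [← hs]
    exact contMDiff_snd.comp_contMDiffOn φ.contMDiffOn_toFun
  · intro e he
    have h1 : B.act (φ.invFun (B.proj e, 1)) (φ e).2 ∈ φ.source := by
      rw [hsrc, B.proj_act, hproj _ he]; exact he
    refine φ.toPartialEquiv.injOn h1 ((hsrc e).2 he) ?_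
    refine (hact _ (hsm _ he) _).trans ?_
    rw [hright _ he]
    exact Prod.ext (hp e ((hsrc e).2 he)).symm (one_mul _)
  · intro e h he
    exact congrArg Prod.snd (hact e ((hsrc e).2 he) h)
  · intro m hm
    exact congrArg Prod.snd (hright m hm)

end Bundle

/-! ### Gauge invariance of the product form -/

section Morphism

variable {𝕜 : Type*} [RCLike 𝕜]
  {EH₀ : Type*} [NormedAddCommGroup EH₀] [NormedSpace 𝕜 EH₀]
  {H₀ : Type*} [TopologicalSpace H₀] [ChartedSpace EH₀ H₀] [Group H₀]
  [LieGroup 𝓘(𝕜, EH₀) ∞ H₀]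
  {𝔤₀ : Type*} [NormedAddCommGroup 𝔤₀] [NormedSpace 𝕜 𝔤₀]
  {EH₁ : Type*} [NormedAddCommGroup EH₁] [NormedSpace 𝕜 EH₁]
  {H₁ : Type*} [TopologicalSpace H₁] [ChartedSpace EH₁ H₁] [Group H₁]
  [LieGroup 𝓘(𝕜, EH₁) ∞ H₁]
  {𝔤₁ : Type*} [NormedAddCommGroup 𝔤₁] [NormedSpace 𝕜 𝔤₁]
  {𝓜₀ : LocalModel 𝕜 EH₀ H₀ 𝔤₀} {𝓜₁ : LocalModel 𝕜 EH₁ H₁ 𝔤₁}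
  {EM : Type*} [NormedAddCommGroup EM] [NormedSpace 𝕜 EM]
  {M : Type*} [TopologicalSpace M] [ChartedSpace EM M]
  {EE₀ : Type*} [NormedAddCommGroup EE₀] [NormedSpace 𝕜 EE₀]
  {E₀ : Type*} [TopologicalSpace E₀] [ChartedSpace EE₀ E₀] [IsManifold 𝓘(𝕜, EE₀) ∞ E₀]
  {EX : Type*} [NormedAddCommGroup EX] [NormedSpace 𝕜 EX]
  {HX : Type*} [TopologicalSpace HX] {I : ModelWithCorners 𝕜 EX HX}
  {X : Type*} [TopologicalSpace X] [ChartedSpace HX X]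

theorem ModelMorphism.mdifferentiable (Φ : ModelMorphism 𝓜₀ 𝓜₁) :
    MDifferentiable 𝓘(𝕜, EH₀) 𝓘(𝕜, EH₁) Φ.grp :=
  Φ.grp.contMDiff_toFun.mdifferentiable (by simp)

/-- Because `Φ(k)⁻¹ Φ(l) = Φ(k⁻¹ l)`, the Maurer-Cartan forms correspond under the differential of
`Φ` at `1`, and `lin_incl` identifies that with `Φ.lin` on `𝔥₀`. -/
theorem ModelMorphism.incl_maurerCartan_map (Φ : ModelMorphism 𝓜₀ 𝓜₁) {k : X → H₀} {x : X}
    (hk : MDifferentiableAt I 𝓘(𝕜, EH₀) k x) (ξ : TangentSpace I x) :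
    𝓜₁.incl (maurerCartan 𝕜 (Φ.grp (k x)) (mfderiv I 𝓘(𝕜, EH₁) (fun y => Φ.grp (k y)) x ξ)) =
      Φ.lin (𝓜₀.incl (maurerCartan 𝕜 (k x) (mfderiv I 𝓘(𝕜, EH₀) k x ξ))) := by
  rw [Φ.lin_incl]
  refine congrArg 𝓜₁.incl ?_
  have c1 := mfderiv_comp_apply x (g := Φ.grp) (Φ.mdifferentiable (k x)) hk ξ
  refine (congrArg (maurerCartan 𝕜 (Φ.grp (k x))) c1).trans ?_
  have c2 := mfderiv_comp_apply (k x) (f := Φ.grp)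
    (mdifferentiable_mul_left (𝕜 := 𝕜) (EH := EH₁) (Φ.grp (k x))⁻¹ (Φ.grp (k x)))
    (Φ.mdifferentiable (k x)) (mfderiv I 𝓘(𝕜, EH₀) k x ξ)
  refine c2.symm.trans ?_
  have : ((fun l => (Φ.grp (k x))⁻¹ * l) ∘ Φ.grp) = Φ.grp ∘ fun l => (k x)⁻¹ * l := by
    funext l; simp
  rw [this]
  exact mfderiv_comp_apply_of_eq (k x) (Φ.mdifferentiable 1) (mdifferentiable_mul_left _ _)
    (inv_mul_cancel (k x)) _

omit [LieGroup 𝓘(𝕜, EH₀) ∞ H₀] in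
theorem maurerCartan_congr {g h : H₀} (hgh : g = h) (v : EH₀) :
    maurerCartan 𝕜 g (v : TangentSpace 𝓘(𝕜, EH₀) g) =
      maurerCartan 𝕜 h (v : TangentSpace 𝓘(𝕜, EH₀) h) := by
  subst hgh; rfl

/-- The form `h₁⁻¹ dh₁ + Ad(h₁)⁻¹ Φ ω₀` is invariant under gauge transformations. -/
theorem productForm_gauge (Φ : ModelMorphism 𝓜₀ 𝓜₁) (G₀ : CartanGeometry 𝓜₀ EM M EE₀ E₀)
    {a : X → E₀} {b : X → H₁} {k : X → H₀} {x : X}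
    (ha : MDifferentiableAt I 𝓘(𝕜, EE₀) a x) (hb : MDifferentiableAt I 𝓘(𝕜, EH₁) b x)
    (hk : MDifferentiableAt I 𝓘(𝕜, EH₀) k x) (ξ : TangentSpace I x) :
    productForm Φ G₀ (G₀.act (a x) (k x)) ((Φ.grp (k x))⁻¹ * b x)
      (mfderiv I 𝓘(𝕜, EE₀) (fun y => G₀.act (a y) (k y)) x ξ,
        mfderiv I 𝓘(𝕜, EH₁) (fun y => (Φ.grp (k y))⁻¹ * b y) x ξ) =
    productForm Φ G₀ (a x) (b x) (mfderiv I 𝓘(𝕜, EE₀) a x ξ, mfderiv I 𝓘(𝕜, EH₁) b x ξ) := by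
  have hΦk : MDifferentiableAt I 𝓘(𝕜, EH₁) (fun y => Φ.grp (k y)) x :=
    (Φ.mdifferentiable (k x)).comp x hk
  have hc : MDifferentiableAt I 𝓘(𝕜, EH₁) (fun y => (Φ.grp (k y))⁻¹ * b y) x := by
    have : MDifferentiableAt (𝓘(𝕜, EH₁).prod 𝓘(𝕜, EH₁)) 𝓘(𝕜, EH₁)
        (fun p : H₁ × H₁ => p.1⁻¹ * p.2) (Φ.grp (k x), b x) :=
      (contMDiff_fst.inv.mul contMDiff_snd).mdifferentiableAt (n := ∞) (by simp)
    exact this.comp x (hΦk.prodMk hb)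
  have h1 := 𝓜₁.incl_maurerCartan_mul hΦk hc ξ
  -- The product rule is applied to `b = Φ(k) · (Φ(k)⁻¹ b)` and solved for the second factor, so no
  -- inverse has to be differentiated.
  have hcancel : (fun y => Φ.grp (k y) * ((Φ.grp (k y))⁻¹ * b y)) = b := by
    funext y; simp
  rw [hcancel, Φ.incl_maurerCartan_map hk] at h1
  have h2 := (congrArg 𝓜₁.incl (maurerCartan_congr (𝕜 := 𝕜) (EH₀ := EH₁)
    (mul_inv_cancel_left (Φ.grp (k x)) (b x)) (mfderiv I 𝓘(𝕜, EH₁) b x ξ))).symm.trans h1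
  have h3 := G₀.conn_mfderiv_act ha hk ξ
  have h4 : ∀ A, 𝓜₁.Ad ((Φ.grp (k x))⁻¹ * b x)⁻¹ (𝓜₁.Ad (Φ.grp (k x)⁻¹) A) =
      𝓜₁.Ad (b x)⁻¹ A := fun A => by
    rw [← Module.End.mul_apply, ← map_mul]; simp
  simp only [productForm]
  refine (congrArg (fun A => _ + 𝓜₁.Ad ((Φ.grp (k x))⁻¹ * b x)⁻¹ (Φ.lin A)) h3).trans ?_
  rw [map_add, Φ.lin_Ad, map_add, h4]
  refine Eq.trans ?_ (congrArg (· + _) h2).symm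
  abel

end Morphism

/-! ### Topology and local trivializations of the quotient -/

section ExtensionTopology

variable {𝕜 : Type*} [RCLike 𝕜]
  {EH₀ : Type*} [NormedAddCommGroup EH₀] [NormedSpace 𝕜 EH₀]
  {H₀ : Type*} [TopologicalSpace H₀] [ChartedSpace EH₀ H₀] [Group H₀]
  [LieGroup 𝓘(𝕜, EH₀) ∞ H₀]
  {𝔤₀ : Type*} [NormedAddCommGroup 𝔤₀] [NormedSpace 𝕜 𝔤₀]
  {EH₁ : Type*} [NormedAddCommGroup EH₁] [NormedSpace 𝕜 EH₁]
  {H₁ : Type*} [TopologicalSpace H₁] [ChartedSpace EH₁ H₁] [Group H₁]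
  [LieGroup 𝓘(𝕜, EH₁) ∞ H₁]
  {𝔤₁ : Type*} [NormedAddCommGroup 𝔤₁] [NormedSpace 𝕜 𝔤₁]
  {𝓜₀ : LocalModel 𝕜 EH₀ H₀ 𝔤₀} {𝓜₁ : LocalModel 𝕜 EH₁ H₁ 𝔤₁}
  {EM : Type*} [NormedAddCommGroup EM] [NormedSpace 𝕜 EM]
  {M : Type*} [TopologicalSpace M] [ChartedSpace EM M]
  {EE₀ : Type*} [NormedAddCommGroup EE₀] [NormedSpace 𝕜 EE₀]
  {E₀ : Type*} [TopologicalSpace E₀] [ChartedSpace EE₀ E₀] [IsManifold 𝓘(𝕜, EE₀) ∞ E₀]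

namespace Extension

variable (Φ : ModelMorphism 𝓜₀ 𝓜₁) (G₀ : CartanGeometry 𝓜₀ EM M EE₀ E₀)

theorem mk_act (e : E₀) (k : H₀) (h : H₁) :
    mk Φ G₀ (G₀.act e k, h) = mk Φ G₀ (e, Φ.grp k * h) :=
  Quotient.sound ⟨k⁻¹, by simp [← G₀.act_mul, G₀.act_one]⟩

theorem mk_surjective : Surjective (mk Φ G₀) := Quotient.mk_surjective

theorem mk_eq_iff (p q : E₀ × H₁) :
    mk Φ G₀ p = mk Φ G₀ q ↔ ∃ k : H₀, q = (G₀.act p.1 k, (Φ.grp k)⁻¹ * p.2) :=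
  Quotient.eq (r := orbitSetoid Φ G₀)

/-- The saturation of an open set is the union of its preimages under the elements of `H₀`, each
acting continuously. -/
theorem isOpenQuotientMap_mk : IsOpenQuotientMap (mk Φ G₀) := by
  refine ⟨mk_surjective Φ G₀, continuous_quotient_mk', fun W hW => ?_⟩
  have hpre : mk Φ G₀ ⁻¹' (mk Φ G₀ '' W) =
      ⋃ k : H₀, (fun p : E₀ × H₁ => (G₀.act p.1 k, (Φ.grp k)⁻¹ * p.2)) ⁻¹' W := by
    ext p
    simp only [mem_preimage, mem_image, mem_iUnion]
    constructor
    · rintro ⟨q, hq, hqp⟩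
      obtain ⟨k, rfl⟩ := (mk_eq_iff Φ G₀ p q).1 hqp.symm
      exact ⟨k, hq⟩
    · rintro ⟨k, hk⟩
      exact ⟨_, hk, ((mk_eq_iff Φ G₀ _ _).2 ⟨k, rfl⟩).symm⟩
  refine isQuotientMap_quotient_mk'.isOpen_preimage.1 ?_
  change IsOpen (mk Φ G₀ ⁻¹' (mk Φ G₀ '' W))
  rw [hpre]
  refine isOpen_iUnion fun k => hW.preimage ?_
  have h1 : Continuous fun p : E₀ × H₁ => G₀.act p.1 k :=
    G₀.contMDiff_act.continuous.comp (continuous_fst.prodMk continuous_const)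
  have h2 : Continuous fun p : E₀ × H₁ => (Φ.grp k)⁻¹ * p.2 :=
    (contMDiff_mul_left (I := 𝓘(𝕜, EH₁)) (n := ∞)).continuous.comp continuous_snd
  exact h1.prodMk h2

/-- The bundle projection `[e, h] ↦ π₀ e`. -/
def proj : Extension Φ G₀ → M :=
  Quotient.lift (fun p => G₀.proj p.1) (by
    rintro p _ ⟨k, rfl⟩
    exact (G₀.proj_act _ _).symm)

@[simp]
theorem proj_mk (p : E₀ × H₁) : proj Φ G₀ (mk Φ G₀ p) = G₀.proj p.1 := rfl

/-- The right action `[e, h] k = [e, h k]`. -/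
def act (x : Extension Φ G₀) (k : H₁) : Extension Φ G₀ :=
  Quotient.lift (fun p => mk Φ G₀ (p.1, p.2 * k)) (by
    rintro p _ ⟨l, rfl⟩
    exact (mk_eq_iff Φ G₀ _ _).2 ⟨l, by simp [mul_assoc]⟩) x

@[simp]
theorem act_mk (p : E₀ × H₁) (k : H₁) : act Φ G₀ (mk Φ G₀ p) k = mk Φ G₀ (p.1, p.2 * k) := rfl

theorem continuous_proj : Continuous (proj Φ G₀) :=
  (G₀.contMDiff_proj.continuous.comp continuous_fst).quotient_lift _

variable {Φ G₀}

/-- The fibre coordinate `[e, h] ↦ Φ(κ(e)) h` induced by a local section of `E₀`. -/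
def fib (s : G₀.LocalSection) (x : Extension Φ G₀) : H₁ :=
  Φ.grp (s.fib x.out.1) * x.out.2

/-- Independence of the representative chosen in `fib`: `Φ(κ(e k)) Φ(k)⁻¹ h = Φ(κ(e)) h`. -/
theorem fib_mk (s : G₀.LocalSection) {p : E₀ × H₁} (hp : G₀.proj p.1 ∈ s.U) :
    fib s (mk Φ G₀ p) = Φ.grp (s.fib p.1) * p.2 := by
  have h : mk Φ G₀ p = mk Φ G₀ (mk Φ G₀ p).out := (Quotient.out_eq _).symm
  obtain ⟨k, hk⟩ := (mk_eq_iff Φ G₀ _ _).1 h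
  rw [fib, hk]
  simp [s.fib_act _ _ hp, mul_assoc]

theorem mk_sec_fib (s : G₀.LocalSection) {x : Extension Φ G₀} (hx : proj Φ G₀ x ∈ s.U) :
    mk Φ G₀ (s.sec (proj Φ G₀ x), fib s x) = x := by
  obtain ⟨p, rfl⟩ := mk_surjective Φ G₀ x
  rw [fib_mk s hx, ← mk_act, proj_mk, s.act_sec _ hx]

variable (Φ) in
/-- The local trivialization of `E₁` induced by a local section of `E₀`. -/
def trivialization (s : G₀.LocalSection) : OpenPartialHomeomorph (Extension Φ G₀) (M × H₁) where
  toFun x := (proj Φ G₀ x, fib s x)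
  invFun p := mk Φ G₀ (s.sec p.1, p.2)
  source := proj Φ G₀ ⁻¹' s.U
  target := s.U ×ˢ univ
  map_source' x hx := ⟨hx, trivial⟩
  map_target' p hp := by
    change G₀.proj (s.sec p.1) ∈ s.U
    rw [s.proj_sec _ hp.1]; exact hp.1
  left_inv' x hx := mk_sec_fib s hx
  right_inv' p hp := by
    have h : G₀.proj (s.sec p.1) = p.1 := s.proj_sec _ hp.1
    refine Prod.ext h ?_
    rw [fib_mk s (by rw [h]; exact hp.1)]
    simp [s.fib_sec _ hp.1]
  open_source := s.isOpen_U.preimage (continuous_proj Φ G₀)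
  open_target := s.isOpen_U.prod isOpen_univ
  continuousOn_toFun := by
    refine (continuous_proj Φ G₀).continuousOn.prodMk ?_
    -- Continuity on an open subset of the quotient is tested upstairs, where `fib_mk` replaces the
    -- chosen representative by a formula.
    rw [(isOpenQuotientMap_mk Φ G₀).isQuotientMap.continuousOn_isOpen_iff
      (s.isOpen_U.preimage (continuous_proj Φ G₀))]
    have h1 : ContinuousOn (fun p : E₀ × H₁ => Φ.grp (s.fib p.1) * p.2)
        (mk Φ G₀ ⁻¹' (proj Φ G₀ ⁻¹' s.U)) := by
      have h2 : ContinuousOn (fun p : E₀ × H₁ => s.fib p.1) (mk Φ G₀ ⁻¹' (proj Φ G₀ ⁻¹' s.U)) :=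
        s.contMDiffOn_fib.continuousOn.comp continuousOn_fst fun p hp => hp
      have h3 := Φ.grp.contMDiff_toFun.continuous.comp_continuousOn h2
      exact (contMDiff_mul 𝓘(𝕜, EH₁) ∞).continuous.comp_continuousOn
        (h3.prodMk continuousOn_snd)
    exact h1.congr fun p hp => fib_mk s hp
  continuousOn_invFun := by
    refine (isOpenQuotientMap_mk Φ G₀).continuous.comp_continuousOn ?_
    exact (s.contMDiffOn_sec.continuousOn.comp continuousOn_fst fun p hp => hp.1).prodMk
      continuousOn_snd

theorem trivialization_symm_apply (s : G₀.LocalSection) (p : M × H₁) :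
    (trivialization Φ s).symm p = mk Φ G₀ (s.sec p.1, p.2) := rfl

/-- The change of section is `(m, h) ↦ (m, Φ(κ_t(s(m))) h)`. -/
theorem contMDiffOn_transition (s t : G₀.LocalSection) :
    ContMDiffOn (𝓘(𝕜, EM).prod 𝓘(𝕜, EH₁)) (𝓘(𝕜, EM).prod 𝓘(𝕜, EH₁)) ∞
      ((trivialization Φ s).symm ≫ₕ trivialization Φ t)
      ((trivialization Φ s).symm ≫ₕ trivialization Φ t).source := by
  have hsrc : ∀ p ∈ ((trivialization Φ s).symm ≫ₕ trivialization Φ t).source,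
      p.1 ∈ s.U ∧ G₀.proj (s.sec p.1) = p.1 ∧ G₀.proj (s.sec p.1) ∈ t.U := fun p hp =>
    ⟨hp.1.1, s.proj_sec _ hp.1.1, hp.2⟩
  have h1 : ContMDiffOn (𝓘(𝕜, EM).prod 𝓘(𝕜, EH₁)) 𝓘(𝕜, EE₀) ∞ (fun p : M × H₁ => s.sec p.1)
      ((trivialization Φ s).symm ≫ₕ trivialization Φ t).source :=
    s.contMDiffOn_sec.comp contMDiffOn_fst fun p hp => (hsrc p hp).1
  have h2 := Φ.grp.contMDiff_toFun.comp_contMDiffOn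
    (t.contMDiffOn_fib.comp h1 fun p hp => (hsrc p hp).2.2)
  refine (contMDiffOn_fst.prodMk (h2.mul contMDiffOn_snd)).congr fun p hp => ?_
  exact Prod.ext (hsrc p hp).2.1 (fib_mk t (hsrc p hp).2.2)

/-- Points of one fibre are separated inside a trivialization, points of different fibres by open
sets of the base. -/
theorem t2Space [T2Space M] [T2Space H₁] : T2Space (Extension Φ G₀) := by
  refine ⟨fun x y hxy => ?_⟩
  by_cases h : proj Φ G₀ x = proj Φ G₀ y
  · obtain ⟨s, hs⟩ := G₀.exists_localSection (proj Φ G₀ x)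
    have hx : x ∈ (trivialization Φ s).source := hs
    have hy : y ∈ (trivialization Φ s).source := by
      change proj Φ G₀ y ∈ s.U
      rw [← h]; exact hs
    obtain ⟨u, v, hu, hv, hxu, hyv, huv⟩ :=
      t2_separation (fun hT => hxy ((trivialization Φ s).injOn hx hy hT))
    refine ⟨_, _, (trivialization Φ s).isOpen_inter_preimage hu,
      (trivialization Φ s).isOpen_inter_preimage hv, ⟨hx, hxu⟩, ⟨hy, hyv⟩, ?_⟩
    rw [Set.disjoint_left] at huv ⊢
    exact fun z hz hz' => huv hz.2 hz'.2
  · obtain ⟨u, v, hu, hv, hxu, hyv, huv⟩ := t2_separation h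
    exact ⟨_, _, hu.preimage (continuous_proj Φ G₀), hv.preimage (continuous_proj Φ G₀), hxu, hyv,
      huv.preimage _⟩

theorem secondCountableTopology [SecondCountableTopology E₀] [SecondCountableTopology H₁] :
    SecondCountableTopology (Extension Φ G₀) :=
  (isOpenQuotientMap_mk Φ G₀).isQuotientMap.secondCountableTopology
    (isOpenQuotientMap_mk Φ G₀).isOpenMap

variable (Φ G₀) in
/-- The local trivializations of `E₁` are diffeomorphisms. -/
structure IsCompatible [ChartedSpace (EM × EH₁) (Extension Φ G₀)] : Prop where
  intro ::
  contMDiffOn : ∀ s : G₀.LocalSection, ContMDiffOn 𝓘(𝕜, EM × EH₁) (𝓘(𝕜, EM).prod 𝓘(𝕜, EH₁)) ∞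
    (trivialization Φ s) (trivialization Φ s).source
  contMDiffOn_symm : ∀ s : G₀.LocalSection,
    ContMDiffOn (𝓘(𝕜, EM).prod 𝓘(𝕜, EH₁)) 𝓘(𝕜, EM × EH₁) ∞
    (trivialization Φ s).symm (trivialization Φ s).target

variable (Φ G₀) in
theorem exists_isCompatible [IsManifold 𝓘(𝕜, EM) ∞ M] :
    ∃ (_ : ChartedSpace (EM × EH₁) (Extension Φ G₀))
      (_ : IsManifold 𝓘(𝕜, EM × EH₁) ∞ (Extension Φ G₀)), IsCompatible Φ G₀ := by
  obtain ⟨cs, hm, h1, h2⟩ := exists_chartedSpace_of_transition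
    (I := 𝓘(𝕜, EM).prod 𝓘(𝕜, EH₁)) (n := ∞) (fun s : G₀.LocalSection => trivialization Φ s)
    (fun x => G₀.exists_localSection (proj Φ G₀ x)) contMDiffOn_transition
  -- Gluing uses the product model; it is rewritten as the trivial model on `EM × EH₁`.
  rw [← modelWithCornersSelf_prod] at hm
  refine ⟨cs, hm, ?_⟩
  let _ : ChartedSpace (EM × EH₁) (Extension Φ G₀) := cs
  constructor <;> rw [modelWithCornersSelf_prod]
  exacts [h1, h2]

end Extension

end ExtensionTopology

/-! ### Tangent maps on open sets -/

section TangentMap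

variable {𝕜 : Type*} [RCLike 𝕜]
  {E : Type*} [NormedAddCommGroup E] [NormedSpace 𝕜 E]
  {M : Type*} [TopologicalSpace M] [ChartedSpace E M] [IsManifold 𝓘(𝕜, E) ∞ M]
  {F : Type*} [NormedAddCommGroup F] [NormedSpace 𝕜 F]
  {N : Type*} [TopologicalSpace N] [ChartedSpace F N] [IsManifold 𝓘(𝕜, F) ∞ N]

theorem contMDiffOn_tangentMap {f : M → N} {V : Set M} (hV : IsOpen V)
    (hf : ContMDiffOn 𝓘(𝕜, E) 𝓘(𝕜, F) ∞ f V) :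
    ContMDiffOn 𝓘(𝕜, E).tangent 𝓘(𝕜, F).tangent ∞ (tangentMap 𝓘(𝕜, E) 𝓘(𝕜, F) f)
      (Bundle.TotalSpace.proj ⁻¹' V) := by
  refine (hf.contMDiffOn_tangentMapWithin (m := ∞) (by simp) hV.uniqueMDiffOn).congr fun v hv => ?_
  simp only [tangentMap, tangentMapWithin, mfderivWithin_of_isOpen hV hv]

end TangentMap

/-! ### Smoothness of the Maurer-Cartan form -/

section LieGroup

variable {𝕜 : Type*} [RCLike 𝕜]
  {EH : Type*} [NormedAddCommGroup EH] [NormedSpace 𝕜 EH]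
  {H : Type*} [TopologicalSpace H] [ChartedSpace EH H] [Group H] [LieGroup 𝓘(𝕜, EH) ∞ H]

/-- At `v` over `g` this is the derivative of `(g, k) ↦ g⁻¹ k` at `(g, g)` on `(0, v)`, hence a
tangent map composed with a smooth map. -/
theorem contMDiff_maurerCartan :
    ContMDiff (M' := EH) (𝓘(𝕜, EH).tangent) 𝓘(𝕜, EH) ∞
      (fun v : TangentBundle 𝓘(𝕜, EH) H => maurerCartan 𝕜 v.1 v.2) := by
  have hd : ContMDiff (𝓘(𝕜, EH).prod 𝓘(𝕜, EH)) 𝓘(𝕜, EH) ∞ (fun p : H × H => p.1⁻¹ * p.2) :=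
    contMDiff_fst.inv.mul contMDiff_snd
  have h0 : ContMDiff (𝓘(𝕜, EH).tangent) (𝓘(𝕜, EH).tangent) ∞
      (fun v : TangentBundle 𝓘(𝕜, EH) H =>
        (Bundle.zeroSection EH (TangentSpace 𝓘(𝕜, EH)) v.1 : TangentBundle 𝓘(𝕜, EH) H)) :=
    (Bundle.contMDiff_zeroSection 𝕜 (TangentSpace 𝓘(𝕜, EH) : H → Type _)).comp
      (Bundle.contMDiff_proj _)
  have h1 := (hd.contMDiff_tangentMap (m := ∞) (by simp)).comp
    ((contMDiff_equivTangentBundleProd_symm (I := 𝓘(𝕜, EH)) (M := H) (I' := 𝓘(𝕜, EH))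
      (M' := H)).comp (h0.prodMk contMDiff_id))
  -- The base point `g⁻¹ g` equals `1` only propositionally, so the vector has to be moved.
  have h2 : ∀ (g : H) (_ : g = 1) (w : EH), (⟨g, w⟩ : TangentBundle 𝓘(𝕜, EH) H) = ⟨1, w⟩ := by
    rintro g rfl w; rfl
  have h3 : ContMDiff (𝓘(𝕜, EH).tangent) (𝓘(𝕜, EH).tangent) ∞
      (fun v : TangentBundle 𝓘(𝕜, EH) H =>
        (⟨1, maurerCartan 𝕜 v.1 v.2⟩ : TangentBundle 𝓘(𝕜, EH) H)) := by
    refine h1.congr fun v => ?_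
    refine (h2 _ (inv_mul_cancel v.1) _).symm.trans ?_
    refine congrArg (Bundle.TotalSpace.mk _) ?_
    have h4 := mfderiv_prod_eq_add_apply (p := (v.1, v.1))
      (v := Prod.mk (α := EH) (β := EH) 0 v.2) (hd.mdifferentiableAt (by simp))
    refine Eq.trans ?_ h4.symm
    exact ((congrArg₂ (fun a b : EH => a + b) (map_zero (mfderiv 𝓘(𝕜, EH) 𝓘(𝕜, EH)
      (fun z : H => z⁻¹ * v.1) v.1)) rfl).trans (zero_add _)).symm
  -- The vector is read off in the tangent bundle trivialization at `1`, whose coordinate change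
  -- over `1` is the identity.
  intro v
  have h4 := (Bundle.contMDiffAt_totalSpace.1 (h3 v)).2
  refine h4.congr_of_eventuallyEq (Filter.Eventually.of_forall fun w => ?_)
  refine Eq.symm ((congrArg Prod.snd (TangentBundle.trivializationAt_apply 1 _)).trans ?_)
  exact ((tangentBundleCore 𝓘(𝕜, EH) H).coordChange_self (achart EH 1) 1
    (mem_chart_source EH 1) _)

end LieGroup

/-! ### Smooth lifts and descent of the connection -/

section ExtensionSmooth

variable {𝕜 : Type*} [RCLike 𝕜]
  {EH₀ : Type*} [NormedAddCommGroup EH₀] [NormedSpace 𝕜 EH₀]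
  {H₀ : Type*} [TopologicalSpace H₀] [ChartedSpace EH₀ H₀] [Group H₀]
  [LieGroup 𝓘(𝕜, EH₀) ∞ H₀]
  {𝔤₀ : Type*} [NormedAddCommGroup 𝔤₀] [NormedSpace 𝕜 𝔤₀]
  {EH₁ : Type*} [NormedAddCommGroup EH₁] [NormedSpace 𝕜 EH₁]
  {H₁ : Type*} [TopologicalSpace H₁] [ChartedSpace EH₁ H₁] [Group H₁]
  [LieGroup 𝓘(𝕜, EH₁) ∞ H₁]
  {𝔤₁ : Type*} [NormedAddCommGroup 𝔤₁] [NormedSpace 𝕜 𝔤₁]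
  {𝓜₀ : LocalModel 𝕜 EH₀ H₀ 𝔤₀} {𝓜₁ : LocalModel 𝕜 EH₁ H₁ 𝔤₁}
  {EM : Type*} [NormedAddCommGroup EM] [NormedSpace 𝕜 EM]
  {M : Type*} [TopologicalSpace M] [ChartedSpace EM M]
  {EE₀ : Type*} [NormedAddCommGroup EE₀] [NormedSpace 𝕜 EE₀]
  {E₀ : Type*} [TopologicalSpace E₀] [ChartedSpace EE₀ E₀] [IsManifold 𝓘(𝕜, EE₀) ∞ E₀]

namespace Extension

variable {Φ : ModelMorphism 𝓜₀ 𝓜₁} {G₀ : CartanGeometry 𝓜₀ EM M EE₀ E₀}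
  [ChartedSpace (EM × EH₁) (Extension Φ G₀)]

namespace IsCompatible

variable (hC : IsCompatible Φ G₀)

include hC

/-- In a trivialization the quotient map reads `(e, h) ↦ (π₀ e, Φ(κ(e)) h)`. -/
theorem contMDiff_mk :
    ContMDiff (𝓘(𝕜, EE₀).prod 𝓘(𝕜, EH₁)) 𝓘(𝕜, EM × EH₁) ∞ (mk Φ G₀) := by
  intro p
  obtain ⟨s, hs⟩ := G₀.exists_localSection (G₀.proj p.1)
  set V : Set (E₀ × H₁) := (fun p => G₀.proj p.1) ⁻¹' s.U with hV
  have hVo : IsOpen V := s.isOpen_U.preimage (G₀.contMDiff_proj.continuous.comp continuous_fst)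
  have h1 : ContMDiffOn (𝓘(𝕜, EE₀).prod 𝓘(𝕜, EH₁)) 𝓘(𝕜, EH₁) ∞
      (fun p : E₀ × H₁ => Φ.grp (s.fib p.1) * p.2) V :=
    (Φ.grp.contMDiff_toFun.comp_contMDiffOn
      (s.contMDiffOn_fib.comp contMDiffOn_fst fun p hp => hp)).mul contMDiffOn_snd
  have h2 : ContMDiffOn (𝓘(𝕜, EE₀).prod 𝓘(𝕜, EH₁)) 𝓘(𝕜, EM) ∞
      (fun p : E₀ × H₁ => G₀.proj p.1) V := G₀.contMDiff_proj.comp_contMDiffOn contMDiffOn_fst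
  refine (((hC.contMDiffOn_symm s).comp (h2.prodMk h1) fun p hp => ⟨hp, trivial⟩).congr
    fun p hp => ?_).contMDiffAt (hVo.mem_nhds hs)
  change _ = (trivialization Φ s).symm (G₀.proj p.1, Φ.grp (s.fib p.1) * p.2)
  rw [trivialization_symm_apply, ← mk_act, s.act_sec _ hp]

theorem contMDiff_proj : ContMDiff 𝓘(𝕜, EM × EH₁) 𝓘(𝕜, EM) ∞ (proj Φ G₀) := by
  intro x
  obtain ⟨s, hs⟩ := G₀.exists_localSection (proj Φ G₀ x)
  exact (contMDiff_fst.comp_contMDiffOn (hC.contMDiffOn s)).contMDiffAt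
    ((trivialization Φ s).open_source.mem_nhds hs)

theorem contMDiffOn_fib (s : G₀.LocalSection) :
    ContMDiffOn 𝓘(𝕜, EM × EH₁) 𝓘(𝕜, EH₁) ∞ (fib s) (proj Φ G₀ ⁻¹' s.U) :=
  contMDiff_snd.comp_contMDiffOn (hC.contMDiffOn s)

/-- The quotient map `E₀ × H₁ → E₁` has smooth local sections through every point. -/
theorem exists_lift (p : E₀ × H₁) :
    ∃ (V : Set (Extension Φ G₀)) (a : Extension Φ G₀ → E₀) (b : Extension Φ G₀ → H₁),
      IsOpen V ∧ mk Φ G₀ p ∈ V ∧ ContMDiffOn 𝓘(𝕜, EM × EH₁) 𝓘(𝕜, EE₀) ∞ a V ∧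
      ContMDiffOn 𝓘(𝕜, EM × EH₁) 𝓘(𝕜, EH₁) ∞ b V ∧ (a (mk Φ G₀ p), b (mk Φ G₀ p)) = p ∧
      ∀ x ∈ V, mk Φ G₀ (a x, b x) = x := by
  obtain ⟨s, hs⟩ := G₀.exists_localSection (G₀.proj p.1)
  -- The section is translated by `k`, so that the lift passes through `p` itself and not merely
  -- through its orbit.
  set k := s.fib p.1 with hk
  refine ⟨proj Φ G₀ ⁻¹' s.U, fun x => G₀.act (s.sec (proj Φ G₀ x)) k,
    fun x => (Φ.grp k)⁻¹ * fib s x, s.isOpen_U.preimage (continuous_proj Φ G₀), hs, ?_, ?_, ?_, ?_⟩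
  · exact G₀.contMDiff_act.comp_contMDiffOn ((s.contMDiffOn_sec.comp
      hC.contMDiff_proj.contMDiffOn fun x hx => hx).prodMk contMDiffOn_const)
  · exact contMDiffOn_const.mul (hC.contMDiffOn_fib s)
  · refine Prod.ext (s.act_sec _ hs) ?_
    simp [fib_mk s hs, hk]
  · intro x hx
    rw [mk_act, mul_inv_cancel_left, mk_sec_fib s hx]

theorem exists_lift' (x : Extension Φ G₀) :
    ∃ (V : Set (Extension Φ G₀)) (a : Extension Φ G₀ → E₀) (b : Extension Φ G₀ → H₁),
      IsOpen V ∧ x ∈ V ∧ ContMDiffOn 𝓘(𝕜, EM × EH₁) 𝓘(𝕜, EE₀) ∞ a V ∧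
      ContMDiffOn 𝓘(𝕜, EM × EH₁) 𝓘(𝕜, EH₁) ∞ b V ∧
      ∀ x ∈ V, mk Φ G₀ (a x, b x) = x := by
  obtain ⟨p, rfl⟩ := mk_surjective Φ G₀ x
  obtain ⟨V, a, b, h1, h2, h3, h4, -, h5⟩ := hC.exists_lift p
  exact ⟨V, a, b, h1, h2, h3, h4, h5⟩

/-- Locally `f` is `f ∘ mk` composed with a smooth section of the quotient map. -/
theorem contMDiff_of_comp_mk {EY : Type*} [NormedAddCommGroup EY] [NormedSpace 𝕜 EY]
    {Y : Type*} [TopologicalSpace Y] [ChartedSpace EY Y] {f : Extension Φ G₀ → Y}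
    (hf : ContMDiff (𝓘(𝕜, EE₀).prod 𝓘(𝕜, EH₁)) 𝓘(𝕜, EY) ∞ (f ∘ mk Φ G₀)) :
    ContMDiff 𝓘(𝕜, EM × EH₁) 𝓘(𝕜, EY) ∞ f := by
  intro x
  obtain ⟨V, a, b, hV, hx, ha, hb, hab⟩ := hC.exists_lift' x
  refine ((hf.comp_contMDiffOn (ha.prodMk hb)).congr fun y hy => ?_).contMDiffAt (hV.mem_nhds hx)
  simp [hab y hy]

theorem mdifferentiable_mk :
    MDifferentiable (𝓘(𝕜, EE₀).prod 𝓘(𝕜, EH₁)) 𝓘(𝕜, EM × EH₁) (mk Φ G₀) :=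
  hC.contMDiff_mk.mdifferentiable (by simp)

/-- The chain rule for a local section of the quotient map. -/
theorem mfderiv_mk_lift {V : Set (Extension Φ G₀)} {a : Extension Φ G₀ → E₀}
    {b : Extension Φ G₀ → H₁} (hV : IsOpen V)
    (ha : ContMDiffOn 𝓘(𝕜, EM × EH₁) 𝓘(𝕜, EE₀) ∞ a V)
    (hb : ContMDiffOn 𝓘(𝕜, EM × EH₁) 𝓘(𝕜, EH₁) ∞ b V)
    (hab : ∀ x ∈ V, mk Φ G₀ (a x, b x) = x) {x : Extension Φ G₀} (hx : x ∈ V)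
    (z : TangentSpace 𝓘(𝕜, EM × EH₁) x) :
    mfderiv (𝓘(𝕜, EE₀).prod 𝓘(𝕜, EH₁)) 𝓘(𝕜, EM × EH₁) (mk Φ G₀) (a x, b x)
      (mfderiv 𝓘(𝕜, EM × EH₁) 𝓘(𝕜, EE₀) a x z, mfderiv 𝓘(𝕜, EM × EH₁) 𝓘(𝕜, EH₁) b x z) = z := by
  have ha' : MDifferentiableAt 𝓘(𝕜, EM × EH₁) 𝓘(𝕜, EE₀) a x :=
    (ha.contMDiffAt (hV.mem_nhds hx)).mdifferentiableAt (by simp)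
  have hb' : MDifferentiableAt 𝓘(𝕜, EM × EH₁) 𝓘(𝕜, EH₁) b x :=
    (hb.contMDiffAt (hV.mem_nhds hx)).mdifferentiableAt (by simp)
  have h1 := mfderiv_comp_apply x (hC.mdifferentiable_mk (a x, b x)) (ha'.prodMk hb') z
  rw [mfderiv_prodMk ha' hb'] at h1
  refine h1.symm.trans ?_
  have h2 : (mk Φ G₀ ∘ fun x => (a x, b x)) =ᶠ[nhds x] id := by
    filter_upwards [hV.mem_nhds hx] with y hy using hab y hy
  rw [h2.mfderiv_eq, mfderiv_id]
  rfl

theorem surjective_mfderiv_mk (p : E₀ × H₁) :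
    Surjective (mfderiv (𝓘(𝕜, EE₀).prod 𝓘(𝕜, EH₁)) 𝓘(𝕜, EM × EH₁) (mk Φ G₀) p) := by
  intro z
  obtain ⟨V, a, b, hV, hx, ha, hb, hp, hab⟩ := hC.exists_lift p
  have h := hC.mfderiv_mk_lift hV ha hb hab hx z
  rw [hp] at h
  exact ⟨_, h⟩

end IsCompatible

variable (Φ G₀) in
/-- The form `h₁⁻¹ dh₁ + Ad(h₁)⁻¹ Φ ω₀` at a point, as a linear map. -/
def productFormL (e : E₀) (h : H₁) : EE₀ × EH₁ →ₗ[𝕜] 𝔤₁ :=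
  (𝓜₁.incl ∘ₗ (maurerCartan 𝕜 h : TangentSpace 𝓘(𝕜, EH₁) h →ₗ[𝕜] _)) ∘ₗ LinearMap.snd 𝕜 EE₀ EH₁ +
    (𝓜₁.Ad h⁻¹ ∘ₗ Φ.lin ∘ₗ (G₀.conn e).toLinearMap) ∘ₗ LinearMap.fst 𝕜 EE₀ EH₁

variable [FiniteDimensional 𝕜 EM] [FiniteDimensional 𝕜 EH₁]

/-- The Cartan connection of the extension, computed with a local section of the quotient map. -/
def conn (hC : IsCompatible Φ G₀) : OneForm 𝕜 (EM × EH₁) (Extension Φ G₀) 𝔤₁ := fun x =>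
  let a := (hC.exists_lift' x).choose_spec.choose
  let b := (hC.exists_lift' x).choose_spec.choose_spec.choose
  let da : EM × EH₁ →L[𝕜] EE₀ := mfderiv 𝓘(𝕜, EM × EH₁) 𝓘(𝕜, EE₀) a x
  let db : EM × EH₁ →L[𝕜] EH₁ := mfderiv 𝓘(𝕜, EM × EH₁) 𝓘(𝕜, EH₁) b x
  (LinearMap.toContinuousLinearMap
    (productFormL Φ G₀ (a x) (b x) ∘ₗ (da.prod db).toLinearMap) : EM × EH₁ →L[𝕜] 𝔤₁)

theorem exists_conn_eq (hC : IsCompatible Φ G₀) (x : Extension Φ G₀) :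
    ∃ (V : Set (Extension Φ G₀)) (a : Extension Φ G₀ → E₀) (b : Extension Φ G₀ → H₁),
      IsOpen V ∧ x ∈ V ∧ ContMDiffOn 𝓘(𝕜, EM × EH₁) 𝓘(𝕜, EE₀) ∞ a V ∧
      ContMDiffOn 𝓘(𝕜, EM × EH₁) 𝓘(𝕜, EH₁) ∞ b V ∧
      (∀ x ∈ V, mk Φ G₀ (a x, b x) = x) ∧ ∀ z, conn hC x z = productForm Φ G₀ (a x) (b x)
        (mfderiv 𝓘(𝕜, EM × EH₁) 𝓘(𝕜, EE₀) a x z, mfderiv 𝓘(𝕜, EM × EH₁) 𝓘(𝕜, EH₁) b x z) := by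
  obtain ⟨h1, h2, h3, h4, h5⟩ := (hC.exists_lift' x).choose_spec.choose_spec.choose_spec
  exact ⟨_, _, _, h1, h2, h3, h4, h5, fun z => rfl⟩

omit [ChartedSpace (EM × EH₁) (Extension Φ G₀)] [FiniteDimensional 𝕜 EM]
  [FiniteDimensional 𝕜 EH₁] in
/-- Two smooth local lifts of a map to the extension yield the same form. -/
theorem productForm_lift {a : E₀ × H₁ → E₀} {b : E₀ × H₁ → H₁} {p : E₀ × H₁}
    (ha : ContMDiffAt (𝓘(𝕜, EE₀).prod 𝓘(𝕜, EH₁)) 𝓘(𝕜, EE₀) ∞ a p)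
    (hb : ContMDiffAt (𝓘(𝕜, EE₀).prod 𝓘(𝕜, EH₁)) 𝓘(𝕜, EH₁) ∞ b p)
    (hab : ∀ᶠ y in nhds p, mk Φ G₀ (a y, b y) = mk Φ G₀ y) (u : EE₀ × EH₁) :
    productForm Φ G₀ (a p) (b p)
      (mfderiv (𝓘(𝕜, EE₀).prod 𝓘(𝕜, EH₁)) 𝓘(𝕜, EE₀) a p u,
        mfderiv (𝓘(𝕜, EE₀).prod 𝓘(𝕜, EH₁)) 𝓘(𝕜, EH₁) b p u) =
    productForm Φ G₀ p.1 p.2 u := by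
  obtain ⟨s, hs⟩ := G₀.exists_localSection (G₀.proj p.1)
  have hps : ∀ᶠ y in nhds p, G₀.proj y.1 ∈ s.U :=
    (G₀.contMDiff_proj.continuous.comp continuous_fst).continuousAt.eventually
      (s.isOpen_U.mem_nhds hs)
  have hap : G₀.proj (a p) ∈ s.U := by
    have h := congrArg (proj Φ G₀) hab.self_of_nhds
    simp only [proj_mk] at h
    rw [h]; exact hs
  have hfib : ∀ e, G₀.proj e ∈ s.U → ContMDiffAt 𝓘(𝕜, EE₀) 𝓘(𝕜, EH₀) ∞ s.fib e := fun e he =>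
    s.contMDiffOn_fib.contMDiffAt
      ((s.isOpen_U.preimage G₀.contMDiff_proj.continuous).mem_nhds he)
  -- The orbit relation gives a group element at each point without any smoothness; this formula
  -- recovers the same element and is visibly smooth.
  set k : E₀ × H₁ → H₀ := fun y => (s.fib (a y))⁻¹ * s.fib y.1 with hk
  have hks : ContMDiffAt (𝓘(𝕜, EE₀).prod 𝓘(𝕜, EH₁)) 𝓘(𝕜, EH₀) ∞ k p :=
    ((hfib _ hap).comp p ha).inv.mul ((hfib _ hs).comp p contMDiffAt_fst)
  have hky : ∀ᶠ y in nhds p, y = (G₀.act (a y) (k y), (Φ.grp (k y))⁻¹ * b y) := by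
    filter_upwards [hab, hps] with y hy hys
    obtain ⟨l, hl⟩ := (mk_eq_iff Φ G₀ _ _).1 hy
    have h1 : y.1 = G₀.act (a y) l := congrArg Prod.fst hl
    have hay : G₀.proj (a y) ∈ s.U := by
      rw [h1, G₀.proj_act] at hys; exact hys
    have h2 : k y = l := by
      rw [hk]; simp only
      rw [h1, s.fib_act _ _ hay, inv_mul_cancel_left]
    rw [h2]; exact hl
  have h := productForm_gauge Φ G₀ (ha.mdifferentiableAt (by simp)) (hb.mdifferentiableAt (by simp))
    (hks.mdifferentiableAt (by simp)) u
  refine h.symm.trans ?_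
  have e1 : (fun y => G₀.act (a y) (k y)) =ᶠ[nhds p] Prod.fst :=
    hky.mono fun y hy => (congrArg Prod.fst hy).symm
  have e2 : (fun y => (Φ.grp (k y))⁻¹ * b y) =ᶠ[nhds p] Prod.snd :=
    hky.mono fun y hy => (congrArg Prod.snd hy).symm
  rw [e1.mfderiv_eq, e2.mfderiv_eq, mfderiv_fst, mfderiv_snd]
  have e3 := hky.self_of_nhds
  have e31 := congrArg Prod.fst e3
  have e32 := congrArg Prod.snd e3
  simp only at e31 e32
  rw [← e31, ← e32]
  rfl

/-- The lift chosen in `conn`, composed with `mk`, and the identity of `E₀ × H₁` both lift `mk`, so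
`productForm_lift` compares them. From here on the choice is irrelevant. -/
theorem conn_mk (hC : IsCompatible Φ G₀) (p : E₀ × H₁) (u : EE₀ × EH₁) :
    conn hC (mk Φ G₀ p)
      (mfderiv (𝓘(𝕜, EE₀).prod 𝓘(𝕜, EH₁)) 𝓘(𝕜, EM × EH₁) (mk Φ G₀) p u) =
    productForm Φ G₀ p.1 p.2 u := by
  obtain ⟨V, a, b, hV, hx, ha, hb, hab, hc⟩ := exists_conn_eq hC (mk Φ G₀ p)
  rw [hc]
  have ha' := ha.contMDiffAt (hV.mem_nhds hx)
  have hb' := hb.contMDiffAt (hV.mem_nhds hx)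
  have h := productForm_lift (Φ := Φ) (G₀ := G₀) (ha'.comp p hC.contMDiff_mk.contMDiffAt)
    (hb'.comp p hC.contMDiff_mk.contMDiffAt) (by
      filter_upwards [hC.contMDiff_mk.continuous.continuousAt.eventually (hV.mem_nhds hx)]
        with y hy using hab _ hy) u
  have e1 := mfderiv_comp_apply p (ha'.mdifferentiableAt (by simp)) (hC.mdifferentiable_mk p) u
  have e2 := mfderiv_comp_apply p (hb'.mdifferentiableAt (by simp)) (hC.mdifferentiable_mk p) u
  exact (congrArg₂ (fun v w => productForm Φ G₀ (a (mk Φ G₀ p)) (b (mk Φ G₀ p)) (v, w))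
    e1 e2).symm.trans h

end Extension

end ExtensionSmooth

/-! ### Dimension of a principal bundle -/

section Dimension

variable {𝕜 : Type*} [RCLike 𝕜]
  {EH : Type*} [NormedAddCommGroup EH] [NormedSpace 𝕜 EH] [FiniteDimensional 𝕜 EH]
  {H : Type*} [TopologicalSpace H] [ChartedSpace EH H] [Group H]
  {EM : Type*} [NormedAddCommGroup EM] [NormedSpace 𝕜 EM] [FiniteDimensional 𝕜 EM]
  {M : Type*} [TopologicalSpace M] [ChartedSpace EM M]
  {EE : Type*} [NormedAddCommGroup EE] [NormedSpace 𝕜 EE]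
  {E : Type*} [TopologicalSpace E] [ChartedSpace EE E]

theorem PrincipalBundle.finrank_eq (B : PrincipalBundle 𝕜 EH H EM M EE E) (e : E) :
    Module.finrank 𝕜 EE = Module.finrank 𝕜 EM + Module.finrank 𝕜 EH := by
  obtain ⟨U, hU, hm, φ, hs, -⟩ := B.locally_trivial (B.proj e)
  have he : e ∈ φ.source := by rw [hs]; exact hm
  have hd : IsLocalDiffeomorphAt 𝓘(𝕜, EE) (𝓘(𝕜, EM).prod 𝓘(𝕜, EH)) ∞ φ e :=
    ⟨φ, he, fun _ _ => rfl⟩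
  have h : EE ≃L[𝕜] EM × EH := hd.mfderivToContinuousLinearEquiv (by simp)
  rw [h.toLinearEquiv.finrank_eq, Module.finrank_prod]

end Dimension

/-! ### The extension as a Cartan geometry -/

section ExtensionGeometry

variable {𝕜 : Type*} [RCLike 𝕜]
  {EH₀ : Type*} [NormedAddCommGroup EH₀] [NormedSpace 𝕜 EH₀]
  {H₀ : Type*} [TopologicalSpace H₀] [ChartedSpace EH₀ H₀] [Group H₀]
  [LieGroup 𝓘(𝕜, EH₀) ∞ H₀]
  {𝔤₀ : Type*} [NormedAddCommGroup 𝔤₀] [NormedSpace 𝕜 𝔤₀]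
  {EH₁ : Type*} [NormedAddCommGroup EH₁] [NormedSpace 𝕜 EH₁]
  {H₁ : Type*} [TopologicalSpace H₁] [ChartedSpace EH₁ H₁] [Group H₁]
  [LieGroup 𝓘(𝕜, EH₁) ∞ H₁]
  {𝔤₁ : Type*} [NormedAddCommGroup 𝔤₁] [NormedSpace 𝕜 𝔤₁]
  {𝓜₀ : LocalModel 𝕜 EH₀ H₀ 𝔤₀} {𝓜₁ : LocalModel 𝕜 EH₁ H₁ 𝔤₁}
  {EM : Type*} [NormedAddCommGroup EM] [NormedSpace 𝕜 EM]
  {M : Type*} [TopologicalSpace M] [ChartedSpace EM M]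
  {EE₀ : Type*} [NormedAddCommGroup EE₀] [NormedSpace 𝕜 EE₀]
  {E₀ : Type*} [TopologicalSpace E₀] [ChartedSpace EE₀ E₀] [IsManifold 𝓘(𝕜, EE₀) ∞ E₀]

/-- The quotients `𝔤₀/𝔥₀` and `𝔤₁/𝔥₁` have equal dimension; the additive form avoids truncated
subtraction. -/
theorem ModelMorphism.IsDisguise.finrank_eq [FiniteDimensional 𝕜 𝔤₀] [FiniteDimensional 𝕜 𝔤₁]
    {Φ : ModelMorphism 𝓜₀ 𝓜₁} (hΦ : Φ.IsDisguise) :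
    Module.finrank 𝕜 𝔤₀ + Module.finrank 𝕜 EH₁ = Module.finrank 𝕜 𝔤₁ + Module.finrank 𝕜 EH₀ := by
  have h0 := 𝓜₀.sub.finrank_quotient_add_finrank
  have h1 := 𝓜₁.sub.finrank_quotient_add_finrank
  have e := (LinearEquiv.ofBijective Φ.baseMap hΦ).finrank_eq
  have d0 : Module.finrank 𝕜 𝓜₀.sub = Module.finrank 𝕜 EH₀ :=
    LinearMap.finrank_range_of_inj 𝓜₀.incl_injective
  have d1 : Module.finrank 𝕜 𝓜₁.sub = Module.finrank 𝕜 EH₁ :=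
    LinearMap.finrank_range_of_inj 𝓜₁.incl_injective
  omega

omit [IsManifold 𝓘(𝕜, EE₀) ∞ E₀] in
/-- Every vector of `𝔤₁` is congruent modulo `𝔥₁` to the image of a vector of `𝔤₀`. -/
theorem ModelMorphism.IsDisguise.exists_add {Φ : ModelMorphism 𝓜₀ 𝓜₁} (hΦ : Φ.IsDisguise)
    (A : 𝔤₁) : ∃ B X, A = 𝓜₁.incl X + Φ.lin B := by
  obtain ⟨B', hB⟩ := hΦ.2 (𝓜₁.sub.mkQ A)
  obtain ⟨B, rfl⟩ := 𝓜₀.sub.mkQ_surjective B'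
  have h : 𝓜₁.sub.mkQ (A - Φ.lin B) = 0 := by
    rw [map_sub, ← hB, sub_eq_zero]; rfl
  rw [Submodule.mkQ_apply, Submodule.Quotient.mk_eq_zero] at h
  obtain ⟨X, hX⟩ := h
  exact ⟨B, X, by rw [hX]; abel⟩

omit [LieGroup 𝓘(𝕜, EH₁) ∞ H₁] in
theorem maurerCartan_one (X : GroupLieAlgebra 𝓘(𝕜, EH₁) H₁) :
    maurerCartan 𝕜 (1 : H₁) X = X := by
  have h : (fun k : H₁ => (1 : H₁)⁻¹ * k) = id := by funext k; simp
  simp only [maurerCartan]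
  rw [h, mfderiv_id]
  rfl

theorem maurerCartan_surjective (h : H₁) : Surjective (maurerCartan 𝕜 (EH := EH₁) h) := by
  intro X
  refine ⟨mfderiv 𝓘(𝕜, EH₁) 𝓘(𝕜, EH₁) (fun k : H₁ => h * k) 1 X, ?_⟩
  have h1 := mfderiv_comp_apply_of_eq (y := h) 1 (f := fun k : H₁ => h * k)
    (g := fun k : H₁ => h⁻¹ * k) (mdifferentiable_mul_left (𝕜 := 𝕜) (EH := EH₁) h⁻¹ h)
    (mdifferentiable_mul_left (𝕜 := 𝕜) (EH := EH₁) h 1) (mul_one h) X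
  refine h1.symm.trans ?_
  have h2 : (fun k : H₁ => h⁻¹ * k) ∘ (fun k => h * k) = id := by funext k; simp
  rw [h2, mfderiv_id]
  rfl

/-- The vector to split along `𝔥₁ + Φ(𝔤₀)` is `Ad(h) A`, as `Φ ω₀` enters through `Ad(h)⁻¹`. Its
`𝔥₁`-part stays in `𝔥₁` under `Ad(h)⁻¹` and is attained by the Maurer-Cartan form. -/
theorem productForm_surjective {Φ : ModelMorphism 𝓜₀ 𝓜₁} (hΦ : Φ.IsDisguise)
    (G₀ : CartanGeometry 𝓜₀ EM M EE₀ E₀) (e : E₀) (h : H₁) (A : 𝔤₁) :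
    ∃ u : EE₀ × EH₁, productForm Φ G₀ e h u = A := by
  obtain ⟨B, X, hA⟩ := hΦ.exists_add (𝓜₁.Ad h A)
  obtain ⟨v, hv⟩ := (G₀.bijective e).2 B
  obtain ⟨w, hw⟩ := maurerCartan_surjective (𝕜 := 𝕜) h
    (mfderiv 𝓘(𝕜, EH₁) 𝓘(𝕜, EH₁) (fun k : H₁ => h⁻¹ * k * h⁻¹⁻¹) 1 X)
  refine ⟨(v, w), ?_⟩
  have h1 : A = 𝓜₁.Ad h⁻¹ (𝓜₁.Ad h A) := by
    rw [← Module.End.mul_apply, ← map_mul]; simp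
  rw [h1, hA, map_add, ← 𝓜₁.incl_Ad, ← hv]
  exact congrArg (fun Y => 𝓜₁.incl Y + 𝓜₁.Ad h⁻¹ (Φ.lin (G₀.conn e v))) hw

namespace Extension

variable {Φ : ModelMorphism 𝓜₀ 𝓜₁} {G₀ : CartanGeometry 𝓜₀ EM M EE₀ E₀}
  [ChartedSpace (EM × EH₁) (Extension Φ G₀)]
  [FiniteDimensional 𝕜 EM] [FiniteDimensional 𝕜 EH₁]

theorem conn_mfderiv_mk (hC : IsCompatible Φ G₀)
    {EX : Type*} [NormedAddCommGroup EX] [NormedSpace 𝕜 EX]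
    {HX : Type*} [TopologicalSpace HX] {I : ModelWithCorners 𝕜 EX HX}
    {X : Type*} [TopologicalSpace X] [ChartedSpace HX X] {a : X → E₀} {b : X → H₁} {x : X}
    (ha : MDifferentiableAt I 𝓘(𝕜, EE₀) a x) (hb : MDifferentiableAt I 𝓘(𝕜, EH₁) b x)
    (ξ : TangentSpace I x) :
    conn hC (mk Φ G₀ (a x, b x)) (mfderiv I 𝓘(𝕜, EM × EH₁) (fun y => mk Φ G₀ (a y, b y)) x ξ) =
      productForm Φ G₀ (a x) (b x) (mfderiv I 𝓘(𝕜, EE₀) a x ξ, mfderiv I 𝓘(𝕜, EH₁) b x ξ) := by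
  have h1 := mfderiv_comp_apply x (hC.mdifferentiable_mk (a x, b x)) (ha.prodMk hb) ξ
  rw [mfderiv_prodMk ha hb] at h1
  exact (congrArg (conn hC (mk Φ G₀ (a x, b x))) h1).trans (conn_mk hC _ _)

theorem conn_surjective (hC : IsCompatible Φ G₀) (hΦ : Φ.IsDisguise) (x : Extension Φ G₀) :
    Surjective (conn hC x) := by
  obtain ⟨p, rfl⟩ := mk_surjective Φ G₀ x
  intro A
  obtain ⟨u, hu⟩ := productForm_surjective hΦ G₀ p.1 p.2 A
  exact ⟨_, (conn_mk hC p u).trans hu⟩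

/-- As `dim 𝔤₀ = dim E₀ = dim M + dim H₀`, the disguise condition gives `dim 𝔤₁ = dim M + dim H₁`,
so surjectivity suffices. -/
theorem conn_bijective [FiniteDimensional 𝕜 𝔤₀] [FiniteDimensional 𝕜 𝔤₁]
    [FiniteDimensional 𝕜 EH₀] (hC : IsCompatible Φ G₀) (hΦ : Φ.IsDisguise) (x : Extension Φ G₀) :
    Bijective (conn hC x) := by
  refine ⟨?_, conn_surjective hC hΦ x⟩
  let L : EM × EH₁ →ₗ[𝕜] 𝔤₁ := (conn hC x).toLinearMap
  have hd : Module.finrank 𝕜 (EM × EH₁) = Module.finrank 𝕜 𝔤₁ := by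
    have h1 := G₀.finrank_eq x.out.1
    let L₀ : EE₀ →ₗ[𝕜] 𝔤₀ := (G₀.conn x.out.1).toLinearMap
    have h2 := (LinearEquiv.ofBijective L₀ (G₀.bijective x.out.1)).finrank_eq
    have h3 := hΦ.finrank_eq
    rw [Module.finrank_prod]
    omega
  exact (LinearMap.injective_iff_surjective_of_finrank_eq_finrank (f := L) hd).2
    (conn_surjective hC hΦ x)

theorem conn_isSmooth [FiniteDimensional 𝕜 𝔤₀] [FiniteDimensional 𝕜 𝔤₁]
    [IsManifold 𝓘(𝕜, EM × EH₁) ∞ (Extension Φ G₀)] (hC : IsCompatible Φ G₀) :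
    (conn hC).IsSmooth := by
  intro v
  obtain ⟨V, a, b, hV, hx, ha, hb, hab⟩ := hC.exists_lift' v.1
  have hTa := contMDiffOn_tangentMap hV ha
  have hTb := contMDiffOn_tangentMap hV hb
  have hVo : IsOpen (Bundle.TotalSpace.proj ⁻¹' V :
      Set (TangentBundle 𝓘(𝕜, EM × EH₁) (Extension Φ G₀))) :=
    hV.preimage (Bundle.contMDiff_proj (n := ∞) (IB := 𝓘(𝕜, EM × EH₁))
      (TangentSpace 𝓘(𝕜, EM × EH₁) : Extension Φ G₀ → Type _)).continuous
  have h1 : ContMDiffOn 𝓘(𝕜, EM × EH₁).tangent 𝓘(𝕜, 𝔤₁) ∞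
      (fun v => 𝓜₁.incl (maurerCartan 𝕜 (tangentMap 𝓘(𝕜, EM × EH₁) 𝓘(𝕜, EH₁) b v).1
        (tangentMap 𝓘(𝕜, EM × EH₁) 𝓘(𝕜, EH₁) b v).2)) (Bundle.TotalSpace.proj ⁻¹' V) := by
    let ι : EH₁ →ₗ[𝕜] 𝔤₁ := 𝓜₁.incl
    have h2 : ContMDiff 𝓘(𝕜, EH₁) 𝓘(𝕜, 𝔤₁) ∞ ι := (LinearMap.toContinuousLinearMap ι).contMDiff
    exact (h2.comp contMDiff_maurerCartan).comp_contMDiffOn hTb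
  have h3 : ContMDiffOn 𝓘(𝕜, EM × EH₁).tangent 𝓘(𝕜, 𝔤₁) ∞
      (fun v => 𝓜₁.Ad (b v.1)⁻¹ (Φ.lin (G₀.conn (tangentMap 𝓘(𝕜, EM × EH₁) 𝓘(𝕜, EE₀) a v).1
        (tangentMap 𝓘(𝕜, EM × EH₁) 𝓘(𝕜, EE₀) a v).2))) (Bundle.TotalSpace.proj ⁻¹' V) := by
    have h4 : ContMDiff 𝓘(𝕜, 𝔤₀) 𝓘(𝕜, 𝔤₁) ∞ (fun w => Φ.lin w) :=
      (LinearMap.toContinuousLinearMap Φ.lin).contMDiff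
    have h5 := (h4.comp G₀.smooth).comp_contMDiffOn hTa
    have h6 : ContMDiffOn 𝓘(𝕜, EM × EH₁).tangent 𝓘(𝕜, EH₁) ∞ (fun v => (b v.1)⁻¹)
        (Bundle.TotalSpace.proj ⁻¹' V :
          Set (TangentBundle 𝓘(𝕜, EM × EH₁) (Extension Φ G₀))) :=
      (hb.comp (Bundle.contMDiff_proj _).contMDiffOn fun x hx => hx).inv
    exact 𝓜₁.contMDiff_Ad.comp_contMDiffOn (h6.prodMk h5)
  -- Although `conn` may use a different lift at each point, `conn_mk` shows that this one lift
  -- computes it on all of `V`.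
  refine ((h1.add h3).congr fun w hw => ?_).contMDiffAt (hVo.mem_nhds hx)
  have h7 := hC.mfderiv_mk_lift hV ha hb hab (x := w.1) hw w.2
  have h8 := conn_mk hC (a w.1, b w.1) (mfderiv 𝓘(𝕜, EM × EH₁) 𝓘(𝕜, EE₀) a w.1 w.2,
    mfderiv 𝓘(𝕜, EM × EH₁) 𝓘(𝕜, EH₁) b w.1 w.2)
  refine Eq.trans ?_ h8
  exact (congrArg (conn hC w.1) h7.symm).trans ((conn hC).apply_congr (hab _ hw).symm _)

omit [FiniteDimensional 𝕜 EM] [FiniteDimensional 𝕜 EH₁] in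
theorem contMDiff_act (hC : IsCompatible Φ G₀) :
    ContMDiff (𝓘(𝕜, EM × EH₁).prod 𝓘(𝕜, EH₁)) 𝓘(𝕜, EM × EH₁) ∞
      (fun q : Extension Φ G₀ × H₁ => act Φ G₀ q.1 q.2) := by
  intro q
  obtain ⟨V, a, b, hV, hx, ha, hb, hab⟩ := hC.exists_lift' q.1
  have h1 := hC.contMDiff_mk.comp_contMDiffOn
    ((ha.comp (contMDiffOn_fst (s := V ×ˢ (univ : Set H₁))) fun x hx => hx.1).prodMk
      ((hb.comp (contMDiffOn_fst (s := V ×ˢ (univ : Set H₁))) fun x hx => hx.1).mul contMDiffOn_snd))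
  refine (h1.congr fun y hy => ?_).contMDiffAt ((hV.prod isOpen_univ).mem_nhds ⟨hx, trivial⟩)
  exact (congrArg (fun x => act Φ G₀ x y.2) (hab _ hy.1)).symm

/-- The extension as a principal bundle. -/
def principalBundle (hC : IsCompatible Φ G₀) :
    PrincipalBundle 𝕜 EH₁ H₁ EM M (EM × EH₁) (Extension Φ G₀) where
  proj := proj Φ G₀
  act := act Φ G₀
  act_one x := by
    obtain ⟨p, rfl⟩ := mk_surjective Φ G₀ x
    simp
  act_mul x h k := by
    obtain ⟨p, rfl⟩ := mk_surjective Φ G₀ x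
    simp [mul_assoc]
  contMDiff_proj := hC.contMDiff_proj
  contMDiff_act := contMDiff_act hC
  proj_act x h := by
    obtain ⟨p, rfl⟩ := mk_surjective Φ G₀ x
    simp
  locally_trivial m := by
    obtain ⟨s, hs⟩ := G₀.exists_localSection m
    refine ⟨s.U, s.isOpen_U, hs, ⟨(trivialization Φ s).toPartialEquiv, (trivialization Φ s).open_source,
      (trivialization Φ s).open_target, hC.contMDiffOn s, hC.contMDiffOn_symm s⟩, rfl, rfl,
      fun x hx => rfl, fun x hx h => ?_⟩
    obtain ⟨p, rfl⟩ := mk_surjective Φ G₀ x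
    refine Prod.ext rfl ?_
    change fib s (mk Φ G₀ _) = fib s (mk Φ G₀ p) * h
    have hp : G₀.proj p.1 ∈ s.U := hx
    rw [fib_mk s hp, fib_mk s (p := (p.1, p.2 * h)) hp, mul_assoc]

/-- The extension as a Cartan geometry. -/
def geometry [FiniteDimensional 𝕜 𝔤₀] [FiniteDimensional 𝕜 𝔤₁] [FiniteDimensional 𝕜 EH₀]
    [IsManifold 𝓘(𝕜, EM × EH₁) ∞ (Extension Φ G₀)] (hC : IsCompatible Φ G₀) (hΦ : Φ.IsDisguise) :
    CartanGeometry 𝓜₁ EM M (EM × EH₁) (Extension Φ G₀) where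
  toPrincipalBundle := principalBundle hC
  conn := conn hC
  smooth := conn_isSmooth hC
  bijective := conn_bijective hC hΦ
  equivariant k x z := by
    obtain ⟨p, rfl⟩ := mk_surjective Φ G₀ x
    obtain ⟨u, rfl⟩ := hC.surjective_mfderiv_mk p z
    have hr : MDifferentiableAt 𝓘(𝕜, EM × EH₁) 𝓘(𝕜, EM × EH₁) (fun x => act Φ G₀ x k)
        (mk Φ G₀ p) :=
      ((contMDiff_act hC).comp (contMDiff_id.prodMk contMDiff_const)).mdifferentiableAt (by simp)
    have h1 := mfderiv_comp_apply p hr (hC.mdifferentiable_mk p) u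
    have hs : MDifferentiableAt (𝓘(𝕜, EE₀).prod 𝓘(𝕜, EH₁)) 𝓘(𝕜, EH₁)
        (fun q : E₀ × H₁ => q.2 * k) p :=
      (contMDiff_snd.mul contMDiff_const).mdifferentiableAt (n := ∞) (by simp)
    have h2 := conn_mfderiv_mk hC (mdifferentiableAt_fst (x := p)) hs u
    refine (congrArg (conn hC (mk Φ G₀ (p.1, p.2 * k))) h1).symm.trans (h2.trans ?_)
    -- For constant `k` the product rule leaves only `Ad(k)⁻¹` of the Maurer-Cartan term; the other
    -- term scales alike by `(h k)⁻¹ = k⁻¹ h⁻¹`.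
    have h3 := 𝓜₁.incl_maurerCartan_mul (mdifferentiableAt_snd (x := p))
      (mdifferentiableAt_const (c := k)) u
    have h4 : maurerCartan 𝕜 k (mfderiv (𝓘(𝕜, EE₀).prod 𝓘(𝕜, EH₁)) 𝓘(𝕜, EH₁)
        (fun _ : E₀ × H₁ => k) p u) = 0 := by
      rw [mfderiv_const]
      exact map_zero (maurerCartan 𝕜 k)
    refine Eq.trans ?_ (congrArg (𝓜₁.Ad k⁻¹) (conn_mk hC p u)).symm
    simp only [productForm]
    rw [map_add, ← Module.End.mul_apply, ← map_mul, mul_inv_rev, mfderiv_fst]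
    refine congrArg (· + _) (h3.trans ?_)
    rw [h4, map_zero, add_zero, mfderiv_snd]
    rfl
  vertical x X := by
    obtain ⟨p, rfl⟩ := mk_surjective Φ G₀ x
    -- The orbit map is `k ↦ [p.1, p.2 k]`: its `E₀`-component is constant, and left translation
    -- preserves the Maurer-Cartan form.
    have h1 := conn_mfderiv_mk hC (mdifferentiableAt_const (c := p.1))
      (mdifferentiable_mul_left (𝕜 := 𝕜) (EH := EH₁) p.2 1) X
    have h2 := 𝓜₁.incl_maurerCartan_mul (mdifferentiableAt_const (c := p.2))
      (mdifferentiableAt_id (𝕜 := 𝕜) (x := (1 : H₁)) (I := 𝓘(𝕜, EH₁))) X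
    have h3 : maurerCartan 𝕜 p.2 (mfderiv 𝓘(𝕜, EH₁) 𝓘(𝕜, EH₁) (fun _ : H₁ => p.2) 1 X) = 0 := by
      rw [mfderiv_const]
      exact map_zero (maurerCartan 𝕜 p.2)
    have h4 : G₀.conn p.1 (mfderiv 𝓘(𝕜, EH₁) 𝓘(𝕜, EE₀) (fun _ : H₁ => p.1) 1 X) = 0 := by
      rw [mfderiv_const]
      exact map_zero (G₀.conn p.1)
    refine h1.trans ?_
    simp only [productForm]
    rw [h4, map_zero, map_zero, add_zero]
    refine h2.trans ?_
    rw [h3, map_zero, map_zero, zero_add, mfderiv_id]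
    exact congrArg 𝓜₁.incl (maurerCartan_one X)

end Extension

end ExtensionGeometry

/-! ### Exterior derivatives in coordinates -/

section ExteriorDerivative

variable {𝕜 : Type*} [RCLike 𝕜]
  {W : Type*} [NormedAddCommGroup W] [NormedSpace 𝕜 W]
  {E : Type*} [NormedAddCommGroup E] [NormedSpace 𝕜 E]
  {M : Type*} [TopologicalSpace M] [ChartedSpace E M]
  {𝔤 : Type*} [NormedAddCommGroup 𝔤] [NormedSpace 𝕜 𝔤]

variable (𝕜 W 𝔤) in
/-- Continuous linear maps as alternating maps of one variable. -/
def oneFormL : (W →L[𝕜] 𝔤) →L[𝕜] W [⋀^Fin 1]→L[𝕜] 𝔤 :=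
  LinearMap.mkContinuous
    { toFun := fun f => ContinuousAlternatingMap.ofSubsingleton 𝕜 W 𝔤 (0 : Fin 1) f
      map_add' := fun _ _ => rfl
      map_smul' := fun _ _ => rfl } 1 fun f => by
    refine ContinuousAlternatingMap.opNorm_le_bound _ (by positivity) fun v => ?_
    change ‖f (v 0)‖ ≤ _
    simpa using f.le_opNorm (v 0)

/-- Constant vector fields commute, so the invariant formula has no bracket term. -/
theorem extDeriv_ofSubsingleton {β : W → W →L[𝕜] 𝔤} {w : W} (hβ : DifferentiableAt 𝕜 β w)
    (u u' : W) :
    extDeriv (fun y => ContinuousAlternatingMap.ofSubsingleton 𝕜 W 𝔤 (0 : Fin 1) (β y)) w ![u, u'] =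
      fderiv 𝕜 (fun y => β y u') w u - fderiv 𝕜 (fun y => β y u) w u' := by
  have h : DifferentiableAt 𝕜
      (fun y => ContinuousAlternatingMap.ofSubsingleton 𝕜 W 𝔤 (0 : Fin 1) (β y)) w :=
    (oneFormL 𝕜 W 𝔤).differentiableAt.comp w hβ
  rw [extDeriv_apply h, Fin.sum_univ_two]
  simp [Fin.removeNth, sub_eq_add_neg]

/-- In finite dimension it suffices to fix a vector `v`; then `α` is composed with the tangent map
of the inverse chart along the constant field `v`. -/
theorem OneForm.contDiffOn_inChart [FiniteDimensional 𝕜 E] [IsManifold 𝓘(𝕜, E) ∞ M]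
    {α : OneForm 𝕜 E M 𝔤} (hα : α.IsSmooth) (x : M) :
    ContDiffOn 𝕜 ∞ (α.inChart x) (extChartAt 𝓘(𝕜, E) x).target := by
  rw [contDiffOn_clm_apply]
  intro v
  have h1 : ContMDiff 𝓘(𝕜, E) 𝓘(𝕜, E).tangent ∞
      (fun y : E => (⟨y, v⟩ : TangentBundle 𝓘(𝕜, E) E)) :=
    contMDiff_vectorSpace_iff_contDiff.2 contDiff_const
  have h2 := contMDiffOn_tangentMap (isOpen_extChartAt_target (I := 𝓘(𝕜, E)) x)
    (contMDiffOn_extChartAt_symm x)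
  exact ((hα.comp_contMDiffOn h2).comp h1.contMDiffOn fun y hy => hy).contDiffOn

/-- The exterior derivative of a 1-form on a manifold can be computed after pullback by a smooth map
from a normed space. -/
theorem OneForm.d_mfderiv [FiniteDimensional 𝕜 E] [IsManifold 𝓘(𝕜, E) ∞ M]
    {α : OneForm 𝕜 E M 𝔤} (hα : α.IsSmooth) {f : W → M} {O : Set W} (hO : IsOpen O)
    (hf : ContMDiffOn 𝓘(𝕜, W) 𝓘(𝕜, E) ∞ f O) {w : W} (hw : w ∈ O) {β : W → W →L[𝕜] 𝔤}
    (hβ : ∀ y ∈ O, ∀ u, β y u = α (f y) (mfderiv 𝓘(𝕜, W) 𝓘(𝕜, E) f y u)) (u u' : W) :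
    DifferentiableAt 𝕜 β w ∧
    α.d (f w) (mfderiv 𝓘(𝕜, W) 𝓘(𝕜, E) f w u) (mfderiv 𝓘(𝕜, W) 𝓘(𝕜, E) f w u') =
      fderiv 𝕜 (fun y => β y u') w u - fderiv 𝕜 (fun y => β y u) w u' := by
  set φ := extChartAt 𝓘(𝕜, E) (f w) with hφ
  set g : W → E := φ ∘ f with hg
  have hfw : f w ∈ φ.source := mem_extChartAt_source _
  have hgw : g w ∈ φ.target := mem_extChartAt_target _
  have hφs : ContMDiffOn 𝓘(𝕜, E) 𝓘(𝕜, E) ∞ φ φ.source := by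
    rw [hφ, extChartAt_source]; exact contMDiffOn_extChartAt
  have hφo : IsOpen φ.source := isOpen_extChartAt_source _
  have hφt : IsOpen φ.target := isOpen_extChartAt_target _
  have hφ's : ContMDiffOn 𝓘(𝕜, E) 𝓘(𝕜, E) ∞ φ.symm φ.target := contMDiffOn_extChartAt_symm _
  have hfc : ContMDiffAt 𝓘(𝕜, W) 𝓘(𝕜, E) ∞ f w := hf.contMDiffAt (hO.mem_nhds hw)
  have hO' : ∀ᶠ y in nhds w, y ∈ O ∧ f y ∈ φ.source :=
    (hO.eventually_mem hw).and (hfc.continuousAt.eventually (hφo.mem_nhds hfw))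
  have hgs : ContDiffAt 𝕜 ∞ g w :=
    ((hφs.contMDiffAt (hφo.mem_nhds hfw)).comp w hfc).contDiffAt
  have hdg : ∀ᶠ y in nhds w, DifferentiableAt 𝕜 g y := by
    filter_upwards [hO'] with y hy
    exact (((hφs.contMDiffAt (hφo.mem_nhds hy.2)).comp y
      (hf.contMDiffAt (hO.mem_nhds hy.1))).contDiffAt).differentiableAt (by simp)
  have hc := (α.contDiffOn_inChart hα (f w)).contDiffAt (hφt.mem_nhds hgw)
  -- Near `w`, `β` is the pullback along `g` of the chart expression of `α`, which reduces the claim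
  -- to naturality of `extDeriv` between normed spaces.
  have hβg : β =ᶠ[nhds w] fun y => (α.inChart (f w) (g y)).comp (fderiv 𝕜 g y) := by
    filter_upwards [hO'.eventually_nhds, hdg] with y hy hdy
    have hy0 := hy.self_of_nhds
    have e1 : f =ᶠ[nhds y] φ.symm ∘ g := hy.mono fun z hz => (φ.left_inv hz.2).symm
    have hgy : g y ∈ φ.target := φ.map_source hy0.2
    ext v
    rw [hβ y hy0.1]
    have e2 : (mfderiv 𝓘(𝕜, W) 𝓘(𝕜, E) f y v : E) =
        mfderiv 𝓘(𝕜, E) 𝓘(𝕜, E) φ.symm (g y) (fderiv 𝕜 g y v) := by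
      rw [e1.mfderiv_eq, ← mfderiv_eq_fderiv]
      exact mfderiv_comp_apply y
        ((hφ's.contMDiffAt (hφt.mem_nhds hgy)).mdifferentiableAt (by simp))
        hdy.mdifferentiableAt v
    exact (congrArg (α (f y)) e2).trans (α.apply_congr (φ.left_inv hy0.2).symm _)
  -- The derivative of the preferred chart at its own centre is the identity.
  have hdφ : fderiv 𝕜 g w = mfderiv 𝓘(𝕜, W) 𝓘(𝕜, E) f w := by
    rw [← mfderiv_eq_fderiv, hg, mfderiv_comp w
      ((hφs.contMDiffAt (hφo.mem_nhds hfw)).mdifferentiableAt (by simp))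
      (hfc.mdifferentiableAt (by simp)), hφ, mfderiv_extChartAt_self]
    rfl
  have hd : DifferentiableAt 𝕜 β w := by
    refine DifferentiableAt.congr_of_eventuallyEq ?_ hβg
    exact ((hc.comp w hgs).differentiableAt (by simp)).clm_comp
      ((hgs.fderiv_right (m := ∞) (by simp)).differentiableAt (by simp))
  refine ⟨hd, ?_⟩
  rw [← extDeriv_ofSubsingleton hd]
  have hβg' : (fun y => ContinuousAlternatingMap.ofSubsingleton 𝕜 W 𝔤 (0 : Fin 1) (β y)) =ᶠ[nhds w]
      fun y => (ContinuousAlternatingMap.ofSubsingleton 𝕜 E 𝔤 (0 : Fin 1)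
        (α.inChart (f w) (g y))).compContinuousLinearMap (fderiv 𝕜 g y) :=
    hβg.mono fun y hy => by
      ext v
      simp [hy]
  have hω : DifferentiableAt 𝕜
      (fun z => ContinuousAlternatingMap.ofSubsingleton 𝕜 E 𝔤 (0 : Fin 1) (α.inChart (f w) z))
      (g w) := (oneFormL 𝕜 E 𝔤).differentiableAt.comp (g w) (hc.differentiableAt (by simp))
  rw [hβg'.extDeriv_eq, extDeriv_pullback hω hgs (by
    rw [minSmoothness_of_isRCLikeNormedField]; exact WithTop.coe_le_coe.2 le_top)]
  rw [ContinuousAlternatingMap.compContinuousLinearMap_apply, hdφ]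
  simp only [OneForm.d]
  congr 1
  ext i
  fin_cases i <;> rfl

end ExteriorDerivative

/-! ### Naturality of the exterior derivative -/

section Naturality

variable {𝕜 : Type*} [RCLike 𝕜]
  {E : Type*} [NormedAddCommGroup E] [NormedSpace 𝕜 E]
  {M : Type*} [TopologicalSpace M] [ChartedSpace E M]
  {𝔤 : Type*} [NormedAddCommGroup 𝔤] [NormedSpace 𝕜 𝔤]
  {E' : Type*} [NormedAddCommGroup E'] [NormedSpace 𝕜 E'] [FiniteDimensional 𝕜 E']
  {M' : Type*} [TopologicalSpace M'] [ChartedSpace E' M'] [IsManifold 𝓘(𝕜, E') ∞ M']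
  {𝔤' : Type*} [NormedAddCommGroup 𝔤'] [NormedSpace 𝕜 𝔤']

theorem OneForm.d_congr (α : OneForm 𝕜 E M 𝔤) {p q : M} (h : p = q) (v w : E) :
    α.d p v w = α.d q v w := by
  subst h; rfl

theorem mfderiv_extChartAt_symm_self [IsManifold 𝓘(𝕜, E) ∞ M] (x : M) (v : E) :
    mfderiv 𝓘(𝕜, E) 𝓘(𝕜, E) (extChartAt 𝓘(𝕜, E) x).symm (extChartAt 𝓘(𝕜, E) x x) v = v := by
  have h := mfderivWithin_range_extChartAt_symm (I := 𝓘(𝕜, E)) (x := x)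
  rw [ModelWithCorners.range_eq_univ, mfderivWithin_univ] at h
  rw [h]
  rfl

/-- Naturality of the exterior derivative, for a smooth map which matches the 1-forms up to a linear
map of the coefficients. -/
theorem OneForm.d_pullback [FiniteDimensional 𝕜 E] [IsManifold 𝓘(𝕜, E) ∞ M]
    {α : OneForm 𝕜 E M 𝔤} (hα : α.IsSmooth)
    {α' : OneForm 𝕜 E' M' 𝔤'} (hα' : α'.IsSmooth) {F : M → M'}
    (hF : ContMDiff 𝓘(𝕜, E) 𝓘(𝕜, E') ∞ F) (L : 𝔤 →L[𝕜] 𝔤')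
    (h : ∀ x v, α' (F x) (mfderiv 𝓘(𝕜, E) 𝓘(𝕜, E') F x v) = L (α x v)) (x : M)
    (v w : TangentSpace 𝓘(𝕜, E) x) :
    α'.d (F x) (mfderiv 𝓘(𝕜, E) 𝓘(𝕜, E') F x v) (mfderiv 𝓘(𝕜, E) 𝓘(𝕜, E') F x w) =
      L (α.d x v w) := by
  set φ := extChartAt 𝓘(𝕜, E) x with hφ
  have hx : φ x ∈ φ.target := mem_extChartAt_target _
  have hxx : φ.symm (φ x) = x := φ.left_inv (mem_extChartAt_source _)
  have hφt : IsOpen φ.target := isOpen_extChartAt_target _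
  have hφ's : ContMDiffOn 𝓘(𝕜, E) 𝓘(𝕜, E) ∞ φ.symm φ.target := contMDiffOn_extChartAt_symm _
  have hc := (α.contDiffOn_inChart hα x).contDiffAt (hφt.mem_nhds hx)
  have hchain : ∀ y ∈ φ.target, ∀ u, mfderiv 𝓘(𝕜, E) 𝓘(𝕜, E') (F ∘ φ.symm) y u =
      mfderiv 𝓘(𝕜, E) 𝓘(𝕜, E') F (φ.symm y) (mfderiv 𝓘(𝕜, E) 𝓘(𝕜, E) φ.symm y u) :=
    fun y hy u => mfderiv_comp_apply y (hF.mdifferentiableAt (by simp))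
      ((hφ's.contMDiffAt (hφt.mem_nhds hy)).mdifferentiableAt (by simp)) u
  have hbase : ∀ u : E, (mfderiv 𝓘(𝕜, E) 𝓘(𝕜, E') (F ∘ φ.symm) (φ x) u : E') =
      mfderiv 𝓘(𝕜, E) 𝓘(𝕜, E') F x u := fun u => by
    refine (hchain _ hx u).trans ?_
    rw [hφ, mfderiv_extChartAt_symm_self, ← hφ, hxx]
  -- In the chart at `x` the pullback of `α'` is `L` applied to `α`, and the constant map `L`
  -- commutes with differentiation.
  have h1 := (α'.d_mfderiv hα' (f := F ∘ φ.symm) hφt (hF.comp_contMDiffOn hφ's) hx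
    (β := fun y => L.comp (α.inChart x y)) (fun y hy u => by
      refine (h _ _).symm.trans ?_
      exact congrArg _ (hchain y hy u).symm) v w).2
  have h2 : α.d x v w = _ := extDeriv_ofSubsingleton (hc.differentiableAt (by simp)) v w
  have h3 : ∀ u u' : E, fderiv 𝕜 (fun y => (L.comp (α.inChart x y)) u') (φ x) u =
      L (fderiv 𝕜 (fun y => α.inChart x y u') (φ x) u) := fun u u' => by
    have hd : DifferentiableAt 𝕜 (fun y => α.inChart x y u') (φ x) :=
      (hc.differentiableAt (by simp)).clm_apply (differentiableAt_const _)
    exact congrArg (fun T : E →L[𝕜] 𝔤' => T u) (L.hasFDerivAt.comp (φ x) hd.hasFDerivAt).fderiv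
  refine Eq.trans ?_ (h1.trans ((congrArg₂ (· - ·) (h3 v w) (h3 w v)).trans
    ((map_sub L _ _).symm.trans (congrArg L h2.symm))))
  refine Eq.trans ?_ (α'.d_congr (congrArg F hxx) _ _).symm
  exact congrArg₂ (α'.d (F x)) (hbase v).symm (hbase w).symm

end Naturality

/-! ### Vertical derivatives of a Cartan connection -/

section VerticalDerivative

variable {𝕜 : Type*} [RCLike 𝕜]
  {EH : Type*} [NormedAddCommGroup EH] [NormedSpace 𝕜 EH]
  {H : Type*} [TopologicalSpace H] [ChartedSpace EH H] [Group H] [LieGroup 𝓘(𝕜, EH) ∞ H]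
  {𝔤 : Type*} [NormedAddCommGroup 𝔤] [NormedSpace 𝕜 𝔤] {𝓜 : LocalModel 𝕜 EH H 𝔤}
  {EM : Type*} [NormedAddCommGroup EM] [NormedSpace 𝕜 EM]
  {M : Type*} [TopologicalSpace M] [ChartedSpace EM M]
  {EE : Type*} [NormedAddCommGroup EE] [NormedSpace 𝕜 EE]
  {E : Type*} [TopologicalSpace E] [ChartedSpace EE E] [IsManifold 𝓘(𝕜, EE) ∞ E]

/-- Differentiate `h h⁻¹ = 1` by the product rule; injectivity of `incl` returns the identity to the
Lie algebra. -/
theorem LocalModel.mfderiv_inv_one (𝓜 : LocalModel 𝕜 EH H 𝔤) (X : EH) :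
    (mfderiv 𝓘(𝕜, EH) 𝓘(𝕜, EH) (fun h : H => h⁻¹) 1 X : EH) = -X := by
  have hinv : MDifferentiableAt 𝓘(𝕜, EH) 𝓘(𝕜, EH) (fun h : H => h⁻¹) 1 :=
    (contMDiff_inv 𝓘(𝕜, EH) ∞).mdifferentiableAt (by simp)
  have h1 := 𝓜.incl_maurerCartan_mul (mdifferentiableAt_id (𝕜 := 𝕜) (x := (1 : H))
    (I := 𝓘(𝕜, EH))) hinv X
  have h2 : (fun y : H => id y * y⁻¹) = fun _ => 1 := by funext y; simp
  have h3 : maurerCartan 𝕜 (id (1 : H) * (1 : H)⁻¹)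
      (mfderiv 𝓘(𝕜, EH) 𝓘(𝕜, EH) (fun y : H => id y * y⁻¹) 1 X) = 0 := by
    rw [h2, mfderiv_const]
    exact map_zero (maurerCartan 𝕜 (id (1 : H) * (1 : H)⁻¹))
  rw [h3, map_zero] at h1
  have h4 : (mfderiv 𝓘(𝕜, EH) 𝓘(𝕜, EH) (id : H → H) 1 X : EH) = X := by
    rw [mfderiv_id]; rfl
  have h5 : 𝓜.Ad ((1 : H)⁻¹)⁻¹ (𝓜.incl (maurerCartan 𝕜 (id (1 : H))
      (mfderiv 𝓘(𝕜, EH) 𝓘(𝕜, EH) (id : H → H) 1 X))) = 𝓜.incl X := by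
    rw [inv_inv, map_one, Module.End.one_apply]
    exact congrArg 𝓜.incl ((maurerCartan_one _).trans h4)
  have h6 : 𝓜.incl (maurerCartan 𝕜 (1 : H)⁻¹
      (mfderiv 𝓘(𝕜, EH) 𝓘(𝕜, EH) (fun h : H => h⁻¹) 1 X)) =
      𝓜.incl (mfderiv 𝓘(𝕜, EH) 𝓘(𝕜, EH) (fun h : H => h⁻¹) 1 X) :=
    congrArg 𝓜.incl ((maurerCartan_congr (EH₀ := EH) inv_one _).trans (maurerCartan_one _))
  have h7 := h1.trans (congrArg₂ (· + ·) h5 h6)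
  exact 𝓜.incl_injective (((neg_eq_of_add_eq_zero_right h7.symm).symm).trans
    (map_neg 𝓜.incl X).symm)

theorem LocalModel.mfderiv_Ad_inv [FiniteDimensional 𝕜 𝔤] (𝓜 : LocalModel 𝕜 EH H 𝔤)
    (h𝓜 : 𝓜.InfinitesimallyAdjoint) (X : EH) (A : 𝔤) :
    mfderiv 𝓘(𝕜, EH) 𝓘(𝕜, 𝔤) (fun h : H => 𝓜.Ad h⁻¹ A) 1 X = -𝓜.bracket (𝓜.incl X) A := by
  have hinv : MDifferentiableAt 𝓘(𝕜, EH) 𝓘(𝕜, EH) (fun h : H => h⁻¹) 1 :=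
    (contMDiff_inv 𝓘(𝕜, EH) ∞).mdifferentiableAt (by simp)
  have hAd : MDifferentiableAt 𝓘(𝕜, EH) 𝓘(𝕜, 𝔤) (fun h : H => 𝓜.Ad h A) 1 :=
    (𝓜.contMDiff_Ad.comp (contMDiff_id.prodMk contMDiff_const)).mdifferentiableAt (by simp)
  have h1 := mfderiv_comp_apply_of_eq 1 hAd hinv inv_one X
  refine h1.trans ((congrArg (mfderiv 𝓘(𝕜, EH) 𝓘(𝕜, 𝔤) (fun h : H => 𝓜.Ad h A) 1)
    (𝓜.mfderiv_inv_one X)).trans ?_)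
  exact (map_neg (mfderiv 𝓘(𝕜, EH) 𝓘(𝕜, 𝔤) (fun h : H => 𝓜.Ad h A) 1) _).trans
    (congrArg Neg.neg (h𝓜 X A))

/-- The exterior derivative of a Cartan connection in a vertical direction. -/
theorem CartanGeometry.d_vertical [FiniteDimensional 𝕜 𝔤] [FiniteDimensional 𝕜 EE]
    (G : CartanGeometry 𝓜 EM M EE E) (h𝓜 : 𝓜.InfinitesimallyAdjoint) (e : E) (v : EE) (X : EH) :
    G.conn.d e v (mfderiv 𝓘(𝕜, EH) 𝓘(𝕜, EE) (fun h => G.act e h) 1 X) =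
      𝓜.bracket (𝓜.incl X) (G.conn e v) := by
  set φ := extChartAt 𝓘(𝕜, EE) e with hφ
  set ψ := extChartAt 𝓘(𝕜, EH) (1 : H) with hψ
  have hφe : φ e ∈ φ.target := mem_extChartAt_target _
  have hψ1 : ψ 1 ∈ ψ.target := mem_extChartAt_target _
  have hφφ : φ.symm (φ e) = e := φ.left_inv (mem_extChartAt_source _)
  have hψψ : ψ.symm (ψ 1) = 1 := ψ.left_inv (mem_extChartAt_source _)
  have hφt : IsOpen φ.target := isOpen_extChartAt_target _
  have hψt : IsOpen ψ.target := isOpen_extChartAt_target _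
  have hφs : ContMDiffOn 𝓘(𝕜, EE) 𝓘(𝕜, EE) ∞ φ.symm φ.target := contMDiffOn_extChartAt_symm _
  have hψs : ContMDiffOn 𝓘(𝕜, EH) 𝓘(𝕜, EH) ∞ ψ.symm ψ.target := contMDiffOn_extChartAt_symm _
  have hφd : ∀ y ∈ φ.target, MDifferentiableAt 𝓘(𝕜, EE) 𝓘(𝕜, EE) φ.symm y := fun y hy =>
    (hφs.contMDiffAt (hφt.mem_nhds hy)).mdifferentiableAt (by simp)
  have hψd : ∀ y ∈ ψ.target, MDifferentiableAt 𝓘(𝕜, EH) 𝓘(𝕜, EH) ψ.symm y := fun y hy =>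
    (hψs.contMDiffAt (hψt.mem_nhds hy)).mdifferentiableAt (by simp)
  set O : Set (EE × EH) := φ.target ×ˢ ψ.target with hO
  have hOo : IsOpen O := hφt.prod hψt
  have hw : (φ e, ψ 1) ∈ O := ⟨hφe, hψ1⟩
  set a : EE × EH → E := φ.symm ∘ Prod.fst with ha
  set b : EE × EH → H := ψ.symm ∘ Prod.snd with hb
  have sa : ContMDiffOn 𝓘(𝕜, EE × EH) 𝓘(𝕜, EE) ∞ a O :=
    hφs.comp contDiff_fst.contMDiff.contMDiffOn fun q hq => hq.1
  have sb : ContMDiffOn 𝓘(𝕜, EE × EH) 𝓘(𝕜, EH) ∞ b O :=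
    hψs.comp contDiff_snd.contMDiff.contMDiffOn fun q hq => hq.2
  -- The action map in coordinates around `(e, 1)`. It sends `(v, 0)` to `v` and `(0, X)` to the
  -- vertical vector, so two partial derivatives of the pulled back form give the answer.
  set f : EE × EH → E := fun q => G.act (a q) (b q) with hf
  have sf : ContMDiffOn 𝓘(𝕜, EE × EH) 𝓘(𝕜, EE) ∞ f O :=
    G.contMDiff_act.comp_contMDiffOn (sa.prodMk sb)
  have da : ∀ q ∈ O, ∀ u : EE × EH, mfderiv 𝓘(𝕜, EE × EH) 𝓘(𝕜, EE) a q u =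
      mfderiv 𝓘(𝕜, EE) 𝓘(𝕜, EE) φ.symm q.1 u.1 := fun q hq u => by
    refine (mfderiv_comp_apply q (hφd q.1 hq.1) differentiableAt_fst.mdifferentiableAt u).trans ?_
    rw [mfderiv_eq_fderiv, fderiv_fst]
    rfl
  have db : ∀ q ∈ O, ∀ u : EE × EH, mfderiv 𝓘(𝕜, EE × EH) 𝓘(𝕜, EH) b q u =
      mfderiv 𝓘(𝕜, EH) 𝓘(𝕜, EH) ψ.symm q.2 u.2 := fun q hq u => by
    refine (mfderiv_comp_apply q (hψd q.2 hq.2) differentiableAt_snd.mdifferentiableAt u).trans ?_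
    rw [mfderiv_eq_fderiv, fderiv_snd]
    rfl
  let β : EE × EH → EE × EH →L[𝕜] 𝔤 := fun q =>
    ContinuousLinearMap.comp (M₂ := EE) (G.conn (f q)) (mfderiv 𝓘(𝕜, EE × EH) 𝓘(𝕜, EE) f q)
  have hβ : ∀ q ∈ O, ∀ u : EE × EH, β q u =
      𝓜.Ad (b q)⁻¹ (G.conn (a q) (mfderiv 𝓘(𝕜, EE) 𝓘(𝕜, EE) φ.symm q.1 u.1)) +
      𝓜.incl (maurerCartan 𝕜 (b q) (mfderiv 𝓘(𝕜, EH) 𝓘(𝕜, EH) ψ.symm q.2 u.2)) := by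
    intro q hq u
    refine (G.conn_mfderiv_act ((sa.contMDiffAt (hOo.mem_nhds hq)).mdifferentiableAt (by simp))
      ((sb.contMDiffAt (hOo.mem_nhds hq)).mdifferentiableAt (by simp)) u).trans ?_
    rw [da q hq, db q hq]
  obtain ⟨hd, hmain⟩ := G.conn.d_mfderiv G.smooth hOo sf hw (β := β) (fun q _ u => rfl)
    (v, 0) (0, X)
  have hd' : ∀ u, DifferentiableAt 𝕜 (fun q => β q u) (φ e, ψ 1) := fun u =>
    hd.clm_apply (differentiableAt_const _)
  have iL : HasFDerivAt (fun y : EE => (y, ψ 1)) (ContinuousLinearMap.inl 𝕜 EE EH) (φ e) :=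
    hasFDerivAt_prodMk_left _ _
  have iR : HasFDerivAt (fun z : EH => (φ e, z)) (ContinuousLinearMap.inr 𝕜 EE EH) (ψ 1) :=
    hasFDerivAt_prodMk_right _ _
  have hψX : ∀ X : EH, (mfderiv 𝓘(𝕜, EH) 𝓘(𝕜, EH) ψ.symm (ψ 1) X : EH) = X :=
    mfderiv_extChartAt_symm_self (1 : H)
  have hφv : ∀ v : EE, (mfderiv 𝓘(𝕜, EE) 𝓘(𝕜, EE) φ.symm (φ e) v : EE) = v :=
    mfderiv_extChartAt_symm_self e
  -- Along `h = 1` the connection takes the constant value `X` on the vertical field.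
  have hD1 : fderiv 𝕜 (fun q => β q (0, X)) (φ e, ψ 1) (v, 0) = 0 := by
    have h1 := (hd' (0, X)).hasFDerivAt.comp (φ e) iL
    have h2 : ((fun q => β q (0, X)) ∘ fun y : EE => (y, ψ 1)) =ᶠ[nhds (φ e)]
        fun _ => 𝓜.incl X := by
      filter_upwards [hφt.mem_nhds hφe] with y hy
      refine (hβ (y, ψ 1) ⟨hy, hψ1⟩ (0, X)).trans ?_
      have e1 : 𝓜.Ad (b (y, ψ 1))⁻¹ (G.conn (a (y, ψ 1))
          (mfderiv 𝓘(𝕜, EE) 𝓘(𝕜, EE) φ.symm y 0)) = 0 := by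
        rw [map_zero]
        exact (congrArg _ (map_zero (G.conn (a (y, ψ 1))))).trans (map_zero _)
      have e2 : 𝓜.incl (maurerCartan 𝕜 (b (y, ψ 1))
          (mfderiv 𝓘(𝕜, EH) 𝓘(𝕜, EH) ψ.symm (ψ 1) X)) = 𝓜.incl X :=
        congrArg 𝓜.incl ((maurerCartan_congr (EH₀ := EH) hψψ _).trans
          ((maurerCartan_one _).trans (hψX X)))
      exact (congrArg₂ (· + ·) e1 e2).trans (zero_add _)
    have h3 := h1.unique ((hasFDerivAt_const (𝓜.incl X) (φ e)).congr_of_eventuallyEq h2)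
    simpa using congrArg (fun T : EE →L[𝕜] 𝔤 => T v) h3
  -- Along the fibre the value is `Ad(h)⁻¹ ω(v)`, whose derivative at `1` is minus the bracket.
  have hD2 : fderiv 𝕜 (fun q => β q (v, 0)) (φ e, ψ 1) (0, X) =
      -𝓜.bracket (𝓜.incl X) (G.conn e v) := by
    have h1 := (hd' (v, 0)).hasFDerivAt.comp (ψ 1) iR
    have h2 : ((fun q => β q (v, 0)) ∘ fun z : EH => (φ e, z)) =ᶠ[nhds (ψ 1)]
        (fun h : H => 𝓜.Ad h⁻¹ (G.conn e v)) ∘ ψ.symm := by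
      filter_upwards [hψt.mem_nhds hψ1] with z hz
      refine (hβ (φ e, z) ⟨hφe, hz⟩ (v, 0)).trans ?_
      have e1 : G.conn (a (φ e, z)) (mfderiv 𝓘(𝕜, EE) 𝓘(𝕜, EE) φ.symm (φ e) v) = G.conn e v :=
        (congrArg (G.conn (a (φ e, z))) (hφv v)).trans (G.conn.apply_congr hφφ v)
      have e2 : 𝓜.incl (maurerCartan 𝕜 (b (φ e, z))
          (mfderiv 𝓘(𝕜, EH) 𝓘(𝕜, EH) ψ.symm z 0)) = 0 := by
        rw [map_zero]
        exact (congrArg _ (map_zero (maurerCartan 𝕜 (b (φ e, z))))).trans (map_zero _)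
      exact (congrArg₂ (fun A B => 𝓜.Ad (b (φ e, z))⁻¹ A + B) e1 e2).trans (add_zero _)
    have hAd : MDifferentiableAt 𝓘(𝕜, EH) 𝓘(𝕜, 𝔤) (fun h : H => 𝓜.Ad h⁻¹ (G.conn e v)) 1 :=
      (𝓜.contMDiff_Ad.comp ((contMDiff_inv 𝓘(𝕜, EH) ∞).prodMk contMDiff_const)).mdifferentiableAt
        (by simp)
    have h3 := mfderiv_comp_apply_of_eq (ψ 1) hAd (hψd _ hψ1) hψψ X
    have h4 : fderiv 𝕜 (fun q => β q (v, 0)) (φ e, ψ 1) (0, X) =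
        fderiv 𝕜 ((fun h : H => 𝓜.Ad h⁻¹ (G.conn e v)) ∘ ψ.symm) (ψ 1) X := by
      rw [← h2.fderiv_eq, h1.fderiv]
      simp
    rw [h4, ← mfderiv_eq_fderiv]
    exact h3.trans ((congrArg _ (hψX X)).trans (𝓜.mfderiv_Ad_inv h𝓜 X _))
  rw [hD1, hD2, zero_sub, neg_neg] at hmain
  refine Eq.trans ?_ hmain
  have hfw : f (φ e, ψ 1) = e := by
    change G.act (φ.symm (φ e)) (ψ.symm (ψ 1)) = e
    rw [hφφ, hψψ, G.act_one]
  have hfd : MDifferentiableAt 𝓘(𝕜, EE × EH) 𝓘(𝕜, EE) f (φ e, ψ 1) :=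
    (sf.contMDiffAt (hOo.mem_nhds hw)).mdifferentiableAt (by simp)
  have hv : (mfderiv 𝓘(𝕜, EE × EH) 𝓘(𝕜, EE) f (φ e, ψ 1) (v, 0) : EE) = v := by
    have h1 := mfderiv_comp_apply (φ e) (f := fun y : EE => (y, ψ 1)) hfd
      iL.differentiableAt.mdifferentiableAt v
    rw [mfderiv_eq_fderiv, iL.fderiv] at h1
    have h2 : (f ∘ fun y : EE => (y, ψ 1)) = φ.symm := by
      funext y
      change G.act (φ.symm y) (ψ.symm (ψ 1)) = _
      rw [hψψ, G.act_one]
    rw [h2] at h1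
    exact h1.symm.trans (hφv v)
  have hX : (mfderiv 𝓘(𝕜, EE × EH) 𝓘(𝕜, EE) f (φ e, ψ 1) (0, X) : EE) =
      mfderiv 𝓘(𝕜, EH) 𝓘(𝕜, EE) (fun h => G.act e h) 1 X := by
    have h1 := mfderiv_comp_apply (ψ 1) (f := fun z : EH => (φ e, z)) hfd
      iR.differentiableAt.mdifferentiableAt X
    rw [mfderiv_eq_fderiv, iR.fderiv] at h1
    have h2 : (f ∘ fun z : EH => (φ e, z)) = (fun h => G.act e h) ∘ ψ.symm := by
      funext z
      change G.act (φ.symm (φ e)) (ψ.symm z) = _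
      rw [hφφ]; rfl
    rw [h2] at h1
    have h3 : MDifferentiableAt 𝓘(𝕜, EH) 𝓘(𝕜, EE) (fun h => G.act e h) 1 :=
      (G.contMDiff_act.comp (contMDiff_const.prodMk contMDiff_id)).mdifferentiableAt (by simp)
    have h4 := mfderiv_comp_apply_of_eq (ψ 1) h3 (hψd _ hψ1) hψψ X
    exact h1.symm.trans (h4.trans (congrArg _ (hψX X)))
  exact (G.conn.d_congr hfw.symm _ _).trans (congrArg₂ (G.conn.d _) hv.symm hX.symm)

end VerticalDerivative

/-! ### Existence and uniqueness of curvature -/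

section Curvature

variable {𝕜 : Type*} [RCLike 𝕜]
  {EH : Type*} [NormedAddCommGroup EH] [NormedSpace 𝕜 EH]
  {H : Type*} [TopologicalSpace H] [ChartedSpace EH H] [Group H] [LieGroup 𝓘(𝕜, EH) ∞ H]
  {𝔤 : Type*} [NormedAddCommGroup 𝔤] [NormedSpace 𝕜 𝔤] {𝓜 : LocalModel 𝕜 EH H 𝔤}
  {EM : Type*} [NormedAddCommGroup EM] [NormedSpace 𝕜 EM]
  {M : Type*} [TopologicalSpace M] [ChartedSpace EM M]
  {EE : Type*} [NormedAddCommGroup EE] [NormedSpace 𝕜 EE]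
  {E : Type*} [TopologicalSpace E] [ChartedSpace EE E] [IsManifold 𝓘(𝕜, EE) ∞ E]

theorem LocalModel.bracket_skew (𝓜 : LocalModel 𝕜 EH H 𝔤) (A B : 𝔤) :
    𝓜.bracket B A = -𝓜.bracket A B := by
  have h := 𝓜.bracket_self (A + B)
  simp only [map_add, LinearMap.add_apply, 𝓜.bracket_self, zero_add, add_zero] at h
  exact eq_neg_of_add_eq_zero_left h

theorem LocalModel.half_wedge (𝓜 : LocalModel 𝕜 EH H 𝔤) {V : Type*} (α : V → 𝔤) (v w : V) :
    (1 / 2 : 𝕜) • 𝓜.wedge α v w = 𝓜.bracket (α v) (α w) := by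
  rw [wedge, 𝓜.bracket_skew (α v) (α w), sub_neg_eq_add, ← two_smul 𝕜, smul_smul]
  norm_num

/-- The bracket as an alternating map. -/
def LocalModel.bracketAlternating (𝓜 : LocalModel 𝕜 EH H 𝔤) : 𝔤 [⋀^Fin 2]→ₗ[𝕜] 𝔤 where
  toFun v := 𝓜.bracket (v 0) (v 1)
  map_update_add' v i x y := by fin_cases i <;> simp [Function.update]
  map_update_smul' v i c x := by fin_cases i <;> simp [Function.update]
  map_eq_zero_of_eq' v i j h hij := by
    fin_cases i <;> fin_cases j <;> simp_all [𝓜.bracket_self]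

/-- An alternating form which vanishes when one argument lies in a subspace descends to the
quotient. -/
theorem exists_alternating_quotient {V W : Type*} [AddCommGroup V] [Module 𝕜 V] [AddCommGroup W]
    [Module 𝕜 W] (S : Submodule 𝕜 V) (Ω : V [⋀^Fin 2]→ₗ[𝕜] W) (h : ∀ a, ∀ s ∈ S, Ω ![a, s] = 0) :
    ∃ K : (V ⧸ S) [⋀^Fin 2]→ₗ[𝕜] W, ∀ a b, K ![S.mkQ a, S.mkQ b] = Ω ![a, b] := by
  -- The descended form is `Ω` composed with a linear splitting `s`; `s (S.mkQ a)` differs from `a`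
  -- by an element of `S`, which `Ω` ignores.
  obtain ⟨s, hs⟩ := S.mkQ.exists_rightInverse_of_surjective S.range_mkQ
  have hs' : ∀ a, s (S.mkQ a) - a ∈ S := fun a => by
    rw [← Submodule.Quotient.mk_eq_zero, ← Submodule.mkQ_apply, map_sub, sub_eq_zero]
    exact LinearMap.congr_fun hs (S.mkQ a)
  have h' : ∀ a, ∀ t ∈ S, Ω ![t, a] = 0 := fun a t ht => by
    have := Ω.map_swap ![a, t] (show (0 : Fin 2) ≠ 1 by decide)
    rw [h a t ht, neg_zero] at this
    rw [← this]
    congr 1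
    ext i
    fin_cases i <;> rfl
  have hr : ∀ a b c, Ω ![a, b + c] = Ω ![a, b] + Ω ![a, c] := fun a b c => by
    have h1 := Ω.map_update_add ![a, 0] 1 b c
    have h2 : ∀ x, Function.update ![a, 0] 1 x = ![a, x] := fun x => by
      ext i
      fin_cases i <;> simp
    simpa only [h2] using h1
  have hl : ∀ a b c, Ω ![a + b, c] = Ω ![a, c] + Ω ![b, c] := fun a b c => by
    have h1 := Ω.map_update_add ![0, c] 0 a b
    have h2 : ∀ x, Function.update ![0, c] 0 x = ![x, c] := fun x => by
      ext i
      fin_cases i <;> simp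
    simpa only [h2] using h1
  refine ⟨Ω.compLinearMap s, fun a b => ?_⟩
  have e : (fun i => s (![S.mkQ a, S.mkQ b] i)) =
      ![(s (S.mkQ a) - a) + a, (s (S.mkQ b) - b) + b] := by
    ext i
    fin_cases i <;> simp
  rw [AlternatingMap.compLinearMap_apply]
  refine (congrArg Ω e).trans ?_
  rw [hl, hr, hr, h' _ _ (hs' a), h' _ _ (hs' a), h _ _ (hs' b)]
  simp

theorem CartanGeometry.IsCurvature.apply {G : CartanGeometry 𝓜 EM M EE E}
    {K : E → (𝔤 ⧸ 𝓜.sub) [⋀^Fin 2]→ₗ[𝕜] 𝔤} (hK : G.IsCurvature K) (e : E) (v w : EE) :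
    K e ![𝓜.sub.mkQ (G.conn e v), 𝓜.sub.mkQ (G.conn e w)] =
      G.conn.d e v w + 𝓜.bracket (G.conn e v) (G.conn e w) := by
  exact (hK e v w).symm.trans (congrArg (G.conn.d e v w + ·) (𝓜.half_wedge (G.conn e) v w))

/-- Every pair in `𝔤/𝔥` is the value of the soldering form on a pair of tangent vectors. -/
theorem CartanGeometry.IsCurvature.unique {G : CartanGeometry 𝓜 EM M EE E}
    {K K' : E → (𝔤 ⧸ 𝓜.sub) [⋀^Fin 2]→ₗ[𝕜] 𝔤} (hK : G.IsCurvature K) (hK' : G.IsCurvature K') :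
    K = K' := by
  funext e
  ext x
  obtain ⟨A, hA⟩ := 𝓜.sub.mkQ_surjective (x 0)
  obtain ⟨B, hB⟩ := 𝓜.sub.mkQ_surjective (x 1)
  obtain ⟨v, rfl⟩ := (G.bijective e).2 A
  obtain ⟨w, rfl⟩ := (G.bijective e).2 B
  have hx : x = ![𝓜.sub.mkQ (G.conn e v), 𝓜.sub.mkQ (G.conn e w)] := by
    ext i
    fin_cases i
    · exact hA.symm
    · exact hB.symm
  rw [hx, ← hK e v w, ← hK' e v w]

theorem CartanGeometry.conn_mfderiv_act_one (G : CartanGeometry 𝓜 EM M EE E) (e : E) (X : EH) :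
    G.conn e (mfderiv 𝓘(𝕜, EH) 𝓘(𝕜, EE) (fun h => G.act e h) 1 X : EE) = 𝓜.incl X :=
  (G.conn.apply_congr (G.act_one e).symm _).trans (G.vertical e X)

/-- The coframe carries `dω + ½[ω, ω]` to an alternating form on `𝔤`; by `d_vertical` it vanishes
when one argument lies in `𝔥`, hence descends. -/
theorem CartanGeometry.exists_isCurvature [FiniteDimensional 𝕜 𝔤] [FiniteDimensional 𝕜 EE]
    (G : CartanGeometry 𝓜 EM M EE E) (h𝓜 : 𝓜.InfinitesimallyAdjoint) : ∃ K, G.IsCurvature K := by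
  have key : ∀ e, ∃ K : (𝔤 ⧸ 𝓜.sub) [⋀^Fin 2]→ₗ[𝕜] 𝔤, ∀ v w : EE,
      K ![𝓜.sub.mkQ (G.conn e v), 𝓜.sub.mkQ (G.conn e w)] =
        G.conn.d e v w + 𝓜.bracket (G.conn e v) (G.conn e w) := by
    intro e
    let L : EE →ₗ[𝕜] 𝔤 := (G.conn e).toLinearMap
    let T : EE ≃ₗ[𝕜] 𝔤 := LinearEquiv.ofBijective L (G.bijective e)
    have hT : ∀ v : EE, T.symm (G.conn e v) = v := T.symm_apply_apply
    let D : EE [⋀^Fin 2]→ₗ[𝕜] 𝔤 := (extDeriv (fun y =>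
      ContinuousAlternatingMap.ofSubsingleton 𝕜 EE 𝔤 (0 : Fin 1) (G.conn.inChart e y))
      (extChartAt 𝓘(𝕜, EE) e e)).toAlternatingMap
    have hD : ∀ v w : EE, D ![v, w] = G.conn.d e v w := fun _ _ => rfl
    let Ω : 𝔤 [⋀^Fin 2]→ₗ[𝕜] 𝔤 := D.compLinearMap T.symm.toLinearMap + 𝓜.bracketAlternating
    have hΩ : ∀ v w : EE, Ω ![G.conn e v, G.conn e w] =
        G.conn.d e v w + 𝓜.bracket (G.conn e v) (G.conn e w) := fun v w => by
      have h1 : (fun i => T.symm (![G.conn e v, G.conn e w] i)) = ![v, w] := by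
        ext i
        fin_cases i
        · exact hT v
        · exact hT w
      exact congrArg₂ (· + ·) ((congrArg D h1).trans (hD v w)) rfl
    obtain ⟨K, hK⟩ := exists_alternating_quotient 𝓜.sub Ω (by
      rintro a _ ⟨X, rfl⟩
      obtain ⟨v, rfl⟩ := (G.bijective e).2 a
      have h1 := hΩ v (mfderiv 𝓘(𝕜, EH) 𝓘(𝕜, EE) (fun h => G.act e h) 1 X : EE)
      have h2 := G.conn_mfderiv_act_one e X
      have h3 := G.d_vertical h𝓜 e v X
      refine (congrArg (fun A => Ω ![G.conn e v, A]) h2).symm.trans (h1.trans ?_)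
      refine (congrArg₂ (fun A B => A + 𝓜.bracket (G.conn e v) B) h3 h2).trans ?_
      rw [𝓜.bracket_skew (𝓜.incl X), add_neg_cancel])
    exact ⟨K, fun v w => (hK _ _).trans (hΩ v w)⟩
  choose K hK using key
  refine ⟨K, fun e v w => ?_⟩
  exact (congrArg (G.conn.d e v w + ·) (𝓜.half_wedge (G.conn e) v w)).trans (hK e v w).symm

theorem CartanGeometry.existsUnique_isCurvature [FiniteDimensional 𝕜 𝔤] [FiniteDimensional 𝕜 EE]
    (G : CartanGeometry 𝓜 EM M EE E) (h𝓜 : 𝓜.InfinitesimallyAdjoint) : ∃! K, G.IsCurvature K := by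
  obtain ⟨K, hK⟩ := G.exists_isCurvature h𝓜
  exact ⟨K, hK, fun K' hK' => hK'.unique hK⟩

end Curvature

/-! ### Pullback of curvature -/

section CurvaturePullback

variable {𝕜 : Type*} [RCLike 𝕜]
  {EH₀ : Type*} [NormedAddCommGroup EH₀] [NormedSpace 𝕜 EH₀]
  {H₀ : Type*} [TopologicalSpace H₀] [ChartedSpace EH₀ H₀] [Group H₀]
  [LieGroup 𝓘(𝕜, EH₀) ∞ H₀]
  {𝔤₀ : Type*} [NormedAddCommGroup 𝔤₀] [NormedSpace 𝕜 𝔤₀] [FiniteDimensional 𝕜 𝔤₀]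
  {EH₁ : Type*} [NormedAddCommGroup EH₁] [NormedSpace 𝕜 EH₁]
  {H₁ : Type*} [TopologicalSpace H₁] [ChartedSpace EH₁ H₁] [Group H₁]
  [LieGroup 𝓘(𝕜, EH₁) ∞ H₁]
  {𝔤₁ : Type*} [NormedAddCommGroup 𝔤₁] [NormedSpace 𝕜 𝔤₁]
  {𝓜₀ : LocalModel 𝕜 EH₀ H₀ 𝔤₀} {𝓜₁ : LocalModel 𝕜 EH₁ H₁ 𝔤₁}
  {EM₀ : Type*} [NormedAddCommGroup EM₀] [NormedSpace 𝕜 EM₀]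
  {M₀ : Type*} [TopologicalSpace M₀] [ChartedSpace EM₀ M₀]
  {EE₀ : Type*} [NormedAddCommGroup EE₀] [NormedSpace 𝕜 EE₀] [FiniteDimensional 𝕜 EE₀]
  {E₀ : Type*} [TopologicalSpace E₀] [ChartedSpace EE₀ E₀] [IsManifold 𝓘(𝕜, EE₀) ∞ E₀]
  {EM₁ : Type*} [NormedAddCommGroup EM₁] [NormedSpace 𝕜 EM₁]
  {M₁ : Type*} [TopologicalSpace M₁] [ChartedSpace EM₁ M₁]
  {EE₁ : Type*} [NormedAddCommGroup EE₁] [NormedSpace 𝕜 EE₁] [FiniteDimensional 𝕜 EE₁]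
  {E₁ : Type*} [TopologicalSpace E₁] [ChartedSpace EE₁ E₁] [IsManifold 𝓘(𝕜, EE₁) ∞ E₁]

/-- The curvatures of two geometries related by a smooth map which matches the Cartan connections up
to a linear map. -/
theorem CartanGeometry.IsCurvature.pullback {G₀ : CartanGeometry 𝓜₀ EM₀ M₀ EE₀ E₀}
    {G₁ : CartanGeometry 𝓜₁ EM₁ M₁ EE₁ E₁} {K₀ : E₀ → (𝔤₀ ⧸ 𝓜₀.sub) [⋀^Fin 2]→ₗ[𝕜] 𝔤₀}
    {K₁ : E₁ → (𝔤₁ ⧸ 𝓜₁.sub) [⋀^Fin 2]→ₗ[𝕜] 𝔤₁} (hK₀ : G₀.IsCurvature K₀)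
    (hK₁ : G₁.IsCurvature K₁) {F : E₀ → E₁} (hF : ContMDiff 𝓘(𝕜, EE₀) 𝓘(𝕜, EE₁) ∞ F)
    (L : 𝔤₀ →ₗ[𝕜] 𝔤₁)
    (h : ∀ e v, G₁.conn (F e) (mfderiv 𝓘(𝕜, EE₀) 𝓘(𝕜, EE₁) F e v) = L (G₀.conn e v))
    (e : E₀) (v w : EE₀) :
    K₁ (F e) ![𝓜₁.sub.mkQ (L (G₀.conn e v)), 𝓜₁.sub.mkQ (L (G₀.conn e w))] =
      L (K₀ e ![𝓜₀.sub.mkQ (G₀.conn e v), 𝓜₀.sub.mkQ (G₀.conn e w)]) +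
        𝓜₁.bracket (L (G₀.conn e v)) (L (G₀.conn e w)) -
        L (𝓜₀.bracket (G₀.conn e v) (G₀.conn e w)) := by
  have hd := OneForm.d_pullback G₀.smooth G₁.smooth hF (LinearMap.toContinuousLinearMap L) h e v w
  have h1 := hK₁.apply (F e) (mfderiv 𝓘(𝕜, EE₀) 𝓘(𝕜, EE₁) F e v : EE₁)
    (mfderiv 𝓘(𝕜, EE₀) 𝓘(𝕜, EE₁) F e w : EE₁)
  rw [hK₀.apply e v w, map_add]
  refine (congrArg₂ (fun A B => K₁ (F e) ![𝓜₁.sub.mkQ A, 𝓜₁.sub.mkQ B]) (h e v)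
    (h e w)).symm.trans (h1.trans ((congrArg₂ (· + ·) hd (congrArg₂ (fun A B => 𝓜₁.bracket A B)
      (h e v) (h e w))).trans ?_))
  change L (G₀.conn.d e v w) + _ = _
  abel

end CurvaturePullback

/-! ### The disguise morphism and its universal property -/

section Universal

variable {𝕜 : Type*} [RCLike 𝕜]
  {EH₀ : Type*} [NormedAddCommGroup EH₀] [NormedSpace 𝕜 EH₀]
  {H₀ : Type*} [TopologicalSpace H₀] [ChartedSpace EH₀ H₀] [Group H₀]
  [LieGroup 𝓘(𝕜, EH₀) ∞ H₀]
  {𝔤₀ : Type*} [NormedAddCommGroup 𝔤₀] [NormedSpace 𝕜 𝔤₀]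
  {EH₁ : Type*} [NormedAddCommGroup EH₁] [NormedSpace 𝕜 EH₁]
  {H₁ : Type*} [TopologicalSpace H₁] [ChartedSpace EH₁ H₁] [Group H₁]
  [LieGroup 𝓘(𝕜, EH₁) ∞ H₁]
  {𝔤₁ : Type*} [NormedAddCommGroup 𝔤₁] [NormedSpace 𝕜 𝔤₁]
  {𝓜₀ : LocalModel 𝕜 EH₀ H₀ 𝔤₀} {𝓜₁ : LocalModel 𝕜 EH₁ H₁ 𝔤₁}
  {EM : Type*} [NormedAddCommGroup EM] [NormedSpace 𝕜 EM]
  {M : Type*} [TopologicalSpace M] [ChartedSpace EM M]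
  {EE₀ : Type*} [NormedAddCommGroup EE₀] [NormedSpace 𝕜 EE₀]
  {E₀ : Type*} [TopologicalSpace E₀] [ChartedSpace EE₀ E₀] [IsManifold 𝓘(𝕜, EE₀) ∞ E₀]

namespace Extension

variable {Φ : ModelMorphism 𝓜₀ 𝓜₁} {G₀ : CartanGeometry 𝓜₀ EM M EE₀ E₀}

theorem act_disguise (e : E₀) (h : H₁) : act Φ G₀ (disguise Φ G₀ e) h = mk Φ G₀ (e, h) := by
  rw [disguise, act_mk, one_mul]

variable [ChartedSpace (EM × EH₁) (Extension Φ G₀)]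
  [FiniteDimensional 𝕜 EM] [FiniteDimensional 𝕜 EH₁]

omit [FiniteDimensional 𝕜 EM] [FiniteDimensional 𝕜 EH₁] in
theorem contMDiff_mk_left (hC : IsCompatible Φ G₀) (h : H₁) :
    ContMDiff 𝓘(𝕜, EE₀) 𝓘(𝕜, EM × EH₁) ∞ (fun e => mk Φ G₀ (e, h)) :=
  hC.contMDiff_mk.comp (contMDiff_id.prodMk contMDiff_const)

/-- On a slice `E₀ × {h}` the Maurer-Cartan term vanishes, leaving a constant linear map applied to
`ω₀`, as `IsCurvature.pullback` requires. -/
theorem conn_mfderiv_mk_left (hC : IsCompatible Φ G₀) (h : H₁) (e : E₀) (v : EE₀) :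
    conn hC (mk Φ G₀ (e, h)) (mfderiv 𝓘(𝕜, EE₀) 𝓘(𝕜, EM × EH₁) (fun e => mk Φ G₀ (e, h)) e v) =
      (𝓜₁.Ad h⁻¹ ∘ₗ Φ.lin) (G₀.conn e v) := by
  refine (conn_mfderiv_mk hC mdifferentiableAt_id (mdifferentiableAt_const (c := h)) v).trans ?_
  rw [mfderiv_const, mfderiv_id]
  refine (congrArg (fun A => 𝓜₁.incl A + 𝓜₁.Ad h⁻¹ (Φ.lin (G₀.conn e v)))
    (map_zero (maurerCartan 𝕜 h))).trans ?_
  rw [map_zero, zero_add]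
  rfl

/-- Uniqueness holds because the quotient map is onto with surjective derivatives. -/
theorem eq_conn_iff (hC : IsCompatible Φ G₀)
    (α : OneForm 𝕜 (EM × EH₁) (Extension Φ G₀) 𝔤₁) :
    (∀ (e : E₀) (h : H₁) (u : TangentSpace 𝓘(𝕜, EE₀) e × TangentSpace 𝓘(𝕜, EH₁) h),
      α (mk Φ G₀ (e, h))
        (mfderiv (𝓘(𝕜, EE₀).prod 𝓘(𝕜, EH₁)) 𝓘(𝕜, EM × EH₁) (mk Φ G₀) (e, h) u) =
      productForm Φ G₀ e h u) ↔ α = conn hC := by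
  refine ⟨fun H => ?_, ?_⟩
  · funext x
    obtain ⟨p, rfl⟩ := mk_surjective Φ G₀ x
    refine ContinuousLinearMap.ext fun z => ?_
    obtain ⟨u, rfl⟩ := hC.surjective_mfderiv_mk p z
    exact (H p.1 p.2 u).trans (conn_mk hC p u).symm
  · rintro rfl e h u
    exact conn_mk hC (e, h) u

variable [FiniteDimensional 𝕜 𝔤₀] [FiniteDimensional 𝕜 𝔤₁] [FiniteDimensional 𝕜 EH₀]
  [IsManifold 𝓘(𝕜, EM × EH₁) ∞ (Extension Φ G₀)]

theorem isMorphism_disguise (hC : IsCompatible Φ G₀) (hΦ : Φ.IsDisguise) :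
    IsMorphism Φ G₀ (geometry hC hΦ) (disguise Φ G₀) where
  contMDiff := contMDiff_mk_left hC 1
  map_act e k := by
    refine Eq.trans ?_ (act_disguise e (Φ.grp k)).symm
    rw [disguise, mk_act, mul_one]
  pullback e v := by
    refine (conn_mfderiv_mk_left hC 1 e v).trans ?_
    simp

/-- The comparison of the curvatures of a geometry and its extension. -/
theorem curvature_mk [FiniteDimensional 𝕜 EE₀] (hC : IsCompatible Φ G₀) (hΦ : Φ.IsDisguise)
    {K₀ : E₀ → (𝔤₀ ⧸ 𝓜₀.sub) [⋀^Fin 2]→ₗ[𝕜] 𝔤₀}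
    {K₁ : Extension Φ G₀ → (𝔤₁ ⧸ 𝓜₁.sub) [⋀^Fin 2]→ₗ[𝕜] 𝔤₁} (hK₀ : G₀.IsCurvature K₀)
    (hK₁ : (geometry hC hΦ).IsCurvature K₁) (e : E₀) (h : H₁)
    (u u' : TangentSpace 𝓘(𝕜, EE₀) e × TangentSpace 𝓘(𝕜, EH₁) h) :
    K₁ (mk Φ G₀ (e, h))
      ![𝓜₁.sub.mkQ (productForm Φ G₀ e h u), 𝓜₁.sub.mkQ (productForm Φ G₀ e h u')] =
    𝓜₁.Ad h⁻¹ (Φ.lin (K₀ e ![𝓜₀.sub.mkQ (G₀.conn e u.1), 𝓜₀.sub.mkQ (G₀.conn e u'.1)])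
      + (1 / 2 : 𝕜) • 𝓜₁.wedge (fun v => Φ.lin (G₀.conn e v)) u.1 u'.1
      - (1 / 2 : 𝕜) • Φ.lin (𝓜₀.wedge (G₀.conn e) u.1 u'.1)) := by
  -- Modulo `𝔥₁` the Maurer-Cartan term disappears, so the slice through `h` sees every value of the
  -- soldering form.
  have hmod : ∀ u : TangentSpace 𝓘(𝕜, EE₀) e × TangentSpace 𝓘(𝕜, EH₁) h,
      𝓜₁.sub.mkQ (productForm Φ G₀ e h u) =
        𝓜₁.sub.mkQ ((𝓜₁.Ad h⁻¹ ∘ₗ Φ.lin) (G₀.conn e u.1)) := fun u => by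
    rw [productForm, map_add]
    refine (congrArg (· + _) ?_).trans (zero_add _)
    rw [Submodule.mkQ_apply, Submodule.Quotient.mk_eq_zero]
    exact ⟨_, rfl⟩
  have h1 := hK₀.pullback hK₁ (contMDiff_mk_left hC h) (𝓜₁.Ad h⁻¹ ∘ₗ Φ.lin)
    (fun e v => conn_mfderiv_mk_left hC h e v) e u.1 u'.1
  rw [hmod, hmod]
  refine h1.trans ?_
  -- `Ad(h)⁻¹` preserves brackets and factors out; `Φ.lin` need not, so both bracket terms remain.
  rw [← map_smul, 𝓜₁.half_wedge, 𝓜₀.half_wedge, map_sub, map_add, 𝓜₁.Ad_bracket]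
  rfl

variable {EM' : Type*} [NormedAddCommGroup EM'] [NormedSpace 𝕜 EM']
  {M' : Type*} [TopologicalSpace M'] [ChartedSpace EM' M']
  {EE' : Type*} [NormedAddCommGroup EE'] [NormedSpace 𝕜 EE'] [FiniteDimensional 𝕜 EE']
  {E' : Type*} [TopologicalSpace E'] [ChartedSpace EE' E'] [IsManifold 𝓘(𝕜, EE') ∞ E']

/-- The universal property of the disguise. -/
theorem existsUnique_isLocalIso (hC : IsCompatible Φ G₀) (hΦ : Φ.IsDisguise)
    (G' : CartanGeometry 𝓜₁ EM' M' EE' E') {F : E₀ → E'} (hF : IsMorphism Φ G₀ G' F) :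
    ∃! F₁ : Extension Φ G₀ → E',
      IsLocalIso (geometry hC hΦ) G' F₁ ∧ F = F₁ ∘ disguise Φ G₀ := by
  -- Well defined because `F(e k) Φ(k)⁻¹ h = F(e) h`.
  let F₁ : Extension Φ G₀ → E' := Quotient.lift (fun p : E₀ × H₁ => G'.act (F p.1) p.2) (by
    rintro p _ ⟨k, rfl⟩
    simp [hF.map_act, ← G'.act_mul])
  have hF₁ : ∀ p, F₁ (mk Φ G₀ p) = G'.act (F p.1) p.2 := fun _ => rfl
  have hs : ContMDiff 𝓘(𝕜, EM × EH₁) 𝓘(𝕜, EE') ∞ F₁ := hC.contMDiff_of_comp_mk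
    (G'.contMDiff_act.comp ((hF.contMDiff.comp contMDiff_fst).prodMk contMDiff_snd))
  have hd : ∀ x, MDifferentiableAt 𝓘(𝕜, EM × EH₁) 𝓘(𝕜, EE') F₁ x := hs.mdifferentiable (by simp)
  have hp : ∀ x (z : EM × EH₁),
      G'.conn (F₁ x) (mfderiv 𝓘(𝕜, EM × EH₁) 𝓘(𝕜, EE') F₁ x z) = conn hC x z := by
    intro x z
    obtain ⟨p, rfl⟩ := mk_surjective Φ G₀ x
    obtain ⟨u, rfl⟩ := hC.surjective_mfderiv_mk p z
    have h1 := mfderiv_comp_apply p (hd _) (hC.mdifferentiable_mk p) u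
    have hFd : MDifferentiableAt 𝓘(𝕜, EE₀) 𝓘(𝕜, EE') F p.1 :=
      hF.contMDiff.mdifferentiableAt (by simp)
    have h2 := G'.conn_mfderiv_act (hFd.comp p mdifferentiableAt_fst)
      (mdifferentiableAt_snd (x := p)) u
    have h3 := mfderiv_comp_apply p hFd mdifferentiableAt_fst u
    have h4 : G'.conn (F p.1) (mfderiv (𝓘(𝕜, EE₀).prod 𝓘(𝕜, EH₁)) 𝓘(𝕜, EE')
        (F ∘ Prod.fst) p u) = Φ.lin (G₀.conn p.1 u.1) := by
      refine (congrArg (G'.conn (F p.1)) h3).trans ((hF.pullback p.1 _).trans ?_)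
      rw [mfderiv_fst]
      rfl
    refine (congrArg (G'.conn (F₁ (mk Φ G₀ p))) h1).symm.trans (h2.trans ?_)
    refine Eq.trans ?_ (conn_mk hC p u).symm
    rw [mfderiv_snd]
    exact (congrArg (fun A => 𝓜₁.Ad p.2⁻¹ A + 𝓜₁.incl (maurerCartan 𝕜 p.2 u.2)) h4).trans
      (add_comm _ _)
  -- The derivative intertwines two pointwise isomorphisms onto `𝔤₁`.
  have hb : ∀ x, Bijective (mfderiv 𝓘(𝕜, EM × EH₁) 𝓘(𝕜, EE') F₁ x) := fun x =>
    (Bijective.of_comp_iff' (G'.bijective (F₁ x)) _).1 (by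
      rw [show (G'.conn (F₁ x)) ∘ (mfderiv 𝓘(𝕜, EM × EH₁) 𝓘(𝕜, EE') F₁ x) = conn hC x from
        funext (hp x)]
      exact conn_bijective hC hΦ x)
  have : CompleteSpace EE' := FiniteDimensional.complete 𝕜 EE'
  have : CompleteSpace (EM × EH₁) := FiniteDimensional.complete 𝕜 (EM × EH₁)
  refine ⟨F₁, ⟨⟨isLocalDiffeomorph_of_bijective_mfderiv (by simp) hs hb, fun x k => ?_, hp⟩, ?_⟩,
    fun F₂ hF₂ => ?_⟩
  · obtain ⟨p, rfl⟩ := mk_surjective Φ G₀ x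
    exact G'.act_mul _ _ _
  · funext e
    exact (G'.act_one (F e)).symm
  -- Every point is a translate of a point in the image of the disguise, so equivariance determines
  -- `F₂`.
  · funext x
    obtain ⟨p, rfl⟩ := mk_surjective Φ G₀ x
    have h1 : F₂ (act Φ G₀ (disguise Φ G₀ p.1) p.2) = G'.act (F₂ (disguise Φ G₀ p.1)) p.2 :=
      hF₂.1.map_act (disguise Φ G₀ p.1) p.2
    rw [act_disguise] at h1
    rw [hF₁, hF₂.2]
    exact h1

end Extension

end Universal

end CartanGeom

end

/-! ### The main theorem -/

theorem mainTheorem7 {𝕜 : Type*} [RCLike 𝕜]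
    -- the two local models
    {EH₀ : Type*} [NormedAddCommGroup EH₀] [NormedSpace 𝕜 EH₀] [FiniteDimensional 𝕜 EH₀]
    {H₀ : Type*} [TopologicalSpace H₀] [T2Space H₀] [SecondCountableTopology H₀]
    [ChartedSpace EH₀ H₀] [Group H₀] [LieGroup 𝓘(𝕜, EH₀) ∞ H₀]
    {𝔤₀ : Type*} [NormedAddCommGroup 𝔤₀] [NormedSpace 𝕜 𝔤₀] [FiniteDimensional 𝕜 𝔤₀]
    {EH₁ : Type*} [NormedAddCommGroup EH₁] [NormedSpace 𝕜 EH₁] [FiniteDimensional 𝕜 EH₁]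
    {H₁ : Type*} [TopologicalSpace H₁] [T2Space H₁] [SecondCountableTopology H₁]
    [ChartedSpace EH₁ H₁] [Group H₁] [LieGroup 𝓘(𝕜, EH₁) ∞ H₁]
    {𝔤₁ : Type*} [NormedAddCommGroup 𝔤₁] [NormedSpace 𝕜 𝔤₁] [FiniteDimensional 𝕜 𝔤₁]
    (𝓜₀ : LocalModel 𝕜 EH₀ H₀ 𝔤₀) (𝓜₁ : LocalModel 𝕜 EH₁ H₁ 𝔤₁)
    -- the disguise
    (Φ : ModelMorphism 𝓜₀ 𝓜₁) (hΦ : Φ.IsDisguise)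
    -- the geometry `E₀ → M`
    {EM : Type*} [NormedAddCommGroup EM] [NormedSpace 𝕜 EM] [FiniteDimensional 𝕜 EM]
    {M : Type*} [TopologicalSpace M] [T2Space M] [SecondCountableTopology M]
    [ChartedSpace EM M] [IsManifold 𝓘(𝕜, EM) ∞ M]
    {EE₀ : Type*} [NormedAddCommGroup EE₀] [NormedSpace 𝕜 EE₀] [FiniteDimensional 𝕜 EE₀]
    {E₀ : Type*} [TopologicalSpace E₀] [T2Space E₀] [SecondCountableTopology E₀]
    [ChartedSpace EE₀ E₀] [IsManifold 𝓘(𝕜, EE₀) ∞ E₀]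
    (G₀ : CartanGeometry 𝓜₀ EM M EE₀ E₀) :
    -- the quotient `E₁ = E₀ ×_{H₀} H₁` is a manifold
    T2Space (Extension Φ G₀) ∧ SecondCountableTopology (Extension Φ G₀) ∧
    ∃ (_ : ChartedSpace (EM × EH₁) (Extension Φ G₀))
      (_ : IsManifold 𝓘(𝕜, EM × EH₁) ∞ (Extension Φ G₀)),
      -- for which `E₀ × H₁ → E₁` is a smooth submersion
      ContMDiff (𝓘(𝕜, EE₀).prod 𝓘(𝕜, EH₁)) 𝓘(𝕜, EM × EH₁) ∞ (Extension.mk Φ G₀) ∧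
      (∀ p : E₀ × H₁, Function.Surjective
        (mfderiv (𝓘(𝕜, EE₀).prod 𝓘(𝕜, EH₁)) 𝓘(𝕜, EM × EH₁) (Extension.mk Φ G₀) p)) ∧
      -- and which carries a geometry `E₁ → M` modelled on `(H₁, 𝔤₁)`
      ∃ G₁ : CartanGeometry 𝓜₁ EM M (EM × EH₁) (Extension Φ G₀),
        (∀ (e : E₀) (h : H₁), G₁.proj (Extension.mk Φ G₀ (e, h)) = G₀.proj e) ∧
        (∀ (e : E₀) (h k : H₁),
          G₁.act (Extension.mk Φ G₀ (e, h)) k = Extension.mk Φ G₀ (e, h * k)) ∧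
        -- whose Cartan connection is the unique 1-form pulling back to the given one
        (∀ α : OneForm 𝕜 (EM × EH₁) (Extension Φ G₀) 𝔤₁,
          (∀ (e : E₀) (h : H₁)
            (u : TangentSpace 𝓘(𝕜, EE₀) e × TangentSpace 𝓘(𝕜, EH₁) h),
            α (Extension.mk Φ G₀ (e, h))
              (mfderiv (𝓘(𝕜, EE₀).prod 𝓘(𝕜, EH₁)) 𝓘(𝕜, EM × EH₁) (Extension.mk Φ G₀) (e, h) u)
              = productForm Φ G₀ e h u) ↔ α = G₁.conn) ∧
        -- the map `E₀ → E₁` is a `Φ`-morphism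
        IsMorphism Φ G₀ G₁ (Extension.disguise Φ G₀) ∧
        -- the curvature functions
        (𝓜₀.InfinitesimallyAdjoint → ∃! K₀, G₀.IsCurvature K₀) ∧
        (𝓜₁.InfinitesimallyAdjoint → ∃! K₁, G₁.IsCurvature K₁) ∧
        (∀ K₀ K₁, G₀.IsCurvature K₀ → G₁.IsCurvature K₁ →
          ∀ (e : E₀) (h : H₁)
            (u u' : TangentSpace 𝓘(𝕜, EE₀) e × TangentSpace 𝓘(𝕜, EH₁) h),
            K₁ (Extension.mk Φ G₀ (e, h))
              ![𝓜₁.sub.mkQ (productForm Φ G₀ e h u), 𝓜₁.sub.mkQ (productForm Φ G₀ e h u')] =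
            𝓜₁.Ad h⁻¹
              (Φ.lin (K₀ e ![𝓜₀.sub.mkQ (G₀.conn e u.1), 𝓜₀.sub.mkQ (G₀.conn e u'.1)])
                + (1 / 2 : 𝕜) • 𝓜₁.wedge (fun v => Φ.lin (G₀.conn e v)) u.1 u'.1
                - (1 / 2 : 𝕜) • Φ.lin (𝓜₀.wedge (G₀.conn e) u.1 u'.1))) ∧
        -- every `Φ`-morphism factors uniquely through the disguise
        ∀ {EM' : Type*} [NormedAddCommGroup EM'] [NormedSpace 𝕜 EM'] [FiniteDimensional 𝕜 EM']
          {M' : Type*} [TopologicalSpace M'] [T2Space M'] [SecondCountableTopology M']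
          [ChartedSpace EM' M'] [IsManifold 𝓘(𝕜, EM') ∞ M']
          {EE' : Type*} [NormedAddCommGroup EE'] [NormedSpace 𝕜 EE'] [FiniteDimensional 𝕜 EE']
          {E' : Type*} [TopologicalSpace E'] [T2Space E'] [SecondCountableTopology E']
          [ChartedSpace EE' E'] [IsManifold 𝓘(𝕜, EE') ∞ E']
          (G' : CartanGeometry 𝓜₁ EM' M' EE' E') (F : E₀ → E'), IsMorphism Φ G₀ G' F →
          ∃! F₁ : Extension Φ G₀ → E',
            IsLocalIso G₁ G' F₁ ∧ F = F₁ ∘ Extension.disguise Φ G₀ := by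
  obtain ⟨cs, hm, hC⟩ := Extension.exists_isCompatible Φ G₀
  refine ⟨Extension.t2Space, Extension.secondCountableTopology, cs, hm, hC.contMDiff_mk,
    hC.surjective_mfderiv_mk, Extension.geometry hC hΦ, fun e h => rfl, fun e h k => rfl,
    Extension.eq_conn_iff hC, Extension.isMorphism_disguise hC hΦ,
    G₀.existsUnique_isCurvature, (Extension.geometry hC hΦ).existsUnique_isCurvature,
    fun K₀ K₁ hK₀ hK₁ => Extension.curvature_mk hC hΦ hK₀ hK₁, ?_⟩
  intro EM' _ _ _ M' _ _ _ _ _ EE' _ _ _ E' _ _ _ _ _ G' F hF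
  exact Extension.existsUnique_isLocalIso hC hΦ G' hF
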